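/- Let $d\in\mathbb N$, $d\ge 1$. For $x\in\mathbb R^d$ and $L>0$ let $\Lambda_L(x)=\prod_{i=1}^d[x_i-L/2,x_i+L/2]$, $\Lambda_L=\Lambda_L(0)$, $\tilde\Lambda_L=\Lambda_L\cap\mathbb Z^d$, and let $B(z,\delta)$ be the open Euclidean ball of radius $\delta$ about $z$. Let $\Delta_{\Lambda_L,0}$ and $\Delta_{\Lambda_L,\mathrm{per}}$ be the Laplacians on $L^2(\Lambda_L)$ with Dirichlet and periodic boundary conditions, i.e. the self-adjoint operators associated with the closure of the form $(u,v)\mapsto\int_{\Lambda_L}\nabla u\cdot\nabla v$ on the smooth functions compactly supported in the interior of $\Lambda_L$, respectively on the smooth $(L\mathbb Z)^d$-periodic functions; write $\mathcal D(\cdot)$ for their domains. There is a constant $C=C(d)\in(0,\infty)$ such that for all $K_V\in[0,\infty)$ and $\delta\in(0,1]$ there is a constant $C_{sfUC}=C_{sfUC}(d,K_V,\delta)>0$ with \[ C_{sfUC}\ \ge\ \Bigl(\frac{\delta}{C}\Bigr)^{C+CK_V^{2/3}} \] and the following property. For every odd positive integer $L$, every family $(z_k)_{k\in\mathbb Z^d}$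 in $\mathbb R^d$ with $B(z_k,\delta)\subset\Lambda_1(k)$ for all $k\in\mathbb Z^d$, every measurable $V\colon\Lambda_L\to[-K_V,K_V]$ and every real-valued $\psi\in\mathcal D(\Delta_{\Lambda_L,0})\cup\mathcal D(\Delta_{\Lambda_L,\mathrm{per}})$ with $|\Delta\psi|\le|V\psi|$ almost everywhere on $\Lambda_L$, the set $S_L:=\Lambda_L\cap\bigcup_{k\in\mathbb Z^d}B(z_k,\delta)$ equals $\bigcup_{k\in\tilde\Lambda_L}B(z_k,\delta)$, and \[ \int_{S_L}|\psi(x)|^2\,dx=\sum_{k\in\tilde\Lambda_L}\int_{B(z_k,\delta)}|\psi(x)|^2\,dx\ \ge\ C_{sfUC}\int_{\Lambda_L}|\psi(x)|^2\,dx . \] -/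

import Mathlib

open MeasureTheory Filter Topology
open scoped ContDiff

namespace ScaleFreeUCP

/-- The closed box `[x - L/2, x + L/2]^d` of side length `L` centred at `x`. -/
def box {d : ℕ} (L : ℝ) (x : EuclideanSpace ℝ (Fin d)) : Set (EuclideanSpace ℝ (Fin d)) :=
  {y | ∀ i, y i ∈ Set.Icc (x i - L / 2) (x i + L / 2)}

/-- An integer vector, viewed as a point of `ℝ^d`. -/
def latticePoint {d : ℕ} (k : Fin d → ℤ) : EuclideanSpace ℝ (Fin d) :=
  WithLp.toLp 2 fun i => (k i : ℝ)

/-- The finite set of lattice points in the box of side `L` centred at `0`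
(see `mem_sites`). -/
noncomputable def sites (d : ℕ) (L : ℝ) : Finset (Fin d → ℤ) :=
  Fintype.piFinset fun _ => Finset.Icc ⌈-(L / 2)⌉ ⌊L / 2⌋

theorem mem_sites {d : ℕ} {L : ℝ} {k : Fin d → ℤ} :
    k ∈ sites d L ↔ latticePoint k ∈ box L (0 : EuclideanSpace ℝ (Fin d)) := by
  simp [sites, box, latticePoint, Fintype.mem_piFinset, Int.ceil_le, Int.le_floor]

/-- Lebesgue measure on the box of side `L` centred at `0`. -/
noncomputable def boxMeasure (d : ℕ) (L : ℝ) : Measure (EuclideanSpace ℝ (Fin d)) :=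
  volume.restrict (box L 0)

/-- Smooth functions with compact support in the open box: the form core of the Dirichlet
Laplacian. -/
def dirichletCore (d : ℕ) (L : ℝ) : Set (EuclideanSpace ℝ (Fin d) → ℝ) :=
  {φ | ContDiff ℝ ∞ φ ∧ HasCompactSupport φ ∧ tsupport φ ⊆ interior (box L 0)}

/-- Smooth `(Lℤ)^d`-periodic functions: the form core of the periodic Laplacian. -/
def periodicCore (d : ℕ) (L : ℝ) : Set (EuclideanSpace ℝ (Fin d) → ℝ) :=
  {φ | ContDiff ℝ ∞ φ ∧ ∀ (k : Fin d → ℤ) (x : EuclideanSpace ℝ (Fin d)),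
    φ (x + L • latticePoint k) = φ x}

/-- `G` is the gradient of `ψ`, where `ψ` lies in the closure of `core` with respect to the
`W^{1,2}`-norm on the box (for the Dirichlet core this closure is `W_0^{1,2}`, for the periodic
core it is the periodic `W^{1,2}`-space). -/
def IsFormGradient {d : ℕ} (core : Set (EuclideanSpace ℝ (Fin d) → ℝ)) (L : ℝ)
    (ψ : EuclideanSpace ℝ (Fin d) → ℝ)
    (G : EuclideanSpace ℝ (Fin d) → EuclideanSpace ℝ (Fin d)) : Prop :=
  MemLp ψ 2 (boxMeasure d L) ∧ MemLp G 2 (boxMeasure d L) ∧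
    ∃ φ : ℕ → EuclideanSpace ℝ (Fin d) → ℝ, (∀ n, φ n ∈ core) ∧
      Tendsto (fun n => eLpNorm (fun x => φ n x - ψ x) 2 (boxMeasure d L)) atTop (𝓝 0) ∧
      Tendsto (fun n => eLpNorm (fun x => gradient (φ n) x - G x) 2 (boxMeasure d L))
        atTop (𝓝 0)

/-- `ψ` lies in the domain of the self-adjoint Laplacian on `L²` of the box that is associated
with the closure of the Dirichlet form `(u, v) ↦ ∫ ∇u · ∇v` on `core`, and the Laplacian of `ψ`
is `g`. -/
def HasLaplacian {d : ℕ} (core : Set (EuclideanSpace ℝ (Fin d) → ℝ)) (L : ℝ)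
    (ψ g : EuclideanSpace ℝ (Fin d) → ℝ) : Prop :=
  MemLp g 2 (boxMeasure d L) ∧ ∃ G, IsFormGradient core L ψ G ∧
    ∀ φ ∈ core, ∫ x, inner ℝ (G x) (gradient φ x) ∂boxMeasure d L
      = -∫ x, g x * φ x ∂boxMeasure d L

/-- `ψ` is in the domain of the Dirichlet Laplacian on the box, with Laplacian `g`. -/
def HasDirichletLaplacian {d : ℕ} (L : ℝ) (ψ g : EuclideanSpace ℝ (Fin d) → ℝ) : Prop :=
  HasLaplacian (dirichletCore d L) L ψ g

/-- `ψ` is in the domain of the Laplacian on the box with periodic boundary conditions, with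
Laplacian `g`. -/
def HasPeriodicLaplacian {d : ℕ} (L : ℝ) (ψ g : EuclideanSpace ℝ (Fin d) → ℝ) : Prop :=
  HasLaplacian (periodicCore d L) L ψ g

/-- The part of the union of all the balls `B(z_k, δ)` that lies in the box of side `L`. -/
def ballUnion {d : ℕ} (L δ : ℝ) (z : (Fin d → ℤ) → EuclideanSpace ℝ (Fin d)) :
    Set (EuclideanSpace ℝ (Fin d)) :=
  (⋃ k, Metric.ball (z k) δ) ∩ box L 0

end ScaleFreeUCP

/-!
The function `ψ` is extended from the box to a function on `ℝ^d` with `|Δψ| ≤ K |ψ|`: by periodicity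
under periodic boundary conditions and by odd reflection across the faces under Dirichlet ones.
Around each centre `z_k` a Carleman inequality with the weight `|x|^{-2(n+1)} e^{nβ|x|²}` is applied
to `ψ` cut off near `z_k` and at a distance that is a large multiple of `√d`. The potential term is
absorbed as soon as `n³` dominates `K²`, which is the origin of the exponent `2/3`. The error
produced by the inner cutoff is at most a constant times `(C/δ)^{O(n)} ∫_{B(z_k,δ)} ψ²`, and that of
the outer cutoff is at most `ε ∫ ψ²` over a ball of fixed radius, where `ε` is arbitrarily small for
`n` large, because the weight decreases. Each point lies in at most `N = N(d)` of the large
balls around the `z_k`, so that on summation over the lattice points in the box the outer errors add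
up to at most half of the integral of `ψ²` over the box and are absorbed as well.
-/

namespace ScaleFreeUCP

open scoped Gradient Laplacian Convolution

/-! ### Divergence theorem and integration by parts -/

section Divergence

variable {E : Type*} [NormedAddCommGroup E] [InnerProductSpace ℝ E]
  {f : E → ℝ} {X Y : E → E} {x : E}

/-- The divergence of a vector field: the trace of its derivative. -/
noncomputable def divergence (X : E → E) (x : E) : ℝ :=
  LinearMap.trace ℝ E (fderiv ℝ X x)

theorem divergence_add (hX : DifferentiableAt ℝ X x) (hY : DifferentiableAt ℝ Y x) :
    divergence (fun y => X y + Y y) x = divergence X x + divergence Y x := by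
  simp [divergence, fderiv_fun_add hX hY]

theorem tsupport_divergence_subset : tsupport (divergence X) ⊆ tsupport X :=
  closure_minimal (fun x hx => by
    contrapose! hx
    rw [notMem_tsupport_iff_eventuallyEq] at hx
    simp [divergence, hx.fderiv_eq]) (isClosed_tsupport X)

theorem divergence_eq_sum_fderiv_inner (hX : DifferentiableAt ℝ X x) {ι : Type*} [Fintype ι]
    (b : OrthonormalBasis ι ℝ E) :
    divergence X x = ∑ i, fderiv ℝ (fun y => inner ℝ (b i) (X y)) x (b i) := by
  rw [divergence, LinearMap.trace_eq_sum_inner _ b]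
  refine Finset.sum_congr rfl fun i _ => ?_
  rw [((hasFDerivAt_const (b i) x).inner ℝ hX.hasFDerivAt).fderiv]
  simp

variable [FiniteDimensional ℝ E]

theorem divergence_id : divergence (fun y : E => y) x = Module.finrank ℝ E := by
  simp [divergence]

theorem divergence_smul (hf : DifferentiableAt ℝ f x) (hX : DifferentiableAt ℝ X x) :
    divergence (fun y => f y • X y) x = f x * divergence X x + fderiv ℝ f x (X x) := by
  rw [divergence, fderiv_fun_smul hf hX, ContinuousLinearMap.toLinearMap_add, map_add,
    ContinuousLinearMap.toLinearMap_smul, map_smul, smul_eq_mul, divergence, add_right_inj]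
  exact LinearMap.trace_smulRight _ _

theorem continuous_divergence (hX : ContDiff ℝ 1 X) : Continuous (divergence X) := by
  have sum_eq := fun x => divergence_eq_sum_fderiv_inner (hX.differentiable one_ne_zero x)
    (stdOrthonormalBasis ℝ E)
  rw [funext sum_eq]
  refine continuous_finsetSum _ fun i _ => ?_
  exact ((contDiff_const.inner ℝ hX).continuous_fderiv one_ne_zero).clm_apply continuous_const

variable [MeasurableSpace E] [BorelSpace E]

theorem integral_divergence_eq_zero (hX : ContDiff ℝ 1 X) (hc : HasCompactSupport X) :
    ∫ x, divergence X x = 0 := by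
  let b := stdOrthonormalBasis ℝ E
  have hXb (i) : ContDiff ℝ 1 fun y => inner ℝ (b i) (X y) := contDiff_const.inner ℝ hX
  have hcb (i) : HasCompactSupport fun y => inner ℝ (b i) (X y) :=
    hc.comp_left (g := fun v => inner ℝ (b i) v) (inner_zero_right _)
  have h_int (i) : Integrable fun y => fderiv ℝ (fun y => inner ℝ (b i) (X y)) y (b i) :=
    (((hXb i).continuous_fderiv one_ne_zero).clm_apply
      continuous_const).integrable_of_hasCompactSupport ((hcb i).fderiv_apply ℝ (b i))
  simp_rw [fun x => divergence_eq_sum_fderiv_inner (hX.differentiable one_ne_zero x) b]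
  rw [integral_finsetSum _ fun i _ => h_int i]
  refine Finset.sum_eq_zero fun i _ => ?_
  have parts := integral_mul_fderiv_eq_neg_fderiv_mul_of_integrable (μ := volume)
    (f := fun _ : E => (1 : ℝ)) (g := fun y => inner ℝ (b i) (X y)) (v := b i) (by simp)
    (by simpa using h_int i)
    (by simpa using (hXb i).continuous.integrable_of_hasCompactSupport (hcb i))
    (fun x _ => differentiableAt_const _) (fun x _ => (hXb i).differentiable one_ne_zero x)
  simpa using parts

end Divergence

section Gradient

variable {E : Type*} [NormedAddCommGroup E] [InnerProductSpace ℝ E] [FiniteDimensional ℝ E]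
  {f g : E → ℝ} {x : E} {n : WithTop ℕ∞}

theorem gradient_mul (hf : DifferentiableAt ℝ f x) (hg : DifferentiableAt ℝ g x) :
    ∇ (fun y => f y * g y) x = f x • ∇ g x + g x • ∇ f x := by
  refine ext_inner_right ℝ fun v => ?_
  simp [inner_gradient_left, inner_add_left, inner_smul_left, fderiv_fun_mul hf hg]

theorem contDiff_gradient (hf : ContDiff ℝ (n + 1) f) : ContDiff ℝ n (∇ f) := by
  have expand : ∇ f = fun y => ∑ i, fderiv ℝ f y (stdOrthonormalBasis ℝ E i) •
      stdOrthonormalBasis ℝ E i := by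
    ext1 y
    rw [← (stdOrthonormalBasis ℝ E).sum_repr (∇ f y)]
    refine Finset.sum_congr rfl fun i _ => ?_
    rw [OrthonormalBasis.repr_apply_apply, real_inner_comm, inner_gradient_left]
  rw [expand]
  exact ContDiff.sum fun i _ =>
    ((hf.fderiv_right le_rfl).clm_apply contDiff_const).smul contDiff_const

theorem differentiable_gradient (hf : ContDiff ℝ 2 f) : Differentiable ℝ (∇ f) :=
  (contDiff_gradient (n := 1) hf).differentiable one_ne_zero

theorem tsupport_gradient_subset : tsupport (∇ f) ⊆ tsupport f :=
  closure_minimal (fun x hx => by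
    contrapose! hx
    rw [notMem_tsupport_iff_eventuallyEq] at hx
    simp [hx.gradient_eq, Pi.zero_def]) (isClosed_tsupport f)

theorem inner_fderiv_gradient (hf : ContDiff ℝ 2 f) (v w : E) :
    inner ℝ (fderiv ℝ (∇ f) x v) w = fderiv ℝ (fderiv ℝ f) x v w := by
  have h := ((differentiable_gradient hf x).hasFDerivAt.inner ℝ (hasFDerivAt_const w x)).fderiv
  have h' := ((hf.fderiv_right (m := 1) le_rfl).differentiable one_ne_zero
    x).hasFDerivAt.clm_apply (hasFDerivAt_const w x) |>.fderiv
  simp only [inner_gradient_left] at h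
  simpa using DFunLike.congr_fun (h.symm.trans h') v

theorem inner_fderiv_gradient_comm (hf : ContDiff ℝ 2 f) (v w : E) :
    inner ℝ (fderiv ℝ (∇ f) x v) w = inner ℝ v (fderiv ℝ (∇ f) x w) := by
  have symm : IsSymmSndFDerivAt ℝ f x := hf.contDiffAt.isSymmSndFDerivAt (by simp)
  rw [inner_fderiv_gradient hf, symm, ← inner_fderiv_gradient hf, real_inner_comm]

theorem divergence_gradient (hf : ContDiff ℝ 2 f) : divergence (∇ f) x = Δ f x := by
  rw [divergence, LinearMap.trace_eq_sum_inner _ (stdOrthonormalBasis ℝ E),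
    InnerProductSpace.laplacian_eq_iteratedFDeriv_stdOrthonormalBasis]
  refine Finset.sum_congr rfl fun i _ => ?_
  rw [real_inner_comm, ContinuousLinearMap.coe_coe, inner_fderiv_gradient hf,
    iteratedFDeriv_two_apply]
  rfl

theorem continuous_laplacian (hf : ContDiff ℝ 2 f) : Continuous (Δ f) := by
  have div_eq : divergence (∇ f) = Δ f := funext fun x => divergence_gradient hf
  rw [← div_eq]
  exact continuous_divergence (contDiff_gradient hf)

theorem tsupport_laplacian_subset : tsupport (Δ f) ⊆ tsupport f :=
  closure_minimal (fun x hx => by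
    contrapose! hx
    rw [notMem_tsupport_iff_eventuallyEq] at hx
    rw [Function.mem_support, not_not, (InnerProductSpace.laplacian_congr_nhds hx).eq_of_nhds,
      ← divergence_gradient (f := 0) contDiff_zero_fun]
    simp [divergence, Pi.zero_def]) (isClosed_tsupport f)

theorem laplacian_finsetSum {ι : Type*} {F : ι → E → ℝ} {s : Finset ι}
    (hF : ∀ i ∈ s, ContDiff ℝ 2 (F i)) :
    Δ (fun y => ∑ i ∈ s, F i y) x = ∑ i ∈ s, Δ (F i) x := by
  classical
  induction s using Finset.induction_on with
  | empty => simp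
  | insert i s hi ih =>
    simp only [Finset.sum_insert hi]
    rw [Finset.forall_mem_insert] at hF
    rw [← ih hF.2]
    exact hF.1.contDiffAt.laplacian_add (ContDiff.sum hF.2).contDiffAt

theorem laplacian_mul (hf : ContDiff ℝ 2 f) (hg : ContDiff ℝ 2 g) :
    Δ (fun y => f y * g y) x = f x * Δ g x + 2 * inner ℝ (∇ f x) (∇ g x) + g x * Δ f x := by
  have hf₁ := hf.differentiable two_ne_zero
  have hg₁ := hg.differentiable two_ne_zero
  have grad_eq : ∇ (fun y => f y * g y) = fun y => f y • ∇ g y + g y • ∇ f y :=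
    funext fun y => gradient_mul (hf₁ y) (hg₁ y)
  rw [← divergence_gradient (hf.mul hg), grad_eq,
    divergence_add ((hf₁ x).fun_smul (differentiable_gradient hg x))
      ((hg₁ x).fun_smul (differentiable_gradient hf x)),
    divergence_smul (hf₁ x) (differentiable_gradient hg x),
    divergence_smul (hg₁ x) (differentiable_gradient hf x), divergence_gradient hf,
    divergence_gradient hg, ← inner_gradient_left, ← inner_gradient_left,
    real_inner_comm (∇ f x) (∇ g x)]
  ring

variable [MeasurableSpace E] [BorelSpace E]

theorem integral_mul_laplacian (hf : ContDiff ℝ 1 f) (hg : ContDiff ℝ 2 g)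
    (hc : HasCompactSupport f ∨ HasCompactSupport g) :
    ∫ x, f x * Δ g x = -∫ x, inner ℝ (∇ f x) (∇ g x) := by
  have div_eq (x : E) :
      divergence (fun y => f y • ∇ g y) x = f x * Δ g x + inner ℝ (∇ f x) (∇ g x) := by
    rw [divergence_smul (hf.differentiable one_ne_zero x) (differentiable_gradient hg x),
      divergence_gradient hg, inner_gradient_left]
  have hc_lap : HasCompactSupport fun x => f x * Δ g x := hc.elim (·.mul_right) fun hg =>
    HasCompactSupport.mul_left (hg.mono' (subset_closure.trans tsupport_laplacian_subset))
  have hc_inner : HasCompactSupport fun x => inner ℝ (∇ f x) (∇ g x) := hc.elim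
    (fun hf => (hf.mono' (subset_closure.trans tsupport_gradient_subset)).mono
      fun x hx h0 => hx (by simp [h0]))
    (fun hg => (hg.mono' (subset_closure.trans tsupport_gradient_subset)).mono
      fun x hx h0 => hx (by simp [h0]))
  have hc_smul : HasCompactSupport fun x => f x • ∇ g x := hc.elim (·.smul_right) fun hg =>
    HasCompactSupport.smul_left (hg.mono' (subset_closure.trans tsupport_gradient_subset))
  have h_int₁ : Integrable fun x => f x * Δ g x :=
    (hf.continuous.mul (continuous_laplacian hg)).integrable_of_hasCompactSupport hc_lap
  have h_int₂ : Integrable fun x => inner ℝ (∇ f x) (∇ g x) :=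
    ((contDiff_gradient (n := 0) hf).continuous.inner
      (contDiff_gradient (n := 1) hg).continuous).integrable_of_hasCompactSupport hc_inner
  have int_div : ∫ x, divergence (fun y => f y • ∇ g y) x = 0 :=
    integral_divergence_eq_zero (hf.smul (contDiff_gradient (n := 1) hg)) hc_smul
  rw [integral_congr_ae (.of_forall div_eq), integral_add h_int₁ h_int₂] at int_div
  exact eq_neg_of_add_eq_zero_left int_div

end Gradient

/-! ### The Carleman inequality -/

section Carleman

/-- The Carleman weight `|x|^{-2(n+1)} e^{nβ|x|²}`, as a function of `s = |x|²`. -/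
noncomputable def carlemanWeight (n : ℕ) (β s : ℝ) : ℝ :=
  (s ^ (n + 1))⁻¹ * Real.exp (n * β * s)

theorem carlemanWeight_nonneg (n : ℕ) (β : ℝ) {s : ℝ} (hs : 0 ≤ s) : 0 ≤ carlemanWeight n β s := by
  unfold carlemanWeight; positivity

theorem hasDerivAt_carlemanWeight (n : ℕ) (β : ℝ) {s : ℝ} (hs : s ≠ 0) :
    HasDerivAt (carlemanWeight n β) (-(n * (1 - β * s) + 1) * carlemanWeight n β s / s) s := by
  have hinv : HasDerivAt (fun t : ℝ => (t ^ (n + 1))⁻¹) _ s :=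
    (hasDerivAt_pow (n + 1) s).inv (pow_ne_zero _ hs)
  have hexp : HasDerivAt (fun t : ℝ => Real.exp (n * β * t)) _ s :=
    ((hasDerivAt_id s).const_mul (n * β)).exp
  convert! hinv.mul hexp using 1
  simp only [carlemanWeight, add_tsub_cancel_right, id]
  field_simp
  push_cast
  ring

theorem contDiffAt_carlemanWeight {m : WithTop ℕ∞} (n : ℕ) (β : ℝ) {s : ℝ} (hs : s ≠ 0) :
    ContDiffAt ℝ m (carlemanWeight n β) s :=
  ((contDiffAt_id.pow (n + 1)).inv (pow_ne_zero _ hs)).mul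
    (contDiffAt_const.mul contDiffAt_id).exp

variable {E F : Type*} [NormedAddCommGroup E] [InnerProductSpace ℝ E]
  [NormedAddCommGroup F] [NormedSpace ℝ F] {f : E → ℝ} {x : E}

theorem contDiff_carlemanWeight_smul {m : WithTop ℕ∞} (n : ℕ) (β : ℝ) {Z : E → F}
    (hZ : ContDiff ℝ m Z) (h0 : 0 ∉ tsupport Z) :
    ContDiff ℝ m fun x => carlemanWeight n β (‖x‖ ^ 2) • Z x := by
  refine contDiff_iff_contDiffAt.2 fun x => ?_
  by_cases hx : x ∈ tsupport Z
  · have hx0 : x ≠ 0 := fun h => h0 (h ▸ hx)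
    exact ((contDiffAt_carlemanWeight n β (by simpa using hx0)).comp x
      (contDiff_norm_sq ℝ).contDiffAt).smul hZ.contDiffAt
  · refine contDiffAt_const (c := 0) |>.congr_of_eventuallyEq ?_
    filter_upwards [notMem_tsupport_iff_eventuallyEq.1 hx] with y hy
    simp [hy]

theorem hasFDerivAt_norm_sq (x : E) :
    HasFDerivAt (fun y : E => ‖y‖ ^ 2) (2 • innerSL ℝ x) x :=
  (hasStrictFDerivAt_norm_sq x).hasFDerivAt

/-- The radial (Euler) derivative `x ↦ x · ∇f(x)`. -/
noncomputable def eulerDeriv [CompleteSpace E] (f : E → ℝ) (x : E) : ℝ :=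
  inner ℝ x (∇ f x)

variable [FiniteDimensional ℝ E]

theorem integrable_carlemanWeight_mul [MeasurableSpace E] [BorelSpace E] (n : ℕ) (β : ℝ)
    {g : E → ℝ} (hg : Continuous g) (hc : HasCompactSupport g) (h0 : 0 ∉ tsupport g) :
    Integrable fun x => carlemanWeight n β (‖x‖ ^ 2) * g x :=
  (contDiff_zero.1 (contDiff_carlemanWeight_smul n β (contDiff_zero.2 hg)
    h0)).integrable_of_hasCompactSupport hc.mul_left

theorem contDiff_eulerDeriv (hf : ContDiff ℝ 2 f) : ContDiff ℝ 1 (eulerDeriv f) :=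
  contDiff_id.inner ℝ (contDiff_gradient hf)

theorem fderiv_eulerDeriv (hf : ContDiff ℝ 2 f) (v : E) :
    fderiv ℝ (eulerDeriv f) x v = inner ℝ v (∇ f x) + inner ℝ x (fderiv ℝ (∇ f) x v) := by
  have h : HasFDerivAt (eulerDeriv f) _ x :=
    (hasFDerivAt_id x).inner ℝ (differentiable_gradient hf x).hasFDerivAt
  rw [h.fderiv]
  simp [add_comm]

theorem fderiv_norm_gradient_sq (hf : ContDiff ℝ 2 f) (v : E) :
    fderiv ℝ (fun y => ‖∇ f y‖ ^ 2) x v = 2 * inner ℝ (∇ f x) (fderiv ℝ (∇ f) x v) := by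
  rw [((differentiable_gradient hf x).hasFDerivAt.norm_sq).fderiv]
  simp

/-- The multiplier paired with `|x|² Δf` in the Carleman identity. In the coordinate `log |x|` it
is the antisymmetric part of the operator `|x|² Δ` conjugated with the weight, applied to `f`. -/
noncomputable def carlemanMultiplier (n : ℕ) (β : ℝ) (f : E → ℝ) (x : E) : ℝ :=
  2 * (n * (1 - β * ‖x‖ ^ 2)) * eulerDeriv f x
    + (2 * (n * (1 - β * ‖x‖ ^ 2)) * ((Module.finrank ℝ E - 2) / 2 - n * (1 - β * ‖x‖ ^ 2))
      - 2 * n * β * ‖x‖ ^ 2) * f x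

/-- The coefficient of the position vector `x` in the Carleman vector field. -/
noncomputable def carlemanFlux (n : ℕ) (β : ℝ) (f : E → ℝ) (x : E) : ℝ :=
  -(n * (1 - β * ‖x‖ ^ 2)) * ‖x‖ ^ 2 * ‖∇ f x‖ ^ 2
    + (-2 * (n * (1 - β * ‖x‖ ^ 2)) ^ 2 * ((Module.finrank ℝ E - 2) / 2 - n * (1 - β * ‖x‖ ^ 2))
      - 2 * n * β * ‖x‖ ^ 2 * ((Module.finrank ℝ E - 2) / 2 - n * (1 - β * ‖x‖ ^ 2))
      + 2 * n * β * ‖x‖ ^ 2) * f x ^ 2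

/-- The Carleman vector field without its weight. -/
noncomputable def carlemanField (n : ℕ) (β : ℝ) (f : E → ℝ) (x : E) : E :=
  (‖x‖ ^ 2 * carlemanMultiplier n β f x) • ∇ f x + carlemanFlux n β f x • x

theorem contDiff_carlemanMultiplier (n : ℕ) (β : ℝ) (hf : ContDiff ℝ 2 f) :
    ContDiff ℝ 1 (carlemanMultiplier n β f) := by
  have hE := contDiff_eulerDeriv hf
  have hf₁ : ContDiff ℝ 1 f := hf.of_le one_le_two
  have hN : ContDiff ℝ 1 fun y : E => ‖y‖ ^ 2 := contDiff_norm_sq ℝ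
  unfold carlemanMultiplier
  fun_prop

theorem contDiff_carlemanFlux (n : ℕ) (β : ℝ) (hf : ContDiff ℝ 2 f) :
    ContDiff ℝ 1 (carlemanFlux n β f) := by
  have hG : ContDiff ℝ 1 fun y => ‖∇ f y‖ ^ 2 := (contDiff_gradient hf).norm_sq ℝ
  have hf₁ : ContDiff ℝ 1 f := hf.of_le one_le_two
  have hN : ContDiff ℝ 1 fun y : E => ‖y‖ ^ 2 := contDiff_norm_sq ℝ
  unfold carlemanFlux
  fun_prop

theorem contDiff_carlemanField (n : ℕ) (β : ℝ) (hf : ContDiff ℝ 2 f) :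
    ContDiff ℝ 1 (carlemanField n β f) :=
  (((contDiff_norm_sq ℝ).mul (contDiff_carlemanMultiplier n β hf)).smul
    (contDiff_gradient hf)).add ((contDiff_carlemanFlux n β hf).smul contDiff_id)

theorem tsupport_carlemanField_subset (n : ℕ) (β : ℝ) (f : E → ℝ) :
    tsupport (carlemanField n β f) ⊆ tsupport f :=
  closure_minimal (fun x hx => by
    contrapose! hx
    have hf : f x = 0 := image_eq_zero_of_notMem_tsupport hx
    have hg : ∇ f x = 0 :=
      image_eq_zero_of_notMem_tsupport fun h => hx (tsupport_gradient_subset h)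
    simp [carlemanField, carlemanFlux, hf, hg]) (isClosed_tsupport f)

theorem fderiv_carlemanMultiplier (n : ℕ) (β : ℝ) (hf : ContDiff ℝ 2 f) (v : E) {s p κ : ℝ}
    (hs : s = ‖x‖ ^ 2) (hp : p = n * (1 - β * s)) (hκ : κ = (Module.finrank ℝ E - 2) / 2) :
    fderiv ℝ (carlemanMultiplier n β f) x v
      = 2 * p * fderiv ℝ (eulerDeriv f) x v
        + (2 * p * (κ - p) - 2 * n * β * s) * fderiv ℝ f x v
        - 4 * n * β * inner ℝ x v * (eulerDeriv f x + (κ - 2 * p + 1) * f x) := by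
  subst hs hp hκ
  have hs := hasFDerivAt_norm_sq x
  have hp : HasFDerivAt (fun y : E => n * (1 - β * ‖y‖ ^ 2)) _ x :=
    ((hs.const_mul β).const_sub 1).const_mul (n : ℝ)
  have hE := ((contDiff_eulerDeriv hf).differentiable one_ne_zero x).hasFDerivAt
  have hf₁ := (hf.differentiable two_ne_zero x).hasFDerivAt
  have hA : HasFDerivAt (carlemanMultiplier n β f) _ x :=
    ((hp.const_mul 2).fun_mul hE).fun_add
      ((((hp.const_mul 2).fun_mul (hp.const_sub _)).fun_sub (hs.const_mul (2 * n * β))).fun_mul hf₁)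
  rw [hA.fderiv]
  simp
  ring

theorem fderiv_carlemanFlux (n : ℕ) (β : ℝ) (hf : ContDiff ℝ 2 f) (v : E) {s p κ : ℝ}
    (hs : s = ‖x‖ ^ 2) (hp : p = n * (1 - β * s)) (hκ : κ = (Module.finrank ℝ E - 2) / 2) :
    fderiv ℝ (carlemanFlux n β f) x v
      = -p * s * fderiv ℝ (fun y => ‖∇ f y‖ ^ 2) x v
        + 2 * (n * β * s - p) * inner ℝ x v * ‖∇ f x‖ ^ 2
        + (-2 * p ^ 2 * (κ - p) - 2 * n * β * s * (κ - p) + 2 * n * β * s)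
          * (2 * f x * fderiv ℝ f x v)
        + 4 * n * β * inner ℝ x v
          * (2 * p * (κ - p) - p ^ 2 - (κ - p) - n * β * s + 1) * f x ^ 2 := by
  subst hs hp hκ
  have hs := hasFDerivAt_norm_sq x
  have hp : HasFDerivAt (fun y : E => n * (1 - β * ‖y‖ ^ 2)) _ x :=
    ((hs.const_mul β).const_sub 1).const_mul (n : ℝ)
  have hG : HasFDerivAt (fun y => ‖∇ f y‖ ^ 2) (fderiv ℝ (fun y => ‖∇ f y‖ ^ 2) x) x :=
    ((differentiable_gradient hf x).norm_sq ℝ).hasFDerivAt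
  have hf₁ := (hf.differentiable two_ne_zero x).hasFDerivAt
  have hW : HasFDerivAt (carlemanFlux n β f) _ x :=
    ((hp.fun_neg.fun_mul hs).fun_mul hG).fun_add
      ((((((hp.pow 2).const_mul (-2)).fun_mul (hp.const_sub _)).fun_sub
        ((hs.const_mul (2 * n * β)).fun_mul (hp.const_sub _))).fun_add
          (hs.const_mul (2 * n * β))).fun_mul (hf₁.pow 2))
  rw [hW.fderiv]
  simp
  ring

theorem divergence_carlemanField (n : ℕ) (β : ℝ) (hf : ContDiff ℝ 2 f) :
    divergence (carlemanField n β f) x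
      = ‖x‖ ^ 2 * carlemanMultiplier n β f x * Δ f x
        + 2 * eulerDeriv f x * carlemanMultiplier n β f x
        + ‖x‖ ^ 2 * fderiv ℝ (carlemanMultiplier n β f) x (∇ f x)
        + Module.finrank ℝ E * carlemanFlux n β f x
        + fderiv ℝ (carlemanFlux n β f) x x := by
  have hA : DifferentiableAt ℝ (carlemanMultiplier n β f) x :=
    (contDiff_carlemanMultiplier n β hf).differentiable one_ne_zero x
  have hW : DifferentiableAt ℝ (carlemanFlux n β f) x :=
    (contDiff_carlemanFlux n β hf).differentiable one_ne_zero x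
  have hsA := (hasFDerivAt_norm_sq x).fun_mul hA.hasFDerivAt
  have hg := differentiable_gradient hf x
  unfold carlemanField
  rw [divergence_add (hsA.differentiableAt.fun_smul hg) (hW.fun_smul differentiableAt_fun_id),
    divergence_smul hsA.differentiableAt hg, divergence_smul hW differentiableAt_fun_id,
    divergence_id, divergence_gradient hf, hsA.fderiv]
  simp [eulerDeriv]
  ring

theorem divergence_carlemanWeight_smul (n : ℕ) (β : ℝ) {Z : E → E}
    (hZ : DifferentiableAt ℝ Z x) (hx : x ≠ 0) :
    divergence (fun y => carlemanWeight n β (‖y‖ ^ 2) • Z y) x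
      = carlemanWeight n β (‖x‖ ^ 2) * (divergence Z x
        - 2 * (n * (1 - β * ‖x‖ ^ 2) + 1) / ‖x‖ ^ 2 * inner ℝ x (Z x)) := by
  have hw := (hasDerivAt_carlemanWeight n β (s := ‖x‖ ^ 2) (by simpa using hx)).comp_hasFDerivAt x
    (hasFDerivAt_norm_sq x)
  have hw' : HasFDerivAt (fun y : E => carlemanWeight n β (‖y‖ ^ 2)) _ x := hw
  rw [divergence_smul hw'.differentiableAt hZ, hw'.fderiv]
  simp
  ring

theorem divergence_weighted_carlemanField (n : ℕ) (β : ℝ) (hf : ContDiff ℝ 2 f) (hx : x ≠ 0)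
    {s p κ : ℝ} (hs : s = ‖x‖ ^ 2) (hp : p = n * (1 - β * s))
    (hκ : κ = (Module.finrank ℝ E - 2) / 2) :
    divergence (fun y => carlemanWeight n β (‖y‖ ^ 2) • carlemanField n β f y) x
      = carlemanWeight n β s * (s * Δ f x * carlemanMultiplier n β f x
        - carlemanMultiplier n β f x ^ 2
        - 4 * n * β * s * (eulerDeriv f x + (κ - p) * f x) ^ 2
        - 4 * n * β * s * (p ^ 2 - 1) * f x ^ 2) := by
  have hs0 : s ≠ 0 := by rw [hs]; simpa using hx
  have hd : (Module.finrank ℝ E : ℝ) = 2 * κ + 2 := by rw [hκ]; ring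
  have hess : inner ℝ (∇ f x) (fderiv ℝ (∇ f) x x) = inner ℝ x (fderiv ℝ (∇ f) x (∇ f x)) := by
    rw [real_inner_comm, inner_fderiv_gradient_comm hf]
  have radial : inner ℝ x (carlemanField n β f x)
      = s * (carlemanMultiplier n β f x * eulerDeriv f x + carlemanFlux n β f x) := by
    simp only [carlemanField, inner_add_right, inner_smul_right, real_inner_self_eq_norm_sq,
      eulerDeriv, hs]
    ring
  rw [divergence_carlemanWeight_smul n β
    ((contDiff_carlemanField n β hf).differentiable one_ne_zero x) hx,
    divergence_carlemanField n β hf, fderiv_carlemanMultiplier n β hf _ hs hp hκ,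
    fderiv_carlemanFlux n β hf _ hs hp hκ, fderiv_eulerDeriv hf,
    fderiv_norm_gradient_sq hf, hess, radial, ← hs, ← hp, hd, ← inner_gradient_left,
    ← inner_gradient_left, real_inner_comm x (∇ f x), real_inner_self_eq_norm_sq,
    real_inner_self_eq_norm_sq, ← hs]
  simp only [carlemanMultiplier, carlemanFlux, ← hs, ← hp, ← hκ, ← eulerDeriv.eq_1]
  field_simp
  rw [hp]
  ring

/-- After completing the square in `A`, everything on the right has a sign: the first-order term
is nonnegative and `p² - 1` is bounded below by `n² / 8`. -/
theorem carleman_pointwise {n b s p κ e l v A : ℝ} (hn : 3 ≤ n) (hb : 0 ≤ b) (hs : 0 ≤ s)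
    (hp : n / 2 ≤ p) :
    n ^ 3 * b / 2 * (s * v ^ 2) + (s * l * A - A ^ 2 - 4 * n * b * s * (e + (κ - p) * v) ^ 2
      - 4 * n * b * s * (p ^ 2 - 1) * v ^ 2) ≤ 1 / 4 * (s ^ 2 * l ^ 2) := by
  have hp3 : n ^ 2 / 8 ≤ p ^ 2 - 1 := by nlinarith
  have hbs : 0 ≤ n * b * s := by positivity
  have zeroth : n ^ 3 * b / 2 * (s * v ^ 2) ≤ 4 * n * b * s * (p ^ 2 - 1) * v ^ 2 := by
    have := mul_le_mul_of_nonneg_left hp3 (mul_nonneg hbs (sq_nonneg v))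
    linarith
  have first : 0 ≤ 4 * n * b * s * (e + (κ - p) * v) ^ 2 := by
    have := mul_nonneg hbs (sq_nonneg (e + (κ - p) * v))
    linarith
  have square : s * l * A - A ^ 2 ≤ 1 / 4 * (s ^ 2 * l ^ 2) := by
    linarith [sq_nonneg (s * l / 2 - A)]
  linarith

theorem weighted_sq_add_divergence_le {n : ℕ} (hn : 3 ≤ n) {β : ℝ} (hβ : 0 ≤ β)
    (hf : ContDiff ℝ 2 f) (h0 : 0 ∉ tsupport f) (hs : ∀ x ∈ tsupport f, β * ‖x‖ ^ 2 ≤ 1 / 2)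
    (x : E) :
    (n : ℝ) ^ 3 * β / 2 * (carlemanWeight n β (‖x‖ ^ 2) * (‖x‖ ^ 2 * f x ^ 2))
        + divergence (fun y => carlemanWeight n β (‖y‖ ^ 2) • carlemanField n β f y) x
      ≤ 1 / 4 * (carlemanWeight n β (‖x‖ ^ 2) * ((‖x‖ ^ 2) ^ 2 * Δ f x ^ 2)) := by
  have hs0 : 0 ≤ ‖x‖ ^ 2 := sq_nonneg _
  have hw := carlemanWeight_nonneg n β hs0
  by_cases hx : x ∈ tsupport f
  · have hx0 : x ≠ 0 := fun h => h0 (h ▸ hx)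
    have hn' : (3 : ℝ) ≤ n := by exact_mod_cast hn
    have hp : (n : ℝ) / 2 ≤ n * (1 - β * ‖x‖ ^ 2) := by nlinarith [hs x hx]
    rw [divergence_weighted_carlemanField n β hf hx0 rfl rfl rfl]
    linarith [mul_le_mul_of_nonneg_left (carleman_pointwise
      (κ := (Module.finrank ℝ E - 2) / 2) (e := eulerDeriv f x) (l := Δ f x) (v := f x)
      (A := carlemanMultiplier n β f x) hn' hβ hs0 hp) hw]
  · have div_zero : divergence
        (fun y => carlemanWeight n β (‖y‖ ^ 2) • carlemanField n β f y) x = 0 :=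
      image_eq_zero_of_notMem_tsupport fun h => hx (tsupport_carlemanField_subset n β f
        (tsupport_smul_subset_right _ _ (tsupport_divergence_subset h)))
    rw [div_zero, image_eq_zero_of_notMem_tsupport hx]
    simp only [ne_eq, OfNat.ofNat_ne_zero, not_false_eq_true, zero_pow, mul_zero, add_zero]
    positivity

variable [MeasurableSpace E] [BorelSpace E]

theorem carleman_estimate {n : ℕ} (hn : 3 ≤ n) {β : ℝ} (hβ : 0 ≤ β) (hf : ContDiff ℝ 2 f)
    (hc : HasCompactSupport f) (h0 : 0 ∉ tsupport f)
    (hs : ∀ x ∈ tsupport f, β * ‖x‖ ^ 2 ≤ 1 / 2) :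
    2 * (n : ℝ) ^ 3 * β * ∫ x, carlemanWeight n β (‖x‖ ^ 2) * (‖x‖ ^ 2 * f x ^ 2)
      ≤ ∫ x, carlemanWeight n β (‖x‖ ^ 2) * ((‖x‖ ^ 2) ^ 2 * Δ f x ^ 2) := by
  have hN : Continuous fun y : E => ‖y‖ ^ 2 := by fun_prop
  have integrable_weight_mul {g : E → ℝ} (hg : Continuous g) (hgf : tsupport g ⊆ tsupport f) :
      Integrable fun x => carlemanWeight n β (‖x‖ ^ 2) * g x :=
    integrable_carlemanWeight_mul n β hg (hc.mono' (subset_closure.trans hgf))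
      fun h => h0 (hgf h)
  have hI₁ : Integrable fun x => carlemanWeight n β (‖x‖ ^ 2) * (‖x‖ ^ 2 * f x ^ 2) :=
    integrable_weight_mul (hN.mul (hf.continuous.pow 2))
      (closure_mono fun y hy (hy0 : f y = 0) => hy (by simp [hy0]))
  have support_subset : (Function.support fun x => (‖x‖ ^ 2) ^ 2 * Δ f x ^ 2) ⊆
      Function.support (Δ f) := fun y hy hy0 => hy (by simp [hy0])
  have hI₂ : Integrable fun x => carlemanWeight n β (‖x‖ ^ 2) * ((‖x‖ ^ 2) ^ 2 * Δ f x ^ 2) :=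
    integrable_weight_mul ((hN.pow 2).mul ((continuous_laplacian hf).pow 2))
      ((closure_mono support_subset).trans tsupport_laplacian_subset)
  have hZ := tsupport_carlemanField_subset n β f
  have hXd := contDiff_carlemanWeight_smul n β (contDiff_carlemanField n β hf) fun h => h0 (hZ h)
  have hXc : HasCompactSupport fun x => carlemanWeight n β (‖x‖ ^ 2) • carlemanField n β f x :=
    HasCompactSupport.smul_left (hc.mono' (subset_closure.trans hZ))
  have hdiv : Integrable
      (divergence fun x => carlemanWeight n β (‖x‖ ^ 2) • carlemanField n β f x) :=
    (continuous_divergence hXd).integrable_of_hasCompactSupport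
      (hXc.mono' (subset_closure.trans tsupport_divergence_subset))
  have integrated := integral_mono ((hI₁.const_mul ((n : ℝ) ^ 3 * β / 2)).add hdiv)
    (hI₂.const_mul (1 / 4)) (weighted_sq_add_divergence_le hn hβ hf h0 hs)
  simp only [Pi.add_apply] at integrated
  rw [integral_add (hI₁.const_mul _) hdiv, integral_divergence_eq_zero hXd hXc,
    integral_const_mul, integral_const_mul] at integrated
  linarith

end Carleman

/-! ### Cutoffs and Caccioppoli estimates -/

section Caccioppoli

variable {E : Type*} [NormedAddCommGroup E] [InnerProductSpace ℝ E] [FiniteDimensional ℝ E]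
  {u χ : E → ℝ} {x : E}

theorem divergence_sq_mul_smul_gradient (hu : ContDiff ℝ 2 u) (hχ : ContDiff ℝ 1 χ) :
    divergence (fun y => (χ y ^ 2 * u y) • ∇ u y) x = χ x ^ 2 * ‖∇ u x‖ ^ 2
      + χ x ^ 2 * u x * Δ u x + 2 * inner ℝ (χ x • ∇ u x) (u x • ∇ χ x) := by
  have hχ₁ := hχ.differentiable one_ne_zero
  have hu₁ := hu.differentiable two_ne_zero
  rw [divergence_smul ((hχ₁.fun_pow 2 x).fun_mul (hu₁ x)) (differentiable_gradient hu x),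
    divergence_gradient hu, fderiv_fun_mul (hχ₁.fun_pow 2 x) (hu₁ x), fderiv_fun_pow 2 (hχ₁ x)]
  simp only [add_apply, smul_apply, smul_eq_mul,
    ← inner_gradient_left, real_inner_self_eq_norm_sq, real_inner_smul_left, real_inner_smul_right,
    real_inner_comm (∇ χ x) (∇ u x)]
  simp only [Nat.reduceSub, pow_one, nsmul_eq_mul, Nat.cast_ofNat]
  ring

variable [MeasurableSpace E] [BorelSpace E]

theorem caccioppoli (hu : ContDiff ℝ 2 u) (hχ : ContDiff ℝ 1 χ) (hc : HasCompactSupport χ) :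
    ∫ x, χ x ^ 2 * ‖∇ u x‖ ^ 2
      ≤ ∫ x, (χ x ^ 2 * (u x ^ 2 + Δ u x ^ 2) + 4 * (‖∇ χ x‖ ^ 2 * u x ^ 2)) := by
  have hu₀ := hu.continuous
  have hΔu := continuous_laplacian hu
  have h_gradu := (contDiff_gradient (n := 1) hu).continuous
  have h_gradχ := (contDiff_gradient (n := 0) hχ).continuous
  have hc₂ : HasCompactSupport fun x => χ x ^ 2 := by
    simp only [sq]; exact hc.mul_left
  have hc_grad : HasCompactSupport fun x => ‖∇ χ x‖ ^ 2 :=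
    (hc.mono' (subset_closure.trans tsupport_gradient_subset)).comp_left (g := fun v => ‖v‖ ^ 2)
      (by simp)
  have hX : ContDiff ℝ 1 fun x => (χ x ^ 2 * u x) • ∇ u x :=
    ((hχ.pow 2).mul (hu.of_le one_le_two)).smul (contDiff_gradient (n := 1) hu)
  have hXc : HasCompactSupport fun x => (χ x ^ 2 * u x) • ∇ u x := hc₂.mul_right.smul_right
  have int_lhs : Integrable fun x => χ x ^ 2 * ‖∇ u x‖ ^ 2 :=
    ((hχ.continuous.pow 2).mul (h_gradu.norm.pow 2)).integrable_of_hasCompactSupport hc₂.mul_right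
  have int_rhs : Integrable fun x =>
      χ x ^ 2 * (u x ^ 2 + Δ u x ^ 2) + 4 * (‖∇ χ x‖ ^ 2 * u x ^ 2) :=
    (((hχ.continuous.pow 2).mul ((hu₀.pow 2).add
      (hΔu.pow 2))).integrable_of_hasCompactSupport hc₂.mul_right).add
      ((((h_gradχ.norm.pow 2).mul (hu₀.pow 2)).integrable_of_hasCompactSupport
        hc_grad.mul_right).const_mul 4)
  have int_div : Integrable fun x => 2 * divergence (fun y => (χ y ^ 2 * u y) • ∇ u y) x :=
    ((continuous_divergence hX).integrable_of_hasCompactSupport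
      (hXc.mono' (subset_closure.trans tsupport_divergence_subset))).const_mul 2
  have pointwise (x : E) : χ x ^ 2 * ‖∇ u x‖ ^ 2
      ≤ 2 * divergence (fun y => (χ y ^ 2 * u y) • ∇ u y) x
        + (χ x ^ 2 * (u x ^ 2 + Δ u x ^ 2) + 4 * (‖∇ χ x‖ ^ 2 * u x ^ 2)) := by
    have expand := norm_add_sq_real (χ x • ∇ u x) ((2 : ℝ) • u x • ∇ χ x)
    rw [real_inner_smul_right, norm_smul, norm_smul, norm_smul, mul_pow, mul_pow, mul_pow,
      Real.norm_eq_abs, sq_abs, Real.norm_eq_abs, sq_abs, Real.norm_eq_abs, sq_abs] at expand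
    rw [divergence_sq_mul_smul_gradient hu hχ]
    linarith [sq_nonneg ‖χ x • ∇ u x + (2 : ℝ) • u x • ∇ χ x‖,
      sq_nonneg (χ x * (u x + Δ u x))]
  have integrated := integral_mono int_lhs (int_div.add int_rhs) pointwise
  simp only [Pi.add_apply] at integrated
  rwa [integral_add int_div int_rhs, integral_const_mul, integral_divergence_eq_zero hX hXc,
    mul_zero, zero_add] at integrated

end Caccioppoli

section Cutoff

variable {E : Type*} [NormedAddCommGroup E] [InnerProductSpace ℝ E] [FiniteDimensional ℝ E]
  {f g u α β χ : E → ℝ} {x : E} {B c : ℝ}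

theorem gradient_const_sub (a : ℝ) : ∇ (fun y => a - f y) x = -∇ f x := by
  simp [gradient, fderiv_const_sub]

theorem laplacian_const_sub (hf : ContDiff ℝ 2 f) (a : ℝ) :
    Δ (fun y => a - f y) x = -Δ f x := by
  have grad_eq : ∇ (fun y => a - f y) = fun y => -∇ f y := funext fun y => gradient_const_sub a
  rw [← divergence_gradient (contDiff_const.sub hf), ← divergence_gradient hf, grad_eq]
  simp [divergence, fderiv_fun_neg]

theorem gradient_comp_const_smul (c : ℝ) : ∇ (fun y => f (c • y)) x = c • ∇ f (c • x) := by
  refine ext_inner_right ℝ fun v => ?_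
  rw [inner_gradient_left, real_inner_smul_left, inner_gradient_left]
  simpa using DFunLike.congr_fun (fderiv_comp_smul (f := f) (x := x) c) v

theorem laplacian_comp_const_smul (hf : ContDiff ℝ 2 f) (c : ℝ) :
    Δ (fun y => f (c • y)) x = c ^ 2 * Δ f (c • x) := by
  have grad_eq : ∇ (fun y => f (c • y)) = fun y => c • ∇ f (c • y) :=
    funext fun y => gradient_comp_const_smul c
  have h_diff : DifferentiableAt ℝ (fun y => ∇ f (c • y)) x :=
    ((differentiable_gradient hf).comp (differentiable_id.const_smul c)) x
  rw [← divergence_gradient (f := fun y => f (c • y)) (hf.comp (contDiff_const_smul c)),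
    ← divergence_gradient hf, grad_eq, divergence, divergence, fderiv_fun_const_smul h_diff,
    fderiv_comp_smul]
  simp only [ContinuousLinearMap.toLinearMap_smul, map_smul, smul_eq_mul]
  ring

theorem laplacian_mul_sq_le (hf : ContDiff ℝ 2 f) (hg : ContDiff ℝ 2 g) :
    Δ (fun y => f y * g y) x ^ 2 ≤ 3 * (f x ^ 2 * Δ g x ^ 2)
      + 12 * (‖∇ f x‖ ^ 2 * ‖∇ g x‖ ^ 2) + 3 * (g x ^ 2 * Δ f x ^ 2) := by
  have cauchy_schwarz : inner ℝ (∇ f x) (∇ g x) ^ 2 ≤ ‖∇ f x‖ ^ 2 * ‖∇ g x‖ ^ 2 := by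
    rw [← mul_pow, ← sq_abs]
    exact pow_le_pow_left₀ (abs_nonneg _) (abs_real_inner_le_norm _ _) 2
  rw [laplacian_mul hf hg]
  generalize inner ℝ (∇ f x) (∇ g x) = S at *
  linarith [sq_nonneg (f x * Δ g x - 2 * S), sq_nonneg (f x * Δ g x - g x * Δ f x),
    sq_nonneg (2 * S - g x * Δ f x)]

theorem norm_gradient_mul_sq_le (hf : ContDiff ℝ 2 f) (hg : ContDiff ℝ 2 g) (hf1 : f x ^ 2 ≤ 1)
    (hg1 : g x ^ 2 ≤ 1) :
    ‖∇ (fun y => f y * g y) x‖ ^ 2 ≤ 2 * ‖∇ f x‖ ^ 2 + 2 * ‖∇ g x‖ ^ 2 := by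
  have parallelogram := parallelogram_law_with_norm ℝ (f x • ∇ g x) (g x • ∇ f x)
  rw [norm_smul, norm_smul, mul_pow, mul_pow, Real.norm_eq_abs, sq_abs,
    Real.norm_eq_abs, sq_abs] at parallelogram
  rw [gradient_mul (hf.differentiable two_ne_zero x) (hg.differentiable two_ne_zero x)]
  linarith [sq_nonneg ‖f x • ∇ g x - g x • ∇ f x‖,
    mul_le_mul_of_nonneg_right hf1 (sq_nonneg ‖∇ g x‖),
    mul_le_mul_of_nonneg_right hg1 (sq_nonneg ‖∇ f x‖)]

/-- The derivatives of a cutoff `φ` which control the commutator `[Δ, φ]`. -/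
noncomputable def cutoffError (φ : E → ℝ) (x : E) : ℝ :=
  ‖∇ φ x‖ ^ 2 + ‖∇ φ x‖ ^ 4 + Δ φ x ^ 2

theorem cutoffError_nonneg (φ : E → ℝ) (x : E) : 0 ≤ cutoffError φ x := by
  unfold cutoffError; positivity

theorem cutoffError_eq_zero (hx : x ∉ tsupport f) : cutoffError f x = 0 := by
  have h_grad : ∇ f x = 0 :=
    image_eq_zero_of_notMem_tsupport fun h => hx (tsupport_gradient_subset h)
  have h_lap : Δ f x = 0 :=
    image_eq_zero_of_notMem_tsupport fun h => hx (tsupport_laplacian_subset h)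
  simp [cutoffError, h_grad, h_lap]

theorem cutoffError_const_sub (hf : ContDiff ℝ 2 f) (a : ℝ) :
    cutoffError (fun y => a - f y) x = cutoffError f x := by
  simp only [cutoffError, gradient_const_sub, laplacian_const_sub hf, norm_neg, neg_sq]

theorem laplacian_mul_mul_sq_le (hα : ContDiff ℝ 2 α) (hβ : ContDiff ℝ 2 β) (hu : ContDiff ℝ 2 u)
    (hα1 : α x ^ 2 ≤ 1) (hβ1 : β x ^ 2 ≤ 1) :
    Δ (fun y => α y * β y * u y) x ^ 2 ≤ 3 * ((α x * β x) ^ 2 * Δ u x ^ 2)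
      + 24 * (cutoffError α x + cutoffError β x) * (‖∇ u x‖ ^ 2 + u x ^ 2) := by
  have grad_le := norm_gradient_mul_sq_le hα hβ hα1 hβ1
  have lap_le : Δ (fun y => α y * β y) x ^ 2
      ≤ 3 * Δ β x ^ 2 + 6 * (‖∇ α x‖ ^ 4 + ‖∇ β x‖ ^ 4) + 3 * Δ α x ^ 2 := by
    linarith [laplacian_mul_sq_le (x := x) hα hβ, sq_nonneg (‖∇ α x‖ ^ 2 - ‖∇ β x‖ ^ 2),
      mul_le_mul_of_nonneg_right hα1 (sq_nonneg (Δ β x)),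
      mul_le_mul_of_nonneg_right hβ1 (sq_nonneg (Δ α x))]
  have grad_term : 12 * ‖∇ (fun y => α y * β y) x‖ ^ 2
      ≤ 24 * (cutoffError α x + cutoffError β x) := by
    unfold cutoffError
    linarith [sq_nonneg (‖∇ α x‖ ^ 2), sq_nonneg (‖∇ β x‖ ^ 2), sq_nonneg (Δ α x),
      sq_nonneg (Δ β x)]
  have lap_term : 3 * Δ (fun y => α y * β y) x ^ 2
      ≤ 24 * (cutoffError α x + cutoffError β x) := by
    unfold cutoffError
    linarith [sq_nonneg (‖∇ α x‖ ^ 2), sq_nonneg (‖∇ β x‖ ^ 2), sq_nonneg (Δ α x),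
      sq_nonneg (Δ β x), sq_nonneg ‖∇ α x‖, sq_nonneg ‖∇ β x‖]
  linarith [laplacian_mul_sq_le (x := x) (hα.mul hβ) hu,
    mul_le_mul_of_nonneg_right grad_term (sq_nonneg ‖∇ u x‖),
    mul_le_mul_of_nonneg_right lap_term (sq_nonneg (u x))]

/-- `χ` is a cutoff equal to one on the unit ball and to zero off the ball of radius two, whose
derivatives up to second order are controlled by `B`. -/
structure IsCutoff (χ : E → ℝ) (B : ℝ) : Prop where
  contDiff : ContDiff ℝ 2 χ
  nonneg : ∀ x, 0 ≤ χ x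
  le_one : ∀ x, χ x ≤ 1
  eq_one : ∀ x, ‖x‖ ≤ 1 → χ x = 1
  eq_zero : ∀ x, 2 ≤ ‖x‖ → χ x = 0
  one_le_bound : 1 ≤ B
  norm_gradient_sq_le : ∀ x, ‖∇ χ x‖ ^ 2 ≤ B
  laplacian_sq_le : ∀ x, Δ χ x ^ 2 ≤ B

variable (E) in
theorem exists_isCutoff : ∃ (χ : E → ℝ) (B : ℝ), IsCutoff χ B := by
  let b : ContDiffBump (0 : E) := ⟨1, 2, one_pos, one_lt_two⟩
  have hb : ContDiff ℝ 2 b := b.contDiff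
  have hc : HasCompactSupport b := b.hasCompactSupport
  obtain ⟨B₁, hB₁⟩ := (hc.mono' (subset_closure.trans
    tsupport_gradient_subset)).exists_bound_of_continuous (contDiff_gradient (n := 1) hb).continuous
  obtain ⟨B₂, hB₂⟩ := (hc.mono' (subset_closure.trans
    tsupport_laplacian_subset)).exists_bound_of_continuous (continuous_laplacian hb)
  refine ⟨b, 1 + B₁ ^ 2 + B₂ ^ 2, hb, fun x => b.nonneg, fun x => b.le_one,
    fun x hx => b.one_of_mem_closedBall (by simpa using hx),
    fun x hx => b.zero_of_le_dist (by simpa using hx), by linarith [sq_nonneg B₁, sq_nonneg B₂],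
    fun x => ?_, fun x => ?_⟩
  · linarith [pow_le_pow_left₀ (norm_nonneg _) (hB₁ x) 2, sq_nonneg B₂]
  · have := pow_le_pow_left₀ (norm_nonneg _) (hB₂ x) 2
    rw [Real.norm_eq_abs, sq_abs] at this
    linarith [sq_nonneg B₁]

namespace IsCutoff

variable (hχ : IsCutoff χ B)
include hχ

theorem sq_le_one (x : E) : χ x ^ 2 ≤ 1 :=
  pow_le_one₀ (hχ.nonneg x) (hχ.le_one x)

theorem contDiff_comp_smul (c : ℝ) : ContDiff ℝ 2 fun y => χ (c • y) :=
  hχ.contDiff.comp (contDiff_const_smul c)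

theorem comp_smul_eq_zero (hc : 0 < c) (hx : x ∉ Metric.closedBall 0 (2 / c)) :
    χ (c • x) = 0 := by
  rw [mem_closedBall_zero_iff, not_le, div_lt_iff₀ hc] at hx
  refine hχ.eq_zero _ ?_
  rw [norm_smul, Real.norm_of_nonneg hc.le, mul_comm]
  exact hx.le

theorem hasCompactSupport_comp_smul (hc : 0 < c) : HasCompactSupport fun y => χ (c • y) :=
  .intro (isCompact_closedBall 0 (2 / c)) fun _ => hχ.comp_smul_eq_zero hc

theorem tsupport_comp_smul_subset (hc : 0 < c) :
    (tsupport fun y => χ (c • y)) ⊆ Metric.closedBall 0 (2 / c) := by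
  refine closure_minimal (fun y hy => ?_) Metric.isClosed_closedBall
  exact not_not.1 fun hy' => hy (hχ.comp_smul_eq_zero hc hy')

theorem cutoffError_comp_smul_eq_zero (hx : ¬(1 ≤ ‖c • x‖ ∧ ‖c • x‖ ≤ 2)) :
    cutoffError (fun y => χ (c • y)) x = 0 := by
  have h_norm : Continuous fun y : E => ‖c • y‖ := (continuous_const_smul c).norm
  rcases lt_or_ge ‖c • x‖ 1 with h1 | h1
  · rw [← cutoffError_const_sub (hχ.contDiff_comp_smul c) 1]
    refine cutoffError_eq_zero (notMem_tsupport_iff_eventuallyEq.2 ?_)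
    filter_upwards [h_norm.continuousAt.eventually (gt_mem_nhds h1)] with y hy
    simp [hχ.eq_one _ hy.le]
  · have h2 : 2 < ‖c • x‖ := not_le.1 fun h2 => hx ⟨h1, h2⟩
    refine cutoffError_eq_zero (notMem_tsupport_iff_eventuallyEq.2 ?_)
    filter_upwards [h_norm.continuousAt.eventually (lt_mem_nhds h2)] with y hy
    exact hχ.eq_zero _ hy.le

theorem cutoffError_comp_smul_le (hc : 0 ≤ c) (x : E) :
    cutoffError (fun y => χ (c • y)) x ≤ 3 * B ^ 2 * max 1 c ^ 4 := by
  have hB : B ≤ B ^ 2 := le_self_pow₀ hχ.one_le_bound two_ne_zero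
  have hm : 1 ≤ max 1 c := le_max_left 1 c
  have hc2 : c ^ 2 ≤ max 1 c ^ 4 := (pow_le_pow_left₀ hc (le_max_right 1 c) 2).trans
    (pow_le_pow_right₀ hm (by norm_num))
  have hc4 : c ^ 4 ≤ max 1 c ^ 4 := pow_le_pow_left₀ hc (le_max_right 1 c) 4
  have h_grad : ‖∇ χ (c • x)‖ ^ 2 ≤ B ^ 2 := (hχ.norm_gradient_sq_le _).trans hB
  have h_grad' : (‖∇ χ (c • x)‖ ^ 2) ^ 2 ≤ B ^ 2 :=
    pow_le_pow_left₀ (sq_nonneg _) (hχ.norm_gradient_sq_le _) 2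
  have h_lap : Δ χ (c • x) ^ 2 ≤ B ^ 2 := (hχ.laplacian_sq_le _).trans hB
  have expand : cutoffError (fun y => χ (c • y)) x = c ^ 2 * ‖∇ χ (c • x)‖ ^ 2
      + c ^ 4 * (‖∇ χ (c • x)‖ ^ 2) ^ 2 + c ^ 4 * Δ χ (c • x) ^ 2 := by
    rw [cutoffError, gradient_comp_const_smul, laplacian_comp_const_smul hχ.contDiff, norm_smul,
      Real.norm_of_nonneg hc]
    ring
  calc cutoffError (fun y => χ (c • y)) x
      ≤ max 1 c ^ 4 * B ^ 2 + max 1 c ^ 4 * B ^ 2 + max 1 c ^ 4 * B ^ 2 := by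
        rw [expand]
        exact add_le_add_three (mul_le_mul hc2 h_grad (by positivity) (by positivity))
          (mul_le_mul hc4 h_grad' (by positivity) (by positivity))
          (mul_le_mul hc4 h_lap (by positivity) (by positivity))
    _ = 3 * B ^ 2 * max 1 c ^ 4 := by ring

end IsCutoff

end Cutoff

section CutoffCaccioppoli

variable {E : Type*} [NormedAddCommGroup E] [InnerProductSpace ℝ E] [FiniteDimensional ℝ E]
  [MeasurableSpace E] [BorelSpace E] {u χ : E → ℝ} {B c : ℝ}

theorem integral_le_const_mul_setIntegral {K : Set E} (hK : IsCompact K) {F h : E → ℝ} {C : ℝ}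
    (hh : Continuous h) (hF : ∀ x, 0 ≤ F x) (hF0 : ∀ x ∉ K, F x = 0)
    (hle : ∀ x ∈ K, F x ≤ C * h x) : ∫ x, F x ≤ C * ∫ x in K, h x := by
  rw [← integral_const_mul, ← setIntegral_eq_integral_of_forall_compl_eq_zero hF0]
  exact integral_mono_of_nonneg (.of_forall hF)
    ((hh.continuousOn.integrableOn_compact hK).const_mul C)
    ((ae_restrict_iff' hK.measurableSet).2 (.of_forall hle))

namespace IsCutoff

variable (hχ : IsCutoff χ B)
include hχ

theorem integrable_sq_mul (hc : 0 < c) {h : E → ℝ} (hh : Continuous h) :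
    Integrable fun x => χ (c • x) ^ 2 * h x := by
  refine (((hχ.contDiff_comp_smul c).continuous.pow 2).mul hh).integrable_of_hasCompactSupport
    (HasCompactSupport.mul_right ?_)
  simp only [sq]
  exact (hχ.hasCompactSupport_comp_smul hc).mul_left

theorem integral_sq_mul_norm_gradient_sq_le (hc : 0 < c) (hu : ContDiff ℝ 2 u) :
    ∫ x, χ (c • x) ^ 2 * ‖∇ u x‖ ^ 2
      ≤ (1 + 4 * B * c ^ 2) * ∫ x in Metric.closedBall 0 (2 / c), (u x ^ 2 + Δ u x ^ 2) := by
  refine (caccioppoli hu ((hχ.contDiff_comp_smul c).of_le one_le_two)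
    (hχ.hasCompactSupport_comp_smul hc)).trans ?_
  refine integral_le_const_mul_setIntegral (isCompact_closedBall 0 (2 / c))
    ((hu.continuous.pow 2).add ((continuous_laplacian hu).pow 2)) (fun x => by positivity)
    (fun x hx => ?_) fun x _ => ?_
  · have h_gradχ : ∇ (fun y => χ (c • y)) x = 0 := image_eq_zero_of_notMem_tsupport fun h =>
      hx (hχ.tsupport_comp_smul_subset hc (tsupport_gradient_subset h))
    simp [h_gradχ, hχ.comp_smul_eq_zero hc hx]
  · have h_grad : c ^ 2 * ‖∇ χ (c • x)‖ ^ 2 ≤ c ^ 2 * B :=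
      mul_le_mul_of_nonneg_left (hχ.norm_gradient_sq_le _) (by positivity)
    have hBc : 0 ≤ B * c ^ 2 * Δ u x ^ 2 := by
      have := zero_le_one.trans hχ.one_le_bound
      positivity
    rw [gradient_comp_const_smul, norm_smul, mul_pow, Real.norm_eq_abs, sq_abs]
    linarith [mul_le_mul_of_nonneg_right (hχ.sq_le_one (c • x))
      (by positivity : 0 ≤ u x ^ 2 + Δ u x ^ 2),
      mul_le_mul_of_nonneg_right h_grad (sq_nonneg (u x))]

theorem integral_sq_mul_le (hc : 0 < c) (hu : ContDiff ℝ 2 u) :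
    ∫ x, χ (c • x) ^ 2 * (‖∇ u x‖ ^ 2 + u x ^ 2)
      ≤ (2 + 4 * B * c ^ 2) * ∫ x in Metric.closedBall 0 (2 / c), (u x ^ 2 + Δ u x ^ 2) := by
  have h_sq : ∫ x, χ (c • x) ^ 2 * u x ^ 2
      ≤ 1 * ∫ x in Metric.closedBall 0 (2 / c), (u x ^ 2 + Δ u x ^ 2) := by
    refine integral_le_const_mul_setIntegral (isCompact_closedBall 0 (2 / c))
      ((hu.continuous.pow 2).add ((continuous_laplacian hu).pow 2)) (fun x => by positivity)
      (fun x hx => by simp [hχ.comp_smul_eq_zero hc hx]) fun x _ => ?_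
    linarith [mul_le_mul_of_nonneg_right (hχ.sq_le_one (c • x)) (sq_nonneg (u x)),
      sq_nonneg (Δ u x)]
  have int_grad : Integrable fun x => χ (c • x) ^ 2 * ‖∇ u x‖ ^ 2 :=
    hχ.integrable_sq_mul hc ((contDiff_gradient (n := 1) hu).continuous.norm.pow 2)
  have int_sq : Integrable fun x => χ (c • x) ^ 2 * u x ^ 2 :=
    hχ.integrable_sq_mul hc (hu.continuous.pow 2)
  simp only [mul_add]
  rw [integral_add int_grad int_sq]
  linarith [hχ.integral_sq_mul_norm_gradient_sq_le hc hu]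

end IsCutoff

end CutoffCaccioppoli

section WeightedInequality

theorem carlemanWeight_mul_sq_le {n : ℕ} (hn : 1 ≤ n) {β s r : ℝ} (hr : 0 < r) (hs : r ≤ s)
    (hβ : β * s ≤ 1 / 2) :
    carlemanWeight n β s * s ^ 2 ≤ (r ^ (n - 1))⁻¹ * Real.exp (n / 2) := by
  obtain ⟨k, rfl⟩ := Nat.exists_eq_add_of_le' hn
  have hs0 : 0 < s := hr.trans_le hs
  have cancel : carlemanWeight (k + 1) β s * s ^ 2
      = (s ^ k)⁻¹ * Real.exp ((k + 1 : ℕ) * β * s) := by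
    simp only [carlemanWeight]
    field_simp
    ring
  rw [cancel, Nat.add_sub_cancel, mul_assoc, div_eq_mul_one_div]
  gcongr

theorem inv_pow_le_carlemanWeight_mul {n : ℕ} {β s : ℝ} (hβ : 0 ≤ β) (hs : 0 < s) :
    (s ^ n)⁻¹ ≤ carlemanWeight n β s * s := by
  have cancel : carlemanWeight n β s * s = (s ^ n)⁻¹ * Real.exp (n * β * s) := by
    simp only [carlemanWeight]
    field_simp
    ring
  rw [cancel]
  exact le_mul_of_one_le_right (by positivity) (Real.one_le_exp (by positivity))

variable {E : Type*} [NormedAddCommGroup E] [InnerProductSpace ℝ E]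
  {u χ : E → ℝ} {x : E} {B a b c : ℝ} {n : ℕ}

/-- The cutoff to the annulus between the radii `1 / a` and `2 / b`. -/
def annularCutoff (χ : E → ℝ) (a b : ℝ) (x : E) : ℝ :=
  (1 - χ (a • x)) * χ (b • x)

/-- The Carleman weight with `β = b² / 8`, multiplied by `|x|^{2k}` and localised to the annulus
between the radii `1 / a` and `2 / b`. -/
noncomputable def annularWeight (n : ℕ) (χ : E → ℝ) (a b : ℝ) (k : ℕ) (x : E) : ℝ :=
  carlemanWeight n (b ^ 2 / 8) (‖x‖ ^ 2) * ((‖x‖ ^ 2) ^ k * annularCutoff χ a b x ^ 2)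

/-- The constant in front of the error which is caused by the cutoff at distance `1 / c` from the
origin. -/
noncomputable def cutoffConst (n : ℕ) (B c : ℝ) : ℝ :=
  216 * B ^ 3 * max 1 c ^ 6 * (c ^ (2 * (n - 1)) * Real.exp (n / 2))

theorem annularWeight_nonneg (n : ℕ) (χ : E → ℝ) (a b : ℝ) (k : ℕ) (x : E) :
    0 ≤ annularWeight n χ a b k x :=
  mul_nonneg (carlemanWeight_nonneg n _ (by positivity)) (by positivity)

variable [FiniteDimensional ℝ E]

theorem IsCutoff.carlemanWeight_mul_cutoffError_le (hχ : IsCutoff χ B) (hn : 1 ≤ n) {β : ℝ}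
    (hβ : 0 ≤ β) (hc : 0 < c) (hβc : β * (2 / c) ^ 2 ≤ 1 / 2) (x : E) :
    carlemanWeight n β (‖x‖ ^ 2) * (‖x‖ ^ 2) ^ 2 * cutoffError (fun y => χ (c • y)) x
      ≤ 3 * B ^ 2 * max 1 c ^ 4 * (c ^ (2 * (n - 1)) * Real.exp (n / 2))
        * χ ((c / 2) • x) ^ 2 := by
  by_cases hx : 1 ≤ ‖c • x‖ ∧ ‖c • x‖ ≤ 2
  · rw [norm_smul, Real.norm_of_nonneg hc.le, mul_comm] at hx
    have h_lower : (c⁻¹) ^ 2 ≤ ‖x‖ ^ 2 :=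
      pow_le_pow_left₀ (by positivity) ((inv_le_iff_one_le_mul₀ hc).2 hx.1) 2
    have h_upper : ‖x‖ ≤ 2 / c := (le_div_iff₀ hc).2 hx.2
    have h_weight : carlemanWeight n β (‖x‖ ^ 2) * (‖x‖ ^ 2) ^ 2
        ≤ c ^ (2 * (n - 1)) * Real.exp (n / 2) := by
      refine (carlemanWeight_mul_sq_le hn (by positivity) h_lower
        (le_trans (by gcongr) hβc)).trans_eq ?_
      rw [← pow_mul, ← inv_pow, inv_inv]
    have h_one : χ ((c / 2) • x) = 1 := hχ.eq_one _ (by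
      rw [norm_smul, Real.norm_of_nonneg (by positivity)]
      linarith [hx.2])
    rw [h_one, one_pow, mul_one, mul_comm]
    have := cutoffError_nonneg (fun y => χ (c • y)) x
    have := carlemanWeight_nonneg n β (sq_nonneg ‖x‖)
    gcongr
    exact hχ.cutoffError_comp_smul_le hc.le x
  · rw [hχ.cutoffError_comp_smul_eq_zero hx, mul_zero]
    positivity

namespace IsCutoff

variable (hχ : IsCutoff χ B)
include hχ

theorem contDiff_annularCutoff (a b : ℝ) : ContDiff ℝ 2 (annularCutoff χ a b) :=
  (contDiff_const.sub (hχ.contDiff_comp_smul a)).mul (hχ.contDiff_comp_smul b)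

theorem annularCutoff_eq_zero (hb : 0 < b) (hx : x ∉ Metric.closedBall 0 (2 / b)) :
    annularCutoff χ a b x = 0 := by
  simp [annularCutoff, hχ.comp_smul_eq_zero hb hx]

theorem annularCutoff_eq_one (ha : 0 < a) (hb : 0 < b) (hx : 2 / a ≤ ‖x‖) (hx' : ‖x‖ ≤ 1 / b) :
    annularCutoff χ a b x = 1 := by
  have h_inner : χ (a • x) = 0 := hχ.eq_zero _ (by
    rwa [norm_smul, Real.norm_of_nonneg ha.le, mul_comm, ← div_le_iff₀ ha])
  have h_outer : χ (b • x) = 1 := hχ.eq_one _ (by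
    rwa [norm_smul, Real.norm_of_nonneg hb.le, mul_comm, ← le_div_iff₀ hb])
  simp [annularCutoff, h_inner, h_outer]

theorem hasCompactSupport_annularCutoff (hb : 0 < b) : HasCompactSupport (annularCutoff χ a b) :=
  (hχ.hasCompactSupport_comp_smul hb).mul_left

theorem zero_notMem_tsupport_annularCutoff (a b : ℝ) : 0 ∉ tsupport (annularCutoff χ a b) := by
  have h_near : ∀ᶠ y : E in 𝓝 0, ‖a • y‖ < 1 :=
    (continuous_const_smul a).norm.continuousAt.eventually (gt_mem_nhds (by simp))
  rw [notMem_tsupport_iff_eventuallyEq]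
  filter_upwards [h_near] with y hy
  simp [annularCutoff, hχ.eq_one _ hy.le]

theorem norm_le_of_mem_tsupport_annularCutoff (hb : 0 < b)
    (hx : x ∈ tsupport (annularCutoff χ a b)) : ‖x‖ ≤ 2 / b :=
  mem_closedBall_zero_iff.1 (hχ.tsupport_comp_smul_subset hb (tsupport_mul_subset_right hx))

theorem continuous_annularWeight (k : ℕ) : Continuous (annularWeight n χ a b k) := by
  refine (contDiff_carlemanWeight_smul (m := 0) n (b ^ 2 / 8) (contDiff_zero.2 (Continuous.mul
    (by fun_prop) ((hχ.contDiff_annularCutoff a b).continuous.pow 2))) fun h => ?_).continuous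
  have h_supp : (Function.support fun y => (‖y‖ ^ 2) ^ k * annularCutoff χ a b y ^ 2)
      ⊆ Function.support (annularCutoff χ a b) := fun y hy hy0 => hy (by simp [hy0])
  exact hχ.zero_notMem_tsupport_annularCutoff a b (closure_mono h_supp h)

theorem annularWeight_eq_zero (hb : 0 < b) (k : ℕ) (hx : x ∉ Metric.closedBall 0 (2 / b)) :
    annularWeight n χ a b k x = 0 := by
  simp [annularWeight, hχ.annularCutoff_eq_zero hb hx]

theorem hasCompactSupport_annularWeight (hb : 0 < b) (k : ℕ) :
    HasCompactSupport (annularWeight n χ a b k) :=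
  .intro (isCompact_closedBall 0 (2 / b)) fun _ => hχ.annularWeight_eq_zero hb k

theorem annularWeight_two_le (hb : 0 < b) (x : E) :
    annularWeight n χ a b 2 x ≤ 4 / b ^ 2 * annularWeight n χ a b 1 x := by
  by_cases hx : x ∈ Metric.closedBall 0 (2 / b)
  · have h_norm : ‖x‖ ^ 2 ≤ 4 / b ^ 2 := by
      refine (pow_le_pow_left₀ (norm_nonneg x) (mem_closedBall_zero_iff.1 hx) 2).trans_eq ?_
      rw [div_pow]; norm_num
    calc annularWeight n χ a b 2 x = ‖x‖ ^ 2 * annularWeight n χ a b 1 x := by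
          unfold annularWeight; ring
      _ ≤ _ := mul_le_mul_of_nonneg_right h_norm (annularWeight_nonneg n χ a b 1 x)
  · simp [hχ.annularWeight_eq_zero hb _ hx]

theorem inv_pow_le_annularWeight_one (ha : 0 < a) (hb : 0 < b) (hx : 2 / a ≤ ‖x‖)
    (hx' : ‖x‖ ≤ 1 / b) : ((‖x‖ ^ 2) ^ n)⁻¹ ≤ annularWeight n χ a b 1 x := by
  have hx0 : 0 < ‖x‖ := (by positivity : 0 < 2 / a).trans_le hx
  simpa [annularWeight, hχ.annularCutoff_eq_one ha hb hx hx']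
    using inv_pow_le_carlemanWeight_mul (n := n) (by positivity : 0 ≤ b ^ 2 / 8)
      (by positivity : 0 < ‖x‖ ^ 2)

theorem carlemanWeight_mul_laplacian_annularCutoff_mul_sq_le (hn : 1 ≤ n) (hb : 0 < b)
    (hab : b ≤ a) (hu : ContDiff ℝ 2 u) (x : E) :
    carlemanWeight n (b ^ 2 / 8) (‖x‖ ^ 2)
        * ((‖x‖ ^ 2) ^ 2 * Δ (fun y => annularCutoff χ a b y * u y) x ^ 2)
      ≤ 3 * (annularWeight n χ a b 2 x * Δ u x ^ 2)
        + 72 * B ^ 2 * max 1 a ^ 4 * (a ^ (2 * (n - 1)) * Real.exp (n / 2))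
          * (χ ((a / 2) • x) ^ 2 * (‖∇ u x‖ ^ 2 + u x ^ 2))
        + 72 * B ^ 2 * max 1 b ^ 4 * (b ^ (2 * (n - 1)) * Real.exp (n / 2))
          * (χ ((b / 2) • x) ^ 2 * (‖∇ u x‖ ^ 2 + u x ^ 2)) := by
  have ha := hb.trans_le hab
  have hα : ContDiff ℝ 2 fun y => 1 - χ (a • y) := contDiff_const.sub (hχ.contDiff_comp_smul a)
  have hα1 : (1 - χ (a • x)) ^ 2 ≤ 1 :=
    pow_le_one₀ (by linarith [hχ.le_one (a • x)]) (by linarith [hχ.nonneg (a • x)])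
  have h_lap := laplacian_mul_mul_sq_le hα (hχ.contDiff_comp_smul b) hu hα1
    (hχ.sq_le_one (b • x))
  rw [cutoffError_const_sub (hχ.contDiff_comp_smul a)] at h_lap
  have hW : 0 ≤ carlemanWeight n (b ^ 2 / 8) (‖x‖ ^ 2) * (‖x‖ ^ 2) ^ 2 :=
    mul_nonneg (carlemanWeight_nonneg n _ (sq_nonneg _)) (by positivity)
  have h_small : b ^ 2 / 8 * (2 / a) ^ 2 ≤ 1 / 2 := by
    have : b ^ 2 ≤ a ^ 2 := pow_le_pow_left₀ hb.le hab 2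
    rw [div_pow, div_mul_div_comm, div_le_div_iff₀ (by positivity) (by norm_num)]
    linarith
  have h_small' : b ^ 2 / 8 * (2 / b) ^ 2 ≤ 1 / 2 := by field_simp; norm_num
  have h_G : 0 ≤ ‖∇ u x‖ ^ 2 + u x ^ 2 := by positivity
  have h_inner := mul_le_mul_of_nonneg_right
    (hχ.carlemanWeight_mul_cutoffError_le hn (by positivity) ha h_small x) h_G
  have h_outer := mul_le_mul_of_nonneg_right
    (hχ.carlemanWeight_mul_cutoffError_le hn (by positivity) hb h_small' x) h_G
  have h_weighted := mul_le_mul_of_nonneg_left h_lap hW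
  unfold annularWeight annularCutoff
  linarith

variable [MeasurableSpace E] [BorelSpace E]

theorem error_integral_le (hc : 0 < c) (hu : ContDiff ℝ 2 u) :
    72 * B ^ 2 * max 1 c ^ 4 * (c ^ (2 * (n - 1)) * Real.exp (n / 2))
        * ∫ x, χ ((c / 2) • x) ^ 2 * (‖∇ u x‖ ^ 2 + u x ^ 2)
      ≤ cutoffConst n B c * ∫ x in Metric.closedBall 0 (4 / c), (u x ^ 2 + Δ u x ^ 2) := by
  have h_cacc := hχ.integral_sq_mul_le (by positivity : 0 < c / 2) hu
  have hm : 1 ≤ max 1 c ^ 2 := one_le_pow₀ (le_max_left 1 c)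
  have hcm : c ^ 2 ≤ max 1 c ^ 2 := pow_le_pow_left₀ hc.le (le_max_right 1 c) 2
  have hB := hχ.one_le_bound
  have h_const : 2 + 4 * B * (c / 2) ^ 2 ≤ 3 * B * max 1 c ^ 2 := by nlinarith
  rw [show 2 / (c / 2) = 4 / c by field_simp; norm_num] at h_cacc
  have h_nonneg : 0 ≤ ∫ x in Metric.closedBall (0 : E) (4 / c), (u x ^ 2 + Δ u x ^ 2) :=
    integral_nonneg fun x => by positivity
  calc _ ≤ 72 * B ^ 2 * max 1 c ^ 4 * (c ^ (2 * (n - 1)) * Real.exp (n / 2))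
        * (3 * B * max 1 c ^ 2
          * ∫ x in Metric.closedBall 0 (4 / c), (u x ^ 2 + Δ u x ^ 2)) := by
        have := h_cacc.trans (mul_le_mul_of_nonneg_right h_const h_nonneg)
        gcongr
    _ = _ := by unfold cutoffConst; ring

theorem weighted_inequality (hn : 3 ≤ n) (hb : 0 < b) (hab : b ≤ a) (hu : ContDiff ℝ 2 u) :
    2 * (n : ℝ) ^ 3 * (b ^ 2 / 8) * ∫ x, annularWeight n χ a b 1 x * u x ^ 2
      ≤ 3 * (∫ x, annularWeight n χ a b 2 x * Δ u x ^ 2)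
        + cutoffConst n B a * (∫ x in Metric.closedBall 0 (4 / a), (u x ^ 2 + Δ u x ^ 2))
        + cutoffConst n B b * ∫ x in Metric.closedBall 0 (4 / b), (u x ^ 2 + Δ u x ^ 2) := by
  have ha := hb.trans_le hab
  have hηu : ContDiff ℝ 2 fun y => annularCutoff χ a b y * u y :=
    (hχ.contDiff_annularCutoff a b).mul hu
  have h_supp : tsupport (fun y => annularCutoff χ a b y * u y) ⊆ tsupport (annularCutoff χ a b) :=
    tsupport_mul_subset_left
  have h_carleman := carleman_estimate hn (by positivity : 0 ≤ b ^ 2 / 8) hηu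
    (hχ.hasCompactSupport_annularCutoff hb).mul_right
    (fun h => hχ.zero_notMem_tsupport_annularCutoff a b (h_supp h)) fun x hx => by
      have h_norm := hχ.norm_le_of_mem_tsupport_annularCutoff hb (h_supp hx)
      calc b ^ 2 / 8 * ‖x‖ ^ 2 ≤ b ^ 2 / 8 * (2 / b) ^ 2 := by gcongr
        _ = 1 / 2 := by field_simp; norm_num
  have int_main : Integrable fun x => annularWeight n χ a b 2 x * Δ u x ^ 2 :=
    ((hχ.continuous_annularWeight 2).mul
      ((continuous_laplacian hu).pow 2)).integrable_of_hasCompactSupport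
      (hχ.hasCompactSupport_annularWeight hb 2).mul_right
  have int_error {c : ℝ} (hc : 0 < c) :
      Integrable fun x => χ ((c / 2) • x) ^ 2 * (‖∇ u x‖ ^ 2 + u x ^ 2) :=
    hχ.integrable_sq_mul (by positivity)
      (((contDiff_gradient (n := 1) hu).continuous.norm.pow 2).add (hu.continuous.pow 2))
  have h_int := integral_mono_of_nonneg (.of_forall fun x => mul_nonneg
      (carlemanWeight_nonneg n _ (sq_nonneg _)) (by positivity))
    (((int_main.const_mul 3).add ((int_error ha).const_mul _)).add ((int_error hb).const_mul _))
    (.of_forall (hχ.carlemanWeight_mul_laplacian_annularCutoff_mul_sq_le (by omega) hb hab hu))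
  rw [integral_add' ((int_main.const_mul 3).add ((int_error ha).const_mul _))
      ((int_error hb).const_mul _),
    integral_add' (int_main.const_mul 3) ((int_error ha).const_mul _), integral_const_mul,
    integral_const_mul, integral_const_mul] at h_int
  have h_lhs : ∫ x, annularWeight n χ a b 1 x * u x ^ 2 = ∫ x, carlemanWeight n (b ^ 2 / 8)
      (‖x‖ ^ 2) * (‖x‖ ^ 2 * (annularCutoff χ a b x * u x) ^ 2) :=
    integral_congr_ae (.of_forall fun x => by simp only [annularWeight]; ring)
  rw [h_lhs]
  linarith [hχ.error_integral_le (n := n) ha hu, hχ.error_integral_le (n := n) hb hu]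

end IsCutoff

end WeightedInequality

/-! ### Weak solutions -/

section Isometry

variable {E : Type*} [NormedAddCommGroup E] [InnerProductSpace ℝ E] {f : E → ℝ} {x : E}

theorem affineIsometryEquiv_apply (A : E ≃ᵃⁱ[ℝ] E) (x : E) :
    A x = A.linearIsometryEquiv.toContinuousLinearEquiv x + A 0 := by
  have h := A.map_vadd 0 x
  simp only [vadd_eq_add, add_zero] at h
  exact h

theorem contDiff_affineIsometryEquiv {n : WithTop ℕ∞} (A : E ≃ᵃⁱ[ℝ] E) : ContDiff ℝ n A := by
  rw [funext (affineIsometryEquiv_apply A)]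
  exact (ContinuousLinearEquiv.contDiff _).add contDiff_const

variable [FiniteDimensional ℝ E]

theorem gradient_comp_affineIsometryEquiv (A : E ≃ᵃⁱ[ℝ] E) :
    ∇ (fun y => f (A y)) x = A.linearIsometryEquiv.symm (∇ f (A x)) := by
  let ℓ := A.linearIsometryEquiv.toContinuousLinearEquiv
  have hA : (fun y => f (A y)) = (fun y => f (y + A 0)) ∘ ℓ := funext fun y =>
    congrArg f (affineIsometryEquiv_apply A y)
  refine ext_inner_right ℝ fun v => ?_
  rw [inner_gradient_left, hA, ℓ.comp_right_fderiv, fderiv_comp_add_right,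
    ← affineIsometryEquiv_apply, LinearIsometryEquiv.inner_map_eq_flip,
    LinearIsometryEquiv.symm_symm, inner_gradient_left]
  rfl

theorem laplacian_comp_affineIsometryEquiv (A : E ≃ᵃⁱ[ℝ] E) (hf : ContDiff ℝ 2 f) :
    Δ (fun y => f (A y)) x = Δ f (A x) := by
  let ℓ := A.linearIsometryEquiv.toContinuousLinearEquiv
  have hfA : ContDiff ℝ 2 fun y => f (A y) := hf.comp (contDiff_affineIsometryEquiv A)
  have h_fderiv : fderiv ℝ (∇ fun y => f (A y)) x
      = (ℓ.symm : E →L[ℝ] E) ∘L fderiv ℝ (∇ f) (A x) ∘L (ℓ : E →L[ℝ] E) := by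
    have h_grad : (∇ fun y => f (A y)) = ℓ.symm ∘ (fun y => ∇ f (y + A 0)) ∘ ℓ :=
      funext fun y => by
        rw [gradient_comp_affineIsometryEquiv, affineIsometryEquiv_apply A y]
        rfl
    rw [h_grad, ℓ.symm.comp_fderiv, ℓ.comp_right_fderiv, fderiv_comp_add_right,
      ← affineIsometryEquiv_apply]
  rw [← divergence_gradient hfA, ← divergence_gradient hf, divergence, divergence, h_fderiv]
  exact LinearMap.trace_conj' _ ℓ.symm.toLinearEquiv

variable [MeasurableSpace E] [BorelSpace E]

theorem measurePreserving_affineIsometryEquiv (A : E ≃ᵃⁱ[ℝ] E) :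
    MeasurePreserving A volume volume := by
  rw [funext (affineIsometryEquiv_apply A)]
  exact (measurePreserving_add_right volume (A 0)).comp A.linearIsometryEquiv.measurePreserving

end Isometry

section WeakSolution

variable {E : Type*} [NormedAddCommGroup E] [InnerProductSpace ℝ E] [FiniteDimensional ℝ E]
  [MeasurableSpace E] {U V : Set E} {u g : E → ℝ}

/-- `u` solves `Δ u = g` in `U` in the sense of distributions. -/
def IsWeakSolution (U : Set E) (u g : E → ℝ) [BorelSpace E] : Prop :=
  ∀ φ : E → ℝ, ContDiff ℝ ∞ φ → HasCompactSupport φ → tsupport φ ⊆ U →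
    ∫ x, u x * Δ φ x = ∫ x, g x * φ x

namespace IsWeakSolution

variable [BorelSpace E]

theorem mono (h : IsWeakSolution U u g) (hVU : V ⊆ U) : IsWeakSolution V u g :=
  fun φ hφ hc hs => h φ hφ hc (hs.trans hVU)

theorem indicator (h : IsWeakSolution U u g) :
    IsWeakSolution U (U.indicator u) (U.indicator g) := by
  intro φ hφ hc hs
  have drop_indicator (v : E → ℝ) {w : E → ℝ} (hw : tsupport w ⊆ U) :
      (fun x => U.indicator v x * w x) = fun x => v x * w x := by
    ext x
    by_cases hx : x ∈ U
    · rw [Set.indicator_of_mem hx]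
    · rw [image_eq_zero_of_notMem_tsupport fun h => hx (hw h), mul_zero, mul_zero]
  rw [drop_indicator u (tsupport_laplacian_subset.trans hs), drop_indicator g hs]
  exact h φ hφ hc hs

theorem comp_affineIsometryEquiv (h : IsWeakSolution U u g) (A : E ≃ᵃⁱ[ℝ] E) :
    IsWeakSolution (A ⁻¹' U) (fun x => u (A x)) (fun x => g (A x)) := by
  intro φ hφ hc hs
  have h2 : (2 : WithTop ℕ∞) ≤ ∞ := WithTop.coe_le_coe.2 le_top
  have hA : MeasurableEmbedding A := A.toHomeomorph.measurableEmbedding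
  have hφA : ContDiff ℝ ∞ fun y => φ (A.symm y) :=
    hφ.comp (contDiff_affineIsometryEquiv A.symm)
  have hsA : tsupport (fun y => φ (A.symm y)) ⊆ U := fun y hy => by
    have : A.symm y ∈ tsupport φ :=
      tsupport_comp_subset_preimage φ A.symm.continuous hy
    simpa using hs this
  have h_int (v w : E → ℝ) : ∫ x, v (A x) * w x = ∫ y, v y * w (A.symm y) := by
    simpa using (measurePreserving_affineIsometryEquiv A).integral_comp hA
      fun y => v y * w (A.symm y)
  rw [h_int u, h_int g, ← h _ hφA (hc.comp_homeomorph A.symm.toHomeomorph) hsA]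
  exact integral_congr_ae (.of_forall fun y => by
    simp only [laplacian_comp_affineIsometryEquiv A.symm (hφ.of_le h2)])

end IsWeakSolution

end WeakSolution

section QuadraticLimit

variable {α F : Type*} [MeasurableSpace α] {μ : Measure α} [NormedAddCommGroup F]
  [InnerProductSpace ℝ F]

theorem tendsto_integral_inner_of_tendsto_eLpNorm {f h : ℕ → α → F} {f₀ h₀ : α → F}
    (hf : ∀ n, MemLp (f n) 2 μ) (hf₀ : MemLp f₀ 2 μ) (hh : ∀ n, MemLp (h n) 2 μ)
    (hh₀ : MemLp h₀ 2 μ) (hf_lim : Tendsto (fun n => eLpNorm (f n - f₀) 2 μ) atTop (𝓝 0))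
    (hh_lim : Tendsto (fun n => eLpNorm (h n - h₀) 2 μ) atTop (𝓝 0)) :
    Tendsto (fun n => ∫ x, inner ℝ (f n x) (h n x) ∂μ) atTop
      (𝓝 (∫ x, inner ℝ (f₀ x) (h₀ x) ∂μ)) := by
  have inner_eq {a b : α → F} (ha : MemLp a 2 μ) (hb : MemLp b 2 μ) :
      inner ℝ (ha.toLp a) (hb.toLp b) = ∫ x, inner ℝ (a x) (b x) ∂μ := by
    rw [L2.inner_def]
    refine integral_congr_ae ?_
    filter_upwards [ha.coeFn_toLp, hb.coeFn_toLp] with x hx hx'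
    rw [hx, hx']
  have inner_lim := ((Lp.tendsto_Lp_iff_tendsto_eLpNorm'' f hf f₀ hf₀).2 hf_lim).inner (𝕜 := ℝ)
    ((Lp.tendsto_Lp_iff_tendsto_eLpNorm'' h hh h₀ hh₀).2 hh_lim)
  simpa only [inner_eq] using inner_lim

theorem tendsto_integral_sq_of_tendsto_eLpNorm {f : ℕ → α → ℝ} {f₀ w : α → ℝ}
    (hf : ∀ n, MemLp (f n) 2 μ) (hf₀ : MemLp f₀ 2 μ)
    (hlim : Tendsto (fun n => eLpNorm (f n - f₀) 2 μ) atTop (𝓝 0)) (hw : AEStronglyMeasurable w μ)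
    {C : ℝ} (hwC : ∀ x, ‖w x‖ ≤ C) :
    Tendsto (fun n => ∫ x, w x * f n x ^ 2 ∂μ) atTop (𝓝 (∫ x, w x * f₀ x ^ 2 ∂μ)) := by
  have hw_top : MemLp w ⊤ μ := memLp_top_of_bound hw C (.of_forall hwC)
  have weighted {a : α → ℝ} (ha : MemLp a 2 μ) : MemLp (w * a) 2 μ := ha.mul (r := 2) hw_top
  have weighted_lim : Tendsto (fun n => eLpNorm (w * f n - w * f₀) 2 μ) atTop (𝓝 0) := by
    have upper : Tendsto (fun n => ENNReal.ofReal C * eLpNorm (f n - f₀) 2 μ) atTop (𝓝 0) := by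
      simpa using ENNReal.Tendsto.const_mul hlim (Or.inr ENNReal.ofReal_ne_top)
    refine tendsto_of_tendsto_of_tendsto_of_le_of_le tendsto_const_nhds upper
      (fun _ => zero_le) fun n => ?_
    refine eLpNorm_le_mul_eLpNorm_of_ae_le_mul (.of_forall fun x => ?_) 2
    rw [← mul_sub, Pi.mul_apply, norm_mul]
    exact mul_le_mul_of_nonneg_right (hwC x) (norm_nonneg _)
  have h_inner := tendsto_integral_inner_of_tendsto_eLpNorm hf hf₀ (fun n => weighted (hf n))
    (weighted hf₀) hlim weighted_lim
  simpa only [Pi.mul_apply, RCLike.inner_apply, conj_trivial, mul_assoc, ← sq] using h_inner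

end QuadraticLimit

section Minkowski

variable {α β : Type*} [MeasurableSpace α] [MeasurableSpace β] {μ : Measure α} {ν : Measure β}

theorem eLpNorm_two_rpow_two (f : α → ℝ) :
    eLpNorm f 2 μ ^ (2 : ℝ) = ∫⁻ x, ‖f x‖ₑ ^ (2 : ℝ) ∂μ :=
  eLpNorm_nnreal_pow_eq_lintegral (p := 2) two_ne_zero

variable [SFinite μ] [IsProbabilityMeasure ν] {F : α → β → ℝ} {ε : ENNReal}

theorem eLpNorm_integral_le (hF : AEStronglyMeasurable F.uncurry (μ.prod ν))
    (hε : ∀ᵐ t ∂ν, eLpNorm (fun x => F x t) 2 μ ≤ ε) :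
    eLpNorm (fun x => ∫ t, F x t ∂ν) 2 μ ≤ ε := by
  have jensen : ∀ᵐ x ∂μ, ‖∫ t, F x t ∂ν‖ₑ ^ (2 : ℝ) ≤ ∫⁻ t, ‖F x t‖ₑ ^ (2 : ℝ) ∂ν := by
    filter_upwards [hF.prodMk_left] with x hx
    rw [← eLpNorm_two_rpow_two]
    gcongr
    calc ‖∫ t, F x t ∂ν‖ₑ ≤ eLpNorm (F x) 1 ν :=
          (enorm_integral_le_lintegral_enorm _).trans_eq eLpNorm_one_eq_lintegral_enorm.symm
      _ ≤ eLpNorm (F x) 2 ν := eLpNorm_le_eLpNorm_of_exponent_le one_le_two hx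
  rw [← ENNReal.rpow_le_rpow_iff (two_pos : (0 : ℝ) < 2), eLpNorm_two_rpow_two]
  calc ∫⁻ x, ‖∫ t, F x t ∂ν‖ₑ ^ (2 : ℝ) ∂μ
      ≤ ∫⁻ x, ∫⁻ t, ‖F x t‖ₑ ^ (2 : ℝ) ∂ν ∂μ := lintegral_mono_ae jensen
    _ = ∫⁻ t, ∫⁻ x, ‖F x t‖ₑ ^ (2 : ℝ) ∂μ ∂ν :=
        lintegral_lintegral_swap (hF.enorm.pow_const _)
    _ ≤ ∫⁻ _, ε ^ (2 : ℝ) ∂ν := lintegral_mono_ae <| by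
        filter_upwards [hε] with t ht
        rw [← eLpNorm_two_rpow_two]
        gcongr
    _ = ε ^ (2 : ℝ) := by simp

end Minkowski

section Mollification

variable {E : Type*} [NormedAddCommGroup E] [InnerProductSpace ℝ E] [FiniteDimensional ℝ E]
  [MeasurableSpace E] [BorelSpace E] {u g ρ : E → ℝ} {x : E}

/-- The convolution of `u` with the kernel `ρ`. -/
noncomputable abbrev mollify (ρ u : E → ℝ) : E → ℝ :=
  ρ ⋆[ContinuousLinearMap.lsmul ℝ ℝ, volume] u

theorem fderiv_mollify_apply (hρ : ContDiff ℝ 1 ρ) (hc : HasCompactSupport ρ)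
    (hu : LocallyIntegrable u) (v : E) :
    fderiv ℝ (mollify ρ u) x v = mollify (fun y => fderiv ℝ ρ y v) u x := by
  rw [(hc.hasFDerivAt_convolution_left _ hρ hu x).fderiv, convolution_def, mollify, convolution_def,
    ContinuousLinearMap.integral_apply]
  · rfl
  · exact (hc.fderiv ℝ).convolutionExists_left _ (hρ.continuous_fderiv one_ne_zero) hu x

theorem laplacian_mollify (hρ : ContDiff ℝ 2 ρ) (hc : HasCompactSupport ρ)
    (hu : LocallyIntegrable u) : Δ (mollify ρ u) x = mollify (Δ ρ) u x := by
  let b := stdOrthonormalBasis ℝ E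
  have hm : ContDiff ℝ 2 (mollify ρ u) := hc.contDiff_convolution_left (n := 2) _ hρ hu
  have hρ' (v : E) : ContDiff ℝ 1 fun y => fderiv ℝ ρ y v :=
    (hρ.fderiv_right (m := 1) le_rfl).clm_apply contDiff_const
  have hc' (v : E) : HasCompactSupport fun y => fderiv ℝ ρ y v := hc.fderiv_apply ℝ v
  have sum_eq {f : E → ℝ} (hf : ContDiff ℝ 2 f) (y : E) :
      Δ f y = ∑ i, fderiv ℝ (fun z => fderiv ℝ f z (b i)) y (b i) := by
    rw [← divergence_gradient hf, divergence_eq_sum_fderiv_inner (differentiable_gradient hf y) b]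
    simp only [real_inner_comm, inner_gradient_left]
  have h_exists (i) : ConvolutionExists (fun y => fderiv ℝ (fun z => fderiv ℝ ρ z (b i)) y (b i))
      u (ContinuousLinearMap.lsmul ℝ ℝ) volume :=
    ((hc' _).fderiv_apply ℝ _).convolutionExists_left _
      (((hρ' _).continuous_fderiv one_ne_zero).clm_apply continuous_const) hu
  have fderiv_eq (v : E) : (fun z => fderiv ℝ (mollify ρ u) z v)
      = mollify (fun y => fderiv ℝ ρ y v) u :=
    funext fun z => fderiv_mollify_apply (hρ.of_le one_le_two) hc hu v
  rw [sum_eq hm]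
  simp only [fderiv_eq, fderiv_mollify_apply (hρ' _) (hc' _) hu]
  simp only [mollify, convolution_lsmul, smul_eq_mul, sum_eq hρ, Finset.sum_mul]
  exact (integral_finsetSum _ fun i _ => h_exists i x).symm

theorem IsWeakSolution.laplacian_mollify {U : Set E} {r : ℝ} (h : IsWeakSolution U u g)
    (hρ : ContDiff ℝ ∞ ρ) (hs : Function.support ρ ⊆ Metric.closedBall 0 r)
    (hu : LocallyIntegrable u) (hx : Metric.closedBall x r ⊆ U) :
    Δ (mollify ρ u) x = mollify ρ g x := by
  have hρ2 : ContDiff ℝ 2 ρ := hρ.of_le (WithTop.coe_le_coe.2 le_top)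
  let A := AffineIsometryEquiv.constVSub ℝ x
  have hc : HasCompactSupport ρ :=
    .of_support_subset_isCompact (isCompact_closedBall 0 r) hs
  have hsA : tsupport (fun t => ρ (A t)) ⊆ Metric.closedBall x r := by
    refine closure_minimal (fun t ht => ?_) Metric.isClosed_closedBall
    simpa [A, dist_eq_norm, norm_sub_rev] using hs ht
  have weak_eq := h (fun t => ρ (A t)) (hρ.comp (contDiff_affineIsometryEquiv A))
    (hc.comp_homeomorph A.toHomeomorph) (hsA.trans hx)
  simp only [laplacian_comp_affineIsometryEquiv A hρ2] at weak_eq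
  rw [ScaleFreeUCP.laplacian_mollify hρ2 hc hu, mollify, mollify,
    convolution_lsmul_swap, convolution_lsmul_swap]
  simpa [A, mul_comm] using weak_eq

theorem tendsto_eLpNorm_translate (hu : MemLp u 2) :
    Tendsto (fun t : E => eLpNorm (fun x => u (x - t) - u x) 2) (𝓝 0) (𝓝 0) := by
  let translation : C(E × E, E) := ⟨fun p => p.2 - p.1, by fun_prop⟩
  have h_mp (t : E) : MeasurePreserving (translation.curry t) volume volume :=
    measurePreserving_sub_right volume t
  have h_lim : Tendsto (fun t => Lp.compMeasurePreserving (translation.curry t) (h_mp t)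
      (hu.toLp u)) (𝓝 0) (𝓝 (Lp.compMeasurePreserving (translation.curry 0) (h_mp 0)
      (hu.toLp u))) :=
    tendsto_const_nhds.compMeasurePreservingLp (translation.curry.continuous.tendsto 0) h_mp
      (h_mp 0) (by simp)
  rw [tendsto_iff_edist_tendsto_0] at h_lim
  refine h_lim.congr fun t => ?_
  rw [Lp.toLp_compMeasurePreserving, Lp.toLp_compMeasurePreserving, Lp.edist_toLp_toLp]
  congr 1
  ext x
  simp [translation]

theorem eLpNorm_mollify_sub_le (hu : MemLp u 2) (b : ContDiffBump (0 : E)) {ε : ENNReal}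
    (hε : ∀ t, ‖t‖ < b.rOut → eLpNorm (fun x => u (x - t) - u x) 2 ≤ ε) :
    eLpNorm (mollify (b.normed volume) u - u) 2 ≤ ε := by
  let ν : Measure E := volume.withDensity fun t => ENNReal.ofReal (b.normed volume t)
  have h_meas : Measurable fun t => ENNReal.ofReal (b.normed volume t) :=
    b.continuous_normed.measurable.ennreal_ofReal
  have : IsProbabilityMeasure ν := ⟨by
    rw [withDensity_apply _ .univ, Measure.restrict_univ,
      ← ofReal_integral_eq_lintegral_ofReal b.integrable_normed (.of_forall b.nonneg_normed),
      b.integral_normed, ENNReal.ofReal_one]⟩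
  have h_toReal (t : E) : (ENNReal.ofReal (b.normed volume t)).toReal = b.normed volume t :=
    ENNReal.toReal_ofReal (b.nonneg_normed t)
  have mollify_eq (x : E) : mollify (b.normed volume) u x - u x = ∫ t, (u (x - t) - u x) ∂ν := by
    have h_int : Integrable (fun t => u (x - t)) ν := by
      rw [integrable_withDensity_iff_integrable_smul' h_meas (by simp)]
      simpa [h_toReal, ConvolutionExistsAt] using
        b.hasCompactSupport_normed.convolutionExists_left (ContinuousLinearMap.lsmul ℝ ℝ)
          b.continuous_normed (hu.locallyIntegrable one_le_two) x
    rw [integral_sub h_int (integrable_const _), integral_const, probReal_univ, one_smul,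
      integral_withDensity_eq_integral_toReal_smul h_meas (by simp)]
    simp only [h_toReal, convolution_lsmul]
  have h_joint : AEStronglyMeasurable (fun p : E × E => u (p.1 - p.2) - u p.1)
      (volume.prod ν) := by
    have h_ac : volume.prod ν ≪ (volume : Measure E).prod volume :=
      Measure.AbsolutelyContinuous.rfl.prod (withDensity_absolutelyContinuous _ _)
    exact ((hu.1.comp_quasiMeasurePreserving
      (quasiMeasurePreserving_sub_of_right_invariant volume volume)).sub
      hu.1.comp_fst).mono_ac h_ac
  have h_ae : ∀ᵐ t ∂ν, eLpNorm (fun x => u (x - t) - u x) 2 ≤ ε := by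
    refine (ae_withDensity_iff h_meas).2 (.of_forall fun t ht => hε t ?_)
    have : t ∈ Function.support (b.normed volume) := fun h0 => ht (by simp [h0])
    simpa [b.support_normed_eq] using this
  refine (eLpNorm_congr_ae (.of_forall mollify_eq)).trans_le (eLpNorm_integral_le h_joint h_ae)

variable (E) in
/-- A sequence of bump functions shrinking to the origin. -/
noncomputable def shrinkingBump (k : ℕ) : ContDiffBump (0 : E) :=
  ⟨1 / (k + 1) / 2, 1 / (k + 1), by positivity, half_lt_self (by positivity)⟩

variable (E) in
/-- The smooth kernels of mass one which approximate the identity. -/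
noncomputable def mollifier (k : ℕ) : E → ℝ :=
  (shrinkingBump E k).normed volume

theorem tendsto_eLpNorm_mollify (hu : MemLp u 2) :
    Tendsto (fun k => eLpNorm (mollify (mollifier E k) u - u) 2) atTop (𝓝 0) := by
  rw [ENNReal.tendsto_nhds_zero]
  intro ε hε
  obtain ⟨r, hr, h_near⟩ := Metric.eventually_nhds_iff_ball.1
    (ENNReal.tendsto_nhds_zero.1 (tendsto_eLpNorm_translate hu) ε hε)
  filter_upwards [tendsto_one_div_add_atTop_nhds_zero_nat.eventually (gt_mem_nhds hr)] with k hk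
  refine eLpNorm_mollify_sub_le hu _ fun t ht => h_near t ?_
  rw [mem_ball_zero_iff]
  exact lt_trans ht hk

end Mollification

/-! ### Local unique continuation -/

section Approximation

variable {E : Type*} [NormedAddCommGroup E] [InnerProductSpace ℝ E] [FiniteDimensional ℝ E]
  [MeasurableSpace E] [BorelSpace E] {u g : E → ℝ} {R : ℝ}

theorem contDiff_mollifier (k : ℕ) {n : ℕ∞} : ContDiff ℝ n (mollifier E k) :=
  (shrinkingBump E k).contDiff_normed

theorem support_mollifier_subset (k : ℕ) :
    Function.support (mollifier E k) ⊆ Metric.closedBall 0 (1 / (k + 1)) := by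
  rw [mollifier, (shrinkingBump E k).support_normed_eq]
  exact Metric.ball_subset_closedBall

theorem contDiff_mollify_mollifier (hu : LocallyIntegrable u) (k : ℕ) :
    ContDiff ℝ 2 (mollify (mollifier E k) u) :=
  (shrinkingBump E k).hasCompactSupport_normed.contDiff_convolution_left (n := 2) _
    (contDiff_mollifier k (n := 2)) hu

theorem memLp_mollify (hu : MemLp u 2) (k : ℕ) : MemLp (mollify (mollifier E k) u) 2 := by
  have h_cont := (contDiff_mollify_mollifier (hu.locallyIntegrable one_le_two) k).continuous
  have h_translate (t : E) : eLpNorm (fun x => u (x - t) - u x) 2 ≤ 2 * eLpNorm u 2 := by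
    have h_mp : MeasurePreserving (fun x : E => x - t) volume volume :=
      measurePreserving_sub_right volume t
    refine (eLpNorm_sub_le (hu.comp_measurePreserving h_mp).1 hu.1 one_le_two).trans_eq ?_
    rw [eLpNorm_comp_measurePreserving hu.1 h_mp, two_mul]
  have h_sub : MemLp (mollify (mollifier E k) u - u) 2 :=
    ⟨h_cont.aestronglyMeasurable.sub hu.1,
      (eLpNorm_mollify_sub_le hu _ fun t _ => h_translate t).trans_lt
        (ENNReal.mul_lt_top ENNReal.ofNat_lt_top hu.2)⟩
  simpa using h_sub.add hu

namespace IsWeakSolution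

theorem laplacian_mollify_mollifier (h : IsWeakSolution (Metric.ball 0 (R + 1)) u g)
    (hu : LocallyIntegrable u) {k : ℕ} (hk : 1 ≤ k) {x : E} (hx : x ∈ Metric.closedBall 0 R) :
    Δ (mollify (mollifier E k) u) x = mollify (mollifier E k) g x := by
  have h_radius : (1 : ℝ) / (k + 1) < 1 := by
    rw [div_lt_one (by positivity)]
    exact lt_add_of_pos_left 1 (by exact_mod_cast hk)
  refine h.laplacian_mollify (contDiff_mollifier k) (support_mollifier_subset k) hu ?_
  refine (Metric.closedBall_subset_ball' ?_).trans subset_rfl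
  rw [mem_closedBall_iff_norm, sub_zero] at hx
  rw [dist_zero_right]
  linarith

theorem exists_smooth_approx (h : IsWeakSolution (Metric.ball 0 (R + 1)) u g) (hu : MemLp u 2)
    (hg : MemLp g 2) : ∃ v : ℕ → E → ℝ, (∀ k, ContDiff ℝ 2 (v k)) ∧
      ∀ (w : E → ℝ) (C : ℝ), AEStronglyMeasurable w → (∀ x, ‖w x‖ ≤ C) →
        (∀ x ∉ Metric.closedBall 0 R, w x = 0) →
        Tendsto (fun k => ∫ x, w x * v k x ^ 2) atTop (𝓝 (∫ x, w x * u x ^ 2)) ∧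
        Tendsto (fun k => ∫ x, w x * Δ (v k) x ^ 2) atTop (𝓝 (∫ x, w x * g x ^ 2)) := by
  have hul := hu.locallyIntegrable one_le_two
  refine ⟨fun k => mollify (mollifier E k) u, contDiff_mollify_mollifier hul,
    fun w C hw hwC hw0 => ⟨tendsto_integral_sq_of_tendsto_eLpNorm (memLp_mollify hu) hu
      (tendsto_eLpNorm_mollify hu) hw hwC, ?_⟩⟩
  refine (tendsto_integral_sq_of_tendsto_eLpNorm (memLp_mollify hg) hg
    (tendsto_eLpNorm_mollify hg) hw hwC).congr' ?_
  filter_upwards [eventually_ge_atTop 1] with k hk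
  refine integral_congr_ae (.of_forall fun x => ?_)
  by_cases hx : x ∈ Metric.closedBall 0 R
  · simp only [h.laplacian_mollify_mollifier hul hk hx]
  · simp only [hw0 x hx, zero_mul]

end IsWeakSolution

end Approximation

section AnnularEstimate

variable {B K a b r : ℝ} {n : ℕ}

theorem cutoffConst_nonneg (hB : 0 ≤ B) (ha : 0 ≤ a) : 0 ≤ cutoffConst n B a := by
  unfold cutoffConst; positivity

theorem sq_le_of_abs_le_mul_abs {s t : ℝ} (h : |s| ≤ K * |t|) : s ^ 2 ≤ K ^ 2 * t ^ 2 := by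
  rw [← sq_abs s, ← sq_abs t, ← mul_pow]
  exact pow_le_pow_left₀ (abs_nonneg _) h 2

theorem le_of_absorb {N I T : ℝ} (hN : 0 < N) (hb : 0 < b) (hI : 0 ≤ I) (hT : 0 ≤ T)
    (hNb : 96 * K ^ 2 ≤ N * b ^ 4) (hNK : 1 + K ^ 2 ≤ N)
    (h : 2 * N * (b ^ 2 / 8) * I ≤ 3 * (4 / b ^ 2 * K ^ 2 * I) + (1 + K ^ 2) * T) :
    I ≤ 8 / b ^ 2 * T := by
  have half : 3 * (4 / b ^ 2 * K ^ 2) ≤ N * (b ^ 2 / 8) := by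
    refine le_of_mul_le_mul_right ?_ (by positivity : 0 < 8 * b ^ 2)
    calc 3 * (4 / b ^ 2 * K ^ 2) * (8 * b ^ 2) = 96 * K ^ 2 := by field_simp; ring
      _ ≤ N * b ^ 4 := hNb
      _ = N * (b ^ 2 / 8) * (8 * b ^ 2) := by ring
  have absorbed : N * (b ^ 2 / 8 * I) ≤ N * T := by
    linarith [mul_le_mul_of_nonneg_right half hI, mul_le_mul_of_nonneg_right hNK hT]
  calc I = 8 / b ^ 2 * (b ^ 2 / 8 * I) := by field_simp
    _ ≤ 8 / b ^ 2 * T := by gcongr; exact le_of_mul_le_mul_left absorbed hN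

theorem indicator_one_mul {α : Type*} (s : Set α) (f : α → ℝ) :
    (fun x => s.indicator 1 x * f x) = s.indicator f := by
  ext x
  by_cases hx : x ∈ s <;> simp [hx]

variable {E : Type*} [NormedAddCommGroup E] [InnerProductSpace ℝ E] [FiniteDimensional ℝ E]
  {χ u g : E → ℝ}

theorem IsCutoff.exists_norm_annularWeight_le (hχ : IsCutoff χ B) (hb : 0 < b) (k : ℕ) :
    ∃ C, ∀ x, ‖annularWeight n χ a b k x‖ ≤ C :=
  (hχ.hasCompactSupport_annularWeight hb k).exists_bound_of_continuous
    (hχ.continuous_annularWeight k)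

variable [MeasurableSpace E] [BorelSpace E]

theorem IsCutoff.weighted_inequality_of_isWeakSolution (hχ : IsCutoff χ B) (hn : 3 ≤ n)
    (hb : 0 < b) (hab : b ≤ a) (h : IsWeakSolution (Metric.ball 0 (4 / b + 1)) u g)
    (hu : MemLp u 2) (hg : MemLp g 2) :
    2 * (n : ℝ) ^ 3 * (b ^ 2 / 8) * ∫ x, annularWeight n χ a b 1 x * u x ^ 2
      ≤ 3 * (∫ x, annularWeight n χ a b 2 x * g x ^ 2)
        + cutoffConst n B a * ((∫ x in Metric.closedBall 0 (4 / a), u x ^ 2)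
          + ∫ x in Metric.closedBall 0 (4 / a), g x ^ 2)
        + cutoffConst n B b * ((∫ x in Metric.closedBall 0 (4 / b), u x ^ 2)
          + ∫ x in Metric.closedBall 0 (4 / b), g x ^ 2) := by
  obtain ⟨v, hv, h_lim⟩ := h.exists_smooth_approx hu hg
  choose C hC using hχ.exists_norm_annularWeight_le (n := n) (a := a) hb
  have h_weight (k : ℕ) := h_lim _ (C k) (hχ.continuous_annularWeight k).aestronglyMeasurable
    (hC k) fun x hx => hχ.annularWeight_eq_zero hb k fun hx' =>
      hx (Metric.closedBall_subset_closedBall (by gcongr; norm_num) hx')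
  have h_ball {c : ℝ} (hbc : b ≤ c) := by
    have h_lim := h_lim ((Metric.closedBall 0 (4 / c)).indicator 1) 1
      (measurable_one.indicator measurableSet_closedBall).aestronglyMeasurable
      (fun x => (norm_indicator_le_norm_self _ x).trans (by simp)) fun x hx =>
        Set.indicator_of_notMem
          (fun hx' => hx (Metric.closedBall_subset_closedBall (by gcongr) hx')) _
    simpa only [indicator_one_mul, integral_indicator measurableSet_closedBall] using
      h_lim.1.add h_lim.2
  refine le_of_tendsto_of_tendsto' ((h_weight 1).1.const_mul _)
    ((((h_weight 2).2.const_mul 3).add ((h_ball hab).const_mul _)).add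
      ((h_ball le_rfl).const_mul _)) fun k => ?_
  have h_int {f : E → ℝ} (hf : Continuous f) (c : ℝ) :
      IntegrableOn (fun x => f x ^ 2) (Metric.closedBall 0 (4 / c)) :=
    (hf.pow 2).continuousOn.integrableOn_compact (isCompact_closedBall 0 _)
  have h_add (c : ℝ) :=
    integral_add (h_int (hv k).continuous c) (h_int (continuous_laplacian (hv k)) c)
  simpa only [h_add] using hχ.weighted_inequality hn hb hab (hv k)

theorem IsCutoff.integrable_annularWeight_mul (hχ : IsCutoff χ B) (hb : 0 < b) (k : ℕ)
    (hu : MemLp u 2) : Integrable fun x => annularWeight n χ a b k x * u x ^ 2 := by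
  obtain ⟨C, hC⟩ := hχ.exists_norm_annularWeight_le (n := n) (a := a) hb k
  exact hu.integrable_sq.bdd_mul (hχ.continuous_annularWeight k).aestronglyMeasurable
    (.of_forall hC)

/-- The potential term is absorbed: `n³ b⁴ ≥ 96 K²` makes it half of the left-hand side. -/
theorem IsCutoff.integral_annularWeight_mul_sq_le (hχ : IsCutoff χ B) (hn : 3 ≤ n) (hb : 0 < b)
    (hab : b ≤ a) (hnb : 96 * K ^ 2 ≤ n ^ 3 * b ^ 4) (hnK : 1 + K ^ 2 ≤ n ^ 3)
    (h : IsWeakSolution (Metric.ball 0 (4 / b + 1)) u g) (hu : MemLp u 2) (hg : MemLp g 2)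
    (hgu : ∀ᵐ x, |g x| ≤ K * |u x|) :
    ∫ x, annularWeight n χ a b 1 x * u x ^ 2
      ≤ 8 / b ^ 2 * (cutoffConst n B a * (∫ x in Metric.closedBall 0 (4 / a), u x ^ 2)
        + cutoffConst n B b * ∫ x in Metric.closedBall 0 (4 / b), u x ^ 2) := by
  have ha := hb.trans_le hab
  have h_sq : ∀ᵐ x, g x ^ 2 ≤ K ^ 2 * u x ^ 2 := hgu.mono fun x hx => sq_le_of_abs_le_mul_abs hx
  have h_ball (s : Set E) : ∫ x in s, g x ^ 2 ≤ K ^ 2 * ∫ x in s, u x ^ 2 := by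
    rw [← integral_const_mul]
    exact integral_mono_ae hg.integrable_sq.integrableOn
      (hu.integrable_sq.integrableOn.const_mul _) (ae_restrict_of_ae h_sq)
  have h_potential : ∫ x, annularWeight n χ a b 2 x * g x ^ 2
      ≤ 4 / b ^ 2 * K ^ 2 * ∫ x, annularWeight n χ a b 1 x * u x ^ 2 := by
    rw [← integral_const_mul]
    refine integral_mono_ae (hχ.integrable_annularWeight_mul hb 2 hg)
      ((hχ.integrable_annularWeight_mul hb 1 hu).const_mul _) (h_sq.mono fun x hx => ?_)
    calc annularWeight n χ a b 2 x * g x ^ 2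
        ≤ 4 / b ^ 2 * annularWeight n χ a b 1 x * (K ^ 2 * u x ^ 2) :=
          mul_le_mul (hχ.annularWeight_two_le hb x) hx (sq_nonneg _)
            (mul_nonneg (by positivity) (annularWeight_nonneg ..))
      _ = 4 / b ^ 2 * K ^ 2 * (annularWeight n χ a b 1 x * u x ^ 2) := by ring
  have hB : 0 ≤ B := zero_le_one.trans hχ.one_le_bound
  have h_sum {c : ℝ} (hc : 0 < c) :
      cutoffConst n B c * ((∫ x in Metric.closedBall 0 (4 / c), u x ^ 2)
        + ∫ x in Metric.closedBall 0 (4 / c), g x ^ 2)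
        ≤ (1 + K ^ 2) * (cutoffConst n B c * ∫ x in Metric.closedBall 0 (4 / c), u x ^ 2) := by
    linarith [mul_le_mul_of_nonneg_left (h_ball (Metric.closedBall 0 (4 / c)))
      (cutoffConst_nonneg (n := n) hB hc.le)]
  have h_nonneg {c : ℝ} (hc : 0 < c) :
      0 ≤ cutoffConst n B c * ∫ x in Metric.closedBall 0 (4 / c), u x ^ 2 :=
    mul_nonneg (cutoffConst_nonneg hB hc.le) (integral_nonneg fun _ => sq_nonneg _)
  refine le_of_absorb (by positivity) hb
    (integral_nonneg fun x => mul_nonneg (annularWeight_nonneg ..) (sq_nonneg _))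
    (add_nonneg (h_nonneg ha) (h_nonneg hb)) hnb hnK ?_
  linarith [hχ.weighted_inequality_of_isWeakSolution hn hb hab h hu hg, h_sum ha, h_sum hb]

theorem IsCutoff.setIntegral_closedBall_le (hχ : IsCutoff χ B) (ha : 0 < a) (hb : 0 < b)
    (hr : r ≤ 1 / b) (hu : MemLp u 2) :
    ∫ x in Metric.closedBall 0 r, u x ^ 2 ≤ (∫ x in Metric.closedBall 0 (4 / a), u x ^ 2)
      + (r ^ 2) ^ n * ∫ x, annularWeight n χ a b 1 x * u x ^ 2 := by
  have h_ball (s : ℝ) :=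
    hu.integrable_sq.indicator (measurableSet_closedBall (x := (0 : E)) (ε := s))
  have h_weight :=
    (hχ.integrable_annularWeight_mul (n := n) (a := a) hb 1 hu).const_mul ((r ^ 2) ^ n)
  rw [← integral_indicator measurableSet_closedBall, ← integral_indicator measurableSet_closedBall,
    ← integral_const_mul, ← integral_add (h_ball _) h_weight]
  refine integral_mono (h_ball _) ((h_ball _).add h_weight) fun x => ?_
  have h_nonneg : 0 ≤ (r ^ 2) ^ n * (annularWeight n χ a b 1 x * u x ^ 2) :=
    mul_nonneg (by positivity) (mul_nonneg (annularWeight_nonneg ..) (sq_nonneg _))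
  have h_indicator (s : Set E) : 0 ≤ s.indicator (fun y => u y ^ 2) x :=
    Set.indicator_nonneg (fun y _ => sq_nonneg _) x
  by_cases hxa : x ∈ Metric.closedBall 0 (4 / a)
  · simp only [Set.indicator_of_mem hxa]
    exact (Set.indicator_le_self' (fun y _ => sq_nonneg (u y)) x).trans
      (le_add_of_nonneg_right h_nonneg)
  by_cases hxr : x ∈ Metric.closedBall 0 r
  · rw [Set.indicator_of_mem hxr]
    refine le_add_of_nonneg_of_le (h_indicator _) ?_
    rw [mem_closedBall_zero_iff] at hxr hxa
    have h_lower := hχ.inv_pow_le_annularWeight_one (n := n) ha hb (x := x)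
      ((by gcongr; norm_num : 2 / a ≤ 4 / a).trans (not_le.1 hxa).le) (hxr.trans hr)
    have hx0 : 0 < ‖x‖ := (by positivity : 0 < 4 / a).trans (not_le.1 hxa)
    rw [← mul_assoc]
    refine le_mul_of_one_le_left (sq_nonneg _) ?_
    calc (1 : ℝ) = (‖x‖ ^ 2) ^ n * ((‖x‖ ^ 2) ^ n)⁻¹ := (mul_inv_cancel₀ (by positivity)).symm
      _ ≤ (r ^ 2) ^ n * annularWeight n χ a b 1 x := by gcongr
  · rw [Set.indicator_of_notMem hxr]
    exact add_nonneg (h_indicator _) h_nonneg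

variable (hχ : IsCutoff χ B) (hn : 3 ≤ n) (hb : 0 < b) (hab : b ≤ a) (hr : r ≤ 1 / b)
  (hnb : 96 * K ^ 2 ≤ n ^ 3 * b ^ 4) (hnK : 1 + K ^ 2 ≤ n ^ 3)

include hχ hn hb hab hr hnb hnK

theorem IsCutoff.setIntegral_closedBall_zero_le_add
    (h : IsWeakSolution (Metric.ball 0 (4 / b + 1)) u g) (hu : MemLp u 2) (hg : MemLp g 2)
    (hgu : ∀ᵐ x, |g x| ≤ K * |u x|) :
    ∫ x in Metric.closedBall 0 r, u x ^ 2
      ≤ (1 + (r ^ 2) ^ n * (8 / b ^ 2) * cutoffConst n B a)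
          * (∫ x in Metric.closedBall 0 (4 / a), u x ^ 2)
        + (r ^ 2) ^ n * (8 / b ^ 2) * cutoffConst n B b
          * ∫ x in Metric.closedBall 0 (4 / b), u x ^ 2 := by
  linarith [hχ.setIntegral_closedBall_le (n := n) (hb.trans_le hab) hb hr hu,
    mul_le_mul_of_nonneg_left (hχ.integral_annularWeight_mul_sq_le hn hb hab hnb hnK h hu hg hgu)
      (by positivity : 0 ≤ (r ^ 2) ^ n)]

theorem IsCutoff.setIntegral_closedBall_le_add {z : E}
    (h : IsWeakSolution (Metric.ball z (4 / b + 1)) u g)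
    (hu : MemLp u 2 (volume.restrict (Metric.ball z (4 / b + 1))))
    (hg : AEStronglyMeasurable g (volume.restrict (Metric.ball z (4 / b + 1))))
    (hgu : ∀ᵐ x ∂volume.restrict (Metric.ball z (4 / b + 1)), |g x| ≤ K * |u x|) :
    ∫ x in Metric.closedBall z r, u x ^ 2
      ≤ (1 + (r ^ 2) ^ n * (8 / b ^ 2) * cutoffConst n B a)
          * (∫ x in Metric.closedBall z (4 / a), u x ^ 2)
        + (r ^ 2) ^ n * (8 / b ^ 2) * cutoffConst n B b
          * ∫ x in Metric.closedBall z (4 / b), u x ^ 2 := by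
  let U := Metric.ball z (4 / b + 1)
  let A := AffineIsometryEquiv.constVAdd ℝ E z
  have hA : MeasurePreserving A volume volume := measurePreserving_affineIsometryEquiv A
  have hA_ball (t : ℝ) : A ⁻¹' Metric.closedBall z t = Metric.closedBall 0 t := by
    ext; simp [A]
  have hAU : A ⁻¹' U = Metric.ball 0 (4 / b + 1) := by ext; simp [A, U]
  have memLp_shift {v : E → ℝ} (hv : MemLp v 2 (volume.restrict U)) :
      MemLp (fun x => U.indicator v (A x)) 2 :=
    ((memLp_indicator_iff_restrict measurableSet_ball).2 hv).comp_measurePreserving hA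
  have integral_shift {t : ℝ} (ht : t ≤ 4 / b) :
      ∫ x in Metric.closedBall 0 t, U.indicator u (A x) ^ 2
        = ∫ x in Metric.closedBall z t, u x ^ 2 := by
    rw [← hA_ball t, hA.setIntegral_preimage_emb A.toHomeomorph.measurableEmbedding
      fun y => U.indicator u y ^ 2]
    refine setIntegral_congr_fun measurableSet_closedBall fun x hx => ?_
    have hxU : x ∈ U := Metric.closedBall_subset_ball (by linarith) hx
    simp only [Set.indicator_of_mem hxU]
  have bound_shift : ∀ᵐ x, |U.indicator g (A x)| ≤ K * |U.indicator u (A x)| := by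
    refine hA.quasiMeasurePreserving.ae (p := fun y => |U.indicator g y| ≤ K * |U.indicator u y|) ?_
    filter_upwards [(ae_restrict_iff' measurableSet_ball).1 hgu] with y hy
    by_cases hyU : y ∈ U
    · simpa only [Set.indicator_of_mem hyU] using hy hyU
    · simp [Set.indicator_of_notMem hyU]
  have h_shift := h.indicator.comp_affineIsometryEquiv A
  rw [hAU] at h_shift
  have h_zero := hχ.setIntegral_closedBall_zero_le_add hn hb hab hr hnb hnK h_shift
    (memLp_shift hu) (memLp_shift (hu.of_le_mul hg hgu)) bound_shift
  rwa [integral_shift (hr.trans (by gcongr; norm_num)), integral_shift (by gcongr),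
    integral_shift le_rfl] at h_zero

end AnnularEstimate

section Parameters

variable {B C C₁ D K δ r t : ℝ} {m n : ℕ}

theorem le_rpow_of_le_pow (hδ : 0 < δ) (hδ1 : δ ≤ 1) (hC₁ : 1 ≤ C₁) (hC : C₁ ≤ C)
    (hm : (m : ℝ) ≤ C + C * t) (hD : D ≤ (C₁ / δ) ^ m) : D ≤ (C / δ) ^ (C + C * t) := by
  have h1 : 1 ≤ C / δ := by rw [le_div_iff₀ hδ]; linarith
  calc D ≤ (C₁ / δ) ^ m := hD
    _ ≤ (C / δ) ^ m := pow_le_pow_left₀ (by positivity) (by gcongr) m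
    _ = (C / δ) ^ (m : ℝ) := (Real.rpow_natCast _ _).symm
    _ ≤ (C / δ) ^ (C + C * t) := Real.rpow_le_rpow_of_exponent_le h1 hm

theorem exp_half_le (n : ℕ) : Real.exp (n / 2) ≤ 2 ^ n := by
  have h_exp : Real.exp (1 / 2) ≤ 2 := by
    rw [← Real.le_log_iff_exp_le two_pos]
    linarith [Real.log_two_gt_d9]
  calc Real.exp (n / 2) = Real.exp (1 / 2) ^ n := by rw [← Real.exp_nat_mul]; ring_nf
    _ ≤ 2 ^ n := pow_le_pow_left₀ (Real.exp_pos _).le h_exp n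

theorem outer_coefficient_le (hr : 1 ≤ r) (hB : 0 ≤ B) (hn : 1 ≤ n) :
    (r ^ 2) ^ n * (8 / (1 / (8 * r)) ^ 2) * cutoffConst n B (1 / (8 * r))
      ≤ 1728 * B ^ 3 * (8 * r) ^ 4 * (1 / 2) ^ n := by
  obtain ⟨k, rfl⟩ := Nat.exists_eq_add_of_le' hn
  have : 0 < r := one_pos.trans_le hr
  have h_max : max 1 (1 / (8 * r)) = 1 := max_eq_left <| by
    rw [div_le_one (by positivity)]; linarith
  calc (r ^ 2) ^ (k + 1) * (8 / (1 / (8 * r)) ^ 2) * cutoffConst (k + 1) B (1 / (8 * r))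
      = 1728 * B ^ 3 * (8 * r) ^ 4 * ((1 / 64) ^ (k + 1) * Real.exp ((k + 1 : ℕ) / 2)) := by
        rw [cutoffConst, h_max, Nat.add_sub_cancel, pow_mul]
        have : (1 / (8 * r)) ^ 2 = 1 / 64 * (r ^ 2)⁻¹ := by field_simp; norm_num
        rw [this, mul_pow, inv_pow]
        field_simp
        ring
    _ ≤ 1728 * B ^ 3 * (8 * r) ^ 4 * ((1 / 64) ^ (k + 1) * 2 ^ (k + 1)) := by
        gcongr
        exact exp_half_le _
    _ ≤ 1728 * B ^ 3 * (8 * r) ^ 4 * (1 / 2) ^ (k + 1) := by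
        rw [← mul_pow]
        gcongr
        norm_num

theorem inner_coefficient_le (hr : 1 ≤ r) (hB : 1 ≤ B) (hδ : 0 < δ) (hδ1 : δ ≤ 1) (hn : 1 ≤ n) :
    1 + (r ^ 2) ^ n * (8 / (1 / (8 * r)) ^ 2) * cutoffConst n B (4 / δ)
      ≤ ((1728 * B ^ 3 * (8 * r) ^ 2 + 1) * (8 * r) / δ) ^ (2 * n + 4) := by
  have h4 : 1 ≤ 4 / δ := by rw [le_div_iff₀ hδ]; linarith
  have h8 : 1 ≤ 8 * r / δ := by rw [le_div_iff₀ hδ]; linarith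
  have h_base : (1 : ℝ) ≤ 1728 * B ^ 3 * (8 * r) ^ 2 + 1 := le_add_of_nonneg_left (by positivity)
  have h_growth : (r ^ 2) ^ n * ((4 / δ) ^ (2 * n + 4) * Real.exp (n / 2))
      ≤ (8 * r / δ) ^ (2 * n + 4) := by
    calc (r ^ 2) ^ n * ((4 / δ) ^ (2 * n + 4) * Real.exp (n / 2))
        ≤ r ^ (2 * n + 4) * ((4 / δ) ^ (2 * n + 4) * 2 ^ (2 * n + 4)) := by
          rw [← pow_mul]
          gcongr
          · omega
          · exact (exp_half_le n).trans (pow_le_pow_right₀ one_le_two (by omega))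
      _ = (8 * r / δ) ^ (2 * n + 4) := by rw [← mul_pow, ← mul_pow]; congr 1; ring
  have h_const : cutoffConst n B (4 / δ)
      = 216 * B ^ 3 * ((4 / δ) ^ (2 * n + 4) * Real.exp (n / 2)) := by
    rw [cutoffConst, max_eq_right h4]
    have : 2 * n + 4 = 6 + 2 * (n - 1) := by omega
    rw [this, pow_add]
    ring
  calc 1 + (r ^ 2) ^ n * (8 / (1 / (8 * r)) ^ 2) * cutoffConst n B (4 / δ)
      = 1 + 1728 * B ^ 3 * (8 * r) ^ 2
          * ((r ^ 2) ^ n * ((4 / δ) ^ (2 * n + 4) * Real.exp (n / 2))) := by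
        rw [h_const]
        field_simp
        ring
    _ ≤ (8 * r / δ) ^ (2 * n + 4)
          + 1728 * B ^ 3 * (8 * r) ^ 2 * (8 * r / δ) ^ (2 * n + 4) := by
        gcongr
        exact one_le_pow₀ h8
    _ = (1728 * B ^ 3 * (8 * r) ^ 2 + 1) * (8 * r / δ) ^ (2 * n + 4) := by ring
    _ ≤ (1728 * B ^ 3 * (8 * r) ^ 2 + 1) ^ (2 * n + 4) * (8 * r / δ) ^ (2 * n + 4) := by
        gcongr
        exact le_self_pow₀ h_base (by omega)
    _ = ((1728 * B ^ 3 * (8 * r) ^ 2 + 1) * (8 * r) / δ) ^ (2 * n + 4) := by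
        rw [← mul_pow, ← mul_div_assoc]

theorem exists_carleman_parameter (hC : 2 ≤ C) (N : ℕ) (hK : 0 ≤ K) :
    ∃ n : ℕ, 3 ≤ n ∧ N ≤ n ∧ (n : ℝ) ≤ N + 4 + C * K ^ (2 / 3 : ℝ) ∧
      C * K ^ 2 ≤ n ^ 3 ∧ 1 + K ^ 2 ≤ n ^ 3 := by
  have h_cube : (K ^ (2 / 3 : ℝ)) ^ 3 = K ^ 2 := by
    rw [← Real.rpow_natCast, ← Real.rpow_mul hK, ← Real.rpow_natCast]; norm_num
  set t := K ^ (2 / 3 : ℝ)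
  have : 0 ≤ t := by positivity
  refine ⟨N + 3 + ⌈C * t⌉₊, by omega, by omega, ?_, ?_⟩
  · push_cast
    linarith [Nat.ceil_lt_add_one (by positivity : 0 ≤ C * t)]
  have h_le : 3 + C * t ≤ (N + 3 + ⌈C * t⌉₊ : ℕ) := by
    push_cast
    linarith [Nat.le_ceil (C * t), (Nat.cast_nonneg N : (0 : ℝ) ≤ N)]
  have h_sum : 27 + C * K ^ 2 ≤ ((N + 3 + ⌈C * t⌉₊ : ℕ) : ℝ) ^ 3 := by
    have hC3 : C ≤ C ^ 3 := le_self_pow₀ (by linarith) three_ne_zero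
    calc 27 + C * K ^ 2 ≤ 3 ^ 3 + C ^ 3 * t ^ 3 := by rw [h_cube]; gcongr; norm_num
      _ = 3 ^ 3 + (C * t) ^ 3 := by rw [mul_pow]
      _ ≤ (3 + C * t) ^ 3 := by
        have : 0 ≤ C * t := by positivity
        nlinarith [pow_nonneg this 2]
      _ ≤ _ := by gcongr
  exact ⟨by linarith, by nlinarith [sq_nonneg K]⟩

end Parameters

section LocalUniqueContinuation

variable (E : Type*) [NormedAddCommGroup E] [InnerProductSpace ℝ E] [FiniteDimensional ℝ E]
  [MeasurableSpace E] [BorelSpace E]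

theorem local_unique_continuation {r ε : ℝ} (hr : 1 ≤ r) (hε : 0 < ε) :
    ∃ C : ℝ, 1 ≤ C ∧ ∀ K δ : ℝ, 0 ≤ K → 0 < δ → δ ≤ 1 →
      ∃ A : ℝ, 0 ≤ A ∧ A ≤ (C / δ) ^ (C + C * K ^ (2 / 3 : ℝ)) ∧
        ∀ (u g : E → ℝ) (z : E), IsWeakSolution (Metric.ball z (32 * r + 1)) u g →
        MemLp u 2 (volume.restrict (Metric.ball z (32 * r + 1))) →
        AEStronglyMeasurable g (volume.restrict (Metric.ball z (32 * r + 1))) →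
        (∀ᵐ x ∂volume.restrict (Metric.ball z (32 * r + 1)), |g x| ≤ K * |u x|) →
        ∫ x in Metric.closedBall z r, u x ^ 2
          ≤ A * (∫ x in Metric.closedBall z δ, u x ^ 2)
            + ε * ∫ x in Metric.closedBall z (32 * r), u x ^ 2 := by
  obtain ⟨χ, B, hχ⟩ := exists_isCutoff E
  have hB := hχ.one_le_bound
  set c : ℝ := 96 * (8 * r) ^ 4
  have hc : 2 ≤ c := by linarith [one_le_pow₀ (by linarith : 1 ≤ 8 * r) (n := 4)]
  set D : ℝ := 1728 * B ^ 3 * (8 * r) ^ 4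
  set C₁ : ℝ := (1728 * B ^ 3 * (8 * r) ^ 2 + 1) * (8 * r)
  have hC₁ : 1 ≤ C₁ :=
    one_le_mul_of_one_le_of_one_le (le_add_of_nonneg_left (by positivity)) (by linarith)
  obtain ⟨N, hN⟩ := exists_pow_lt_of_lt_one (by positivity : 0 < ε / D) one_half_lt_one
  have : (0 : ℝ) ≤ N := N.cast_nonneg
  refine ⟨C₁ + (2 * N + 12) + 2 * c, by linarith, fun K δ hK hδ hδ1 => ?_⟩
  obtain ⟨n, hn3, hNn, hn_le, hKc, hnK⟩ := exists_carleman_parameter hc N hK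
  have h_outer : (r ^ 2) ^ n * (8 / (1 / (8 * r)) ^ 2) * cutoffConst n B (1 / (8 * r)) ≤ ε := by
    refine (outer_coefficient_le hr (zero_le_one.trans hB) (by omega)).trans ?_
    rw [← le_div_iff₀' (by positivity)]
    exact (pow_le_pow_of_le_one (by norm_num) (by norm_num) hNn).trans hN.le
  have h_exponent : ((2 * n + 4 : ℕ) : ℝ)
      ≤ C₁ + (2 * N + 12) + 2 * c + (C₁ + (2 * N + 12) + 2 * c) * K ^ (2 / 3 : ℝ) := by
    have : 0 ≤ (C₁ + (2 * N + 12)) * K ^ (2 / 3 : ℝ) := by positivity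
    push_cast
    linarith
  refine ⟨_, ?_, le_rpow_of_le_pow hδ hδ1 hC₁ (by linarith) h_exponent
    (inner_coefficient_le hr hB hδ hδ1 (by omega : 1 ≤ n)), fun u g z h hu hg hgu => ?_⟩
  · have := cutoffConst_nonneg (n := n) (zero_le_one.trans hB) (by positivity : 0 ≤ 4 / δ)
    positivity
  have h_radius : 4 / (1 / (8 * r)) = 32 * r := by field_simp; norm_num
  have hba : 1 / (8 * r) ≤ 4 / δ := by
    rw [div_le_div_iff₀ (by positivity) hδ]
    linarith
  have hKb : 96 * K ^ 2 ≤ n ^ 3 * (1 / (8 * r)) ^ 4 := by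
    rw [one_div, inv_pow, ← div_eq_mul_inv, le_div_iff₀ (by positivity)]
    linarith
  have h_main := hχ.setIntegral_closedBall_le_add (r := r) hn3 (by positivity) hba
    (by rw [one_div_one_div]; linarith) hKb hnK (h_radius ▸ h) (h_radius ▸ hu) (h_radius ▸ hg)
    (h_radius ▸ hgu)
  rw [h_radius, div_div_cancel₀ four_ne_zero] at h_main
  exact h_main.trans (by gcongr)

end LocalUniqueContinuation

/-! ### Extension by translation and odd reflection -/

section Box

variable {d : ℕ} {L : ℝ} {x y : EuclideanSpace ℝ (Fin d)}

theorem mem_box : y ∈ box L x ↔ ∀ i, |y i - x i| ≤ L / 2 :=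
  forall_congr' fun i => by
    rw [Set.mem_Icc, abs_le]
    constructor <;> rintro ⟨h, h'⟩ <;> constructor <;> linarith

theorem box_eq_preimage_pi (L : ℝ) (x : EuclideanSpace ℝ (Fin d)) :
    box L x = (EuclideanSpace.equiv (Fin d) ℝ).toHomeomorph ⁻¹'
      Set.univ.pi fun i => Set.Icc (x i - L / 2) (x i + L / 2) := by
  ext y
  simp only [box, Set.mem_preimage, Set.mem_univ_pi]
  rfl

theorem isCompact_box : IsCompact (box L x) := by
  rw [box_eq_preimage_pi, Homeomorph.isCompact_preimage]
  exact isCompact_univ_pi fun _ => isCompact_Icc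

theorem convex_box : Convex ℝ (box L x) := by
  rw [box_eq_preimage_pi]
  exact (convex_pi fun _ _ => convex_Icc _ _).linear_preimage
    (EuclideanSpace.equiv (Fin d) ℝ).toLinearMap

theorem mem_interior_box : y ∈ interior (box L x) ↔ ∀ i, |y i - x i| < L / 2 := by
  rw [box_eq_preimage_pi, ← Homeomorph.preimage_interior, interior_pi_set Set.finite_univ]
  simp only [interior_Icc, Set.mem_preimage, Set.mem_univ_pi, Set.mem_Ioo]
  refine forall_congr' fun i => ?_
  rw [abs_lt]
  constructor <;> rintro ⟨h, h'⟩ <;> constructor <;> linarith!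

theorem interior_box_ae_eq (L : ℝ) (x : EuclideanSpace ℝ (Fin d)) :
    interior (box L x) =ᵐ[volume] box L x :=
  interior_ae_eq_of_null_frontier (convex_box.addHaar_frontier volume)

theorem restrict_interior_box (d : ℕ) (L : ℝ) :
    volume.restrict (interior (box L 0)) = boxMeasure d L :=
  Measure.restrict_congr_set (interior_box_ae_eq L 0)

theorem ae_mem_interior_box (d : ℕ) (L : ℝ) :
    ∀ᵐ x ∂boxMeasure d L, x ∈ interior (box L 0) := by
  rw [← restrict_interior_box]
  exact ae_restrict_mem isOpen_interior.measurableSet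

end Box

section LatticeCube

variable {d : ℕ}

/-- The lattice points at distance at most `M` from `a` in the maximum norm. -/
noncomputable def latticeCube (a : Fin d → ℤ) (M : ℕ) : Finset (Fin d → ℤ) :=
  Finset.Icc (fun i => a i - M) fun i => a i + M

theorem mem_latticeCube {a k : Fin d → ℤ} {M : ℕ} :
    k ∈ latticeCube a M ↔ ∀ i, |k i - a i| ≤ M := by
  simp only [latticeCube, Finset.mem_Icc, Pi.le_def, ← forall_and, abs_le]
  exact forall_congr' fun i => by lia

theorem card_latticeCube (a : Fin d → ℤ) (M : ℕ) : (latticeCube a M).card = (2 * M + 1) ^ d := by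
  have h_card (i : Fin d) : (a i + M + 1 - (a i - M)).toNat = 2 * M + 1 := by lia
  simp [latticeCube, Pi.card_Icc, h_card]

end LatticeCube

section TileMotion

variable {d : ℕ} {c : ℤˣ} {L : ℝ} {m : Fin d → ℤ} {x : EuclideanSpace ℝ (Fin d)}

/-- The sign `c ^ k` as a real number. -/
def signPow (c : ℤˣ) (k : ℤ) : ℝ := ((c ^ k : ℤˣ) : ℤ)

theorem signPow_eq_one_or (c : ℤˣ) (k : ℤ) : signPow c k = 1 ∨ signPow c k = -1 := by
  rcases Int.units_eq_one_or (c ^ k) with h | h <;> simp [signPow, h]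

theorem abs_signPow (c : ℤˣ) (k : ℤ) : |signPow c k| = 1 := by
  rcases signPow_eq_one_or c k with h | h <;> simp [h]

@[simp] theorem signPow_one (k : ℤ) : signPow 1 k = 1 := by simp [signPow]

/-- The sign with which a function on the box is copied to the tile with index `m`. -/
def tileSign (c : ℤˣ) (m : Fin d → ℤ) : ℝ := ∏ i, signPow c (m i)

@[simp] theorem tileSign_one (m : Fin d → ℤ) : tileSign 1 m = 1 := by simp [tileSign]

theorem abs_tileSign (c : ℤˣ) (m : Fin d → ℤ) : |tileSign c m| = 1 := by
  simp [tileSign, Finset.abs_prod, abs_signPow]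

theorem tileSign_mul_self (c : ℤˣ) (m : Fin d → ℤ) : tileSign c m * tileSign c m = 1 := by
  rw [← abs_mul_abs_self, abs_tileSign, mul_one]

/-- The diagonal isometry of `ℝ^d` with the signs `c ^ m i`. -/
noncomputable def signIso (c : ℤˣ) (m : Fin d → ℤ) :
    EuclideanSpace ℝ (Fin d) ≃ₗᵢ[ℝ] EuclideanSpace ℝ (Fin d) :=
  LinearIsometryEquiv.piLpCongrRight 2 fun i =>
    if signPow c (m i) = 1 then LinearIsometryEquiv.refl ℝ ℝ else LinearIsometryEquiv.neg ℝ

theorem signIso_apply (i : Fin d) : signIso c m x i = signPow c (m i) * x i := by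
  have h_ne : (-1 : ℝ) ≠ 1 := by norm_num
  rcases signPow_eq_one_or c (m i) with h | h <;> simp [signIso, h, h_ne]

/-- The isometry carrying the box of side `L` around the origin to the tile with index `m`: for
`c = 1` a translation, for `c = -1` composed with a reflection in every coordinate direction in
which `m` is odd. -/
noncomputable def tileMotion (c : ℤˣ) (L : ℝ) (m : Fin d → ℤ) :
    EuclideanSpace ℝ (Fin d) ≃ᵃⁱ[ℝ] EuclideanSpace ℝ (Fin d) :=
  (signIso c m).toAffineIsometryEquiv.trans
    (AffineIsometryEquiv.constVAdd ℝ _ (L • latticePoint m))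

theorem tileMotion_apply (i : Fin d) :
    tileMotion c L m x i = signPow c (m i) * x i + m i * L := by
  simp [tileMotion, signIso_apply, latticePoint, mul_comm, add_comm]

theorem tileMotion_one : tileMotion 1 L m x = x + L • latticePoint m := by
  ext i
  simp [tileMotion_apply, latticePoint, mul_comm]

@[simp] theorem tileMotion_zero : tileMotion c L 0 x = x := by
  ext i
  simp [tileMotion_apply, signPow]

theorem measurableEmbedding_tileMotion (c : ℤˣ) (L : ℝ) (m : Fin d → ℤ) :
    MeasurableEmbedding (tileMotion c L m) :=
  (tileMotion c L m).toHomeomorph.measurableEmbedding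

end TileMotion

section Tile

variable {d : ℕ} {c : ℤˣ} {L : ℝ} {m : Fin d → ℤ} {x : EuclideanSpace ℝ (Fin d)}

/-- The index of the tile of side `L` that contains `y`. -/
noncomputable def tileIndex (L : ℝ) (y : EuclideanSpace ℝ (Fin d)) : Fin d → ℤ :=
  fun i => ⌊y i / L + 1 / 2⌋

theorem measurable_tileIndex (L : ℝ) :
    Measurable (tileIndex L : EuclideanSpace ℝ (Fin d) → Fin d → ℤ) :=
  measurable_pi_lambda _ fun i => Int.measurable_floor.comp <|
    ((PiLp.continuous_apply 2 (fun _ => ℝ) i).measurable.div_const L).add_const _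

/-- The tile with index `m`; up to a null set it is the translate of the box of side `L` by
`L • m`. -/
def tile (L : ℝ) (m : Fin d → ℤ) : Set (EuclideanSpace ℝ (Fin d)) := tileIndex L ⁻¹' {m}

theorem measurableSet_tile (L : ℝ) (m : Fin d → ℤ) : MeasurableSet (tile L m) :=
  measurable_tileIndex L (measurableSet_singleton m)

theorem iUnion_tile (d : ℕ) (L : ℝ) : ⋃ m : Fin d → ℤ, tile L m = Set.univ :=
  Set.iUnion_eq_univ_iff.2 fun y => ⟨tileIndex L y, rfl⟩

theorem pairwise_disjoint_tile (d : ℕ) (L : ℝ) :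
    Pairwise (Function.onFun Disjoint fun m : Fin d → ℤ => tile L m) := fun _ _ h =>
  (Set.disjoint_singleton.2 h).preimage _

theorem mem_tile (hL : 0 < L) {y : EuclideanSpace ℝ (Fin d)} :
    y ∈ tile L m ↔ ∀ i, -(L / 2) ≤ y i - m i * L ∧ y i - m i * L < L / 2 := by
  simp only [tile, Set.mem_preimage, Set.mem_singleton_iff, funext_iff, tileIndex,
    Int.floor_eq_iff]
  refine forall_congr' fun i => ?_
  rw [← sub_le_iff_le_add, ← lt_sub_iff_add_lt, le_div_iff₀ hL, div_lt_iff₀ hL]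
  constructor <;> rintro ⟨h, h'⟩ <;> constructor <;> linarith

theorem tileMotion_mem_tile (hL : 0 < L) (hx : x ∈ interior (box L 0)) :
    tileMotion c L m x ∈ tile L m := by
  refine (mem_tile hL).2 fun i => ?_
  have h_abs : |signPow c (m i) * x i| < L / 2 := by
    simpa [abs_mul, abs_signPow] using mem_interior_box.1 hx i
  rw [tileMotion_apply, add_sub_cancel_right]
  exact ⟨(abs_lt.1 h_abs).1.le, (abs_lt.1 h_abs).2⟩

theorem mem_box_of_tileMotion_mem_tile (hL : 0 < L) (hx : tileMotion c L m x ∈ tile L m) :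
    x ∈ box L 0 := by
  refine mem_box.2 fun i => ?_
  have h_mem := (mem_tile hL).1 hx i
  rw [tileMotion_apply, add_sub_cancel_right] at h_mem
  simpa [abs_mul, abs_signPow] using abs_le.2 ⟨h_mem.1, h_mem.2.le⟩

theorem measurePreserving_tileMotion (hL : 0 < L) (c : ℤˣ) (m : Fin d → ℤ) :
    MeasurePreserving (tileMotion c L m) (boxMeasure d L) (volume.restrict (tile L m)) := by
  have h_sub : tileMotion c L m ⁻¹' tile L m ⊆ box L 0 := fun _ =>
    mem_box_of_tileMotion_mem_tile hL
  have h_sup : interior (box L 0) ⊆ tileMotion c L m ⁻¹' tile L m := fun _ =>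
    tileMotion_mem_tile hL
  have h_ae : tileMotion c L m ⁻¹' tile L m =ᵐ[volume] box L 0 :=
    h_sub.eventuallyLE.antisymm
      ((interior_box_ae_eq L 0).symm.le.trans h_sup.eventuallyLE)
  have h := (measurePreserving_affineIsometryEquiv (tileMotion c L m)).restrict_preimage_emb
    (measurableEmbedding_tileMotion c L m) (tile L m)
  rwa [Measure.restrict_congr_set h_ae] at h

theorem ae_tileMotion_mem_tile (hL : 0 < L) (c : ℤˣ) (m : Fin d → ℤ) :
    ∀ᵐ x ∂boxMeasure d L, tileMotion c L m x ∈ tile L m :=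
  (ae_mem_interior_box d L).mono fun _ => tileMotion_mem_tile hL

theorem ae_of_forall_tileMotion (hL : 0 < L) (c : ℤˣ) {p : EuclideanSpace ℝ (Fin d) → Prop}
    (h : ∀ m, ∀ᵐ x ∂boxMeasure d L, p (tileMotion c L m x)) : ∀ᵐ y, p y := by
  rw [← Measure.restrict_univ (μ := volume), ← iUnion_tile d L, ae_restrict_iUnion_iff]
  intro m
  rw [← (measurePreserving_tileMotion hL c m).map_eq,
    (measurableEmbedding_tileMotion c L m).ae_map_iff]
  exact h m

theorem tileIndex_mem_latticeCube (hL : 0 < L) {M : ℕ} {y : EuclideanSpace ℝ (Fin d)}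
    (hy : ∀ i, |y i| ≤ M * L) : tileIndex L y ∈ latticeCube 0 M := by
  refine mem_latticeCube.2 fun i => ?_
  have h_div : |y i / L| ≤ M := by
    rw [abs_div, abs_of_pos hL]
    exact (div_le_iff₀ hL).2 (hy i)
  rw [Pi.zero_apply, sub_zero, abs_le, tileIndex, Int.le_floor, ← Int.lt_add_one_iff,
    Int.floor_lt]
  push_cast
  constructor <;> linarith [(abs_le.1 h_div).1, (abs_le.1 h_div).2]

end Tile

section Extend

variable {d : ℕ} {c : ℤˣ} {L : ℝ} {m : Fin d → ℤ} {x : EuclideanSpace ℝ (Fin d)}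
  {ψ : EuclideanSpace ℝ (Fin d) → ℝ}

/-- The extension of a function on the box to the whole space, by translations (`c = 1`) or by odd
reflections (`c = -1`). -/
noncomputable def extend (c : ℤˣ) (L : ℝ) (ψ : EuclideanSpace ℝ (Fin d) → ℝ)
    (y : EuclideanSpace ℝ (Fin d)) : ℝ :=
  tileSign c (tileIndex L y) * ψ ((tileMotion c L (tileIndex L y)).symm y)

theorem extend_tileMotion (hx : tileMotion c L m x ∈ tile L m) :
    extend c L ψ (tileMotion c L m x) = tileSign c m * ψ x := by
  have h_index : tileIndex L (tileMotion c L m x) = m := hx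
  rw [extend, h_index, AffineIsometryEquiv.symm_apply_apply]

theorem extend_of_mem_interior_box (hL : 0 < L) (hx : x ∈ interior (box L 0)) :
    extend c L ψ x = ψ x := by
  simpa [tileSign, signPow] using
    extend_tileMotion (c := c) (ψ := ψ) (tileMotion_mem_tile (m := 0) hL hx)

theorem ae_extend_tileMotion (hL : 0 < L) (c : ℤˣ) (m : Fin d → ℤ)
    (ψ : EuclideanSpace ℝ (Fin d) → ℝ) :
    ∀ᵐ x ∂boxMeasure d L, extend c L ψ (tileMotion c L m x) = tileSign c m * ψ x :=
  (ae_tileMotion_mem_tile hL c m).mono fun _ => extend_tileMotion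

theorem ae_abs_extend_le (hL : 0 < L) {g : EuclideanSpace ℝ (Fin d) → ℝ} {K : ℝ}
    (h : ∀ᵐ x ∂boxMeasure d L, |g x| ≤ K * |ψ x|) :
    ∀ᵐ y, |extend c L g y| ≤ K * |extend c L ψ y| := by
  refine ae_of_forall_tileMotion hL c fun m => ?_
  filter_upwards [h, ae_extend_tileMotion hL c m g, ae_extend_tileMotion hL c m ψ]
    with x hx hg hψ
  rwa [hg, hψ, abs_mul, abs_mul, abs_tileSign, one_mul, one_mul]

theorem aestronglyMeasurable_extend (hL : 0 < L) (c : ℤˣ)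
    (hψ : AEStronglyMeasurable ψ (boxMeasure d L)) : AEStronglyMeasurable (extend c L ψ) := by
  rw [← Measure.restrict_univ (μ := volume), ← iUnion_tile d L, aestronglyMeasurable_iUnion_iff]
  intro m
  rw [← (measurePreserving_tileMotion hL c m).aestronglyMeasurable_comp_iff
    (measurableEmbedding_tileMotion c L m)]
  exact (hψ.const_mul (tileSign c m)).congr
    ((ae_extend_tileMotion hL c m ψ).mono fun _ => Eq.symm)

theorem ae_extend_tileMotion_sq (hL : 0 < L) (c : ℤˣ) (m : Fin d → ℤ)
    (ψ : EuclideanSpace ℝ (Fin d) → ℝ) :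
    ∀ᵐ x ∂boxMeasure d L, extend c L ψ (tileMotion c L m x) ^ 2 = ψ x ^ 2 := by
  filter_upwards [ae_extend_tileMotion hL c m ψ] with x hx
  rw [hx, mul_pow, sq (tileSign c m), tileSign_mul_self, one_mul]

theorem integrableOn_tile_extend_sq (hL : 0 < L) (c : ℤˣ) (hψ : MemLp ψ 2 (boxMeasure d L))
    (m : Fin d → ℤ) : IntegrableOn (fun y => extend c L ψ y ^ 2) (tile L m) := by
  rw [IntegrableOn, ← (measurePreserving_tileMotion hL c m).integrable_comp_emb
    (measurableEmbedding_tileMotion c L m)]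
  exact hψ.integrable_sq.congr ((ae_extend_tileMotion_sq hL c m ψ).mono fun _ => Eq.symm)

theorem setIntegral_tile_extend_sq (hL : 0 < L) (c : ℤˣ) (m : Fin d → ℤ)
    (ψ : EuclideanSpace ℝ (Fin d) → ℝ) :
    ∫ y in tile L m, extend c L ψ y ^ 2 = ∫ x, ψ x ^ 2 ∂boxMeasure d L := by
  rw [← (measurePreserving_tileMotion hL c m).integral_comp
    (measurableEmbedding_tileMotion c L m)]
  exact integral_congr_ae (ae_extend_tileMotion_sq hL c m ψ)

theorem memLp_biUnion_tile_extend (hL : 0 < L) (c : ℤˣ) (hψ : MemLp ψ 2 (boxMeasure d L))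
    (S : Finset (Fin d → ℤ)) :
    MemLp (extend c L ψ) 2 (volume.restrict (⋃ m ∈ S, tile L m)) :=
  (memLp_two_iff_integrable_sq (aestronglyMeasurable_extend hL c hψ.1).restrict).2 <|
    integrableOn_finset_iUnion.2 fun m _ => integrableOn_tile_extend_sq hL c hψ m

theorem setIntegral_biUnion_tile_extend_sq (hL : 0 < L) (c : ℤˣ)
    (hψ : MemLp ψ 2 (boxMeasure d L)) (S : Finset (Fin d → ℤ)) :
    ∫ y in ⋃ m ∈ S, tile L m, extend c L ψ y ^ 2
      = S.card * ∫ x, ψ x ^ 2 ∂boxMeasure d L := by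
  rw [integral_biUnion_finset _ (fun m _ => measurableSet_tile L m)
    ((pairwise_disjoint_tile d L).set_pairwise _)
    fun m _ => integrableOn_tile_extend_sq hL c hψ m]
  simp only [setIntegral_tile_extend_sq hL, Finset.sum_const, nsmul_eq_mul]

theorem mem_biUnion_tile (hL : 0 < L) {M : ℕ} {y : EuclideanSpace ℝ (Fin d)}
    (hy : ∀ i, |y i| ≤ M * L) : y ∈ ⋃ m ∈ latticeCube (0 : Fin d → ℤ) M, tile L m :=
  Set.mem_iUnion₂.2 ⟨tileIndex L y, tileIndex_mem_latticeCube hL hy, rfl⟩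

theorem memLp_restrict_extend (hL : 0 < L) (c : ℤˣ) (hψ : MemLp ψ 2 (boxMeasure d L))
    {s : Set (EuclideanSpace ℝ (Fin d))} (hs : Bornology.IsBounded s) :
    MemLp (extend c L ψ) 2 (volume.restrict s) := by
  obtain ⟨r, hr⟩ := hs.subset_closedBall 0
  obtain ⟨M, hM⟩ := exists_nat_ge (r / L)
  have h_subset : s ⊆ ⋃ m ∈ latticeCube (0 : Fin d → ℤ) M, tile L m := fun y hy =>
    mem_biUnion_tile hL fun i => (PiLp.norm_apply_le y i).trans <|
      (mem_closedBall_zero_iff.1 (hr hy)).trans ((div_le_iff₀ hL).1 hM)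
  exact (memLp_biUnion_tile_extend hL c hψ _).mono_measure
    (Measure.restrict_mono h_subset le_rfl)

theorem locallyIntegrable_extend (hL : 0 < L) (c : ℤˣ) (hψ : MemLp ψ 2 (boxMeasure d L)) :
    LocallyIntegrable (extend c L ψ) := by
  refine MeasureTheory.locallyIntegrable_iff.2 fun s hs => ?_
  have h_finite : IsFiniteMeasure (volume.restrict s) := ⟨by simpa using hs.measure_lt_top⟩
  exact (memLp_restrict_extend hL c hψ hs.isBounded).integrable one_le_two

end Extend

/-! ### Unfolding test functions -/

section FoldSum

variable {d : ℕ} {L : ℝ} {x : EuclideanSpace ℝ (Fin d)}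
  {f : EuclideanSpace ℝ (Fin d) → ℝ}

theorem exists_finset_eventually_tileMotion_notMem (hL : 0 < L)
    {K : Set (EuclideanSpace ℝ (Fin d))} (hK : IsCompact K) (c : ℤˣ)
    (x : EuclideanSpace ℝ (Fin d)) :
    ∃ S : Finset (Fin d → ℤ), ∀ᶠ y in 𝓝 x, ∀ m ∉ S, tileMotion c L m y ∉ K := by
  obtain ⟨ρ, hρ⟩ := hK.isBounded.subset_closedBall 0
  obtain ⟨M, hM⟩ := exists_nat_ge ((ρ + (‖x‖ + 1)) / L)
  refine ⟨latticeCube 0 M, ?_⟩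
  filter_upwards [continuous_norm.continuousAt.eventually (gt_mem_nhds (lt_add_one ‖x‖))]
    with y hy m hm h_mem
  refine hm (mem_latticeCube.2 fun i => ?_)
  have h_image : |tileMotion c L m y i| ≤ ρ :=
    (PiLp.norm_apply_le _ i).trans (mem_closedBall_zero_iff.1 (hρ h_mem))
  have h_point : |signPow c (m i) * y i| ≤ ‖x‖ + 1 := by
    rw [abs_mul, abs_signPow, one_mul]
    exact (PiLp.norm_apply_le y i).trans hy.le
  have h_shift : |(m i : ℝ)| * L ≤ ρ + (‖x‖ + 1) := by
    nth_rw 1 [← abs_of_pos hL]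
    rw [← abs_mul]
    rw [eq_sub_of_add_eq' (tileMotion_apply i).symm]
    exact (abs_sub _ _).trans (add_le_add h_image h_point)
  simpa [← Int.cast_le (R := ℝ)] using ((le_div_iff₀ hL).2 h_shift).trans hM

/-- The signed sum of a function over the orbit of a point under the motions of the tiling; it is
dual to `extend`. -/
noncomputable def foldSum (c : ℤˣ) (L : ℝ) (f : EuclideanSpace ℝ (Fin d) → ℝ)
    (x : EuclideanSpace ℝ (Fin d)) : ℝ :=
  ∑' m : Fin d → ℤ, tileSign c m * f (tileMotion c L m x)

theorem exists_finset_foldSum_eventuallyEq (hL : 0 < L) (hc : HasCompactSupport f) (c : ℤˣ)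
    (x : EuclideanSpace ℝ (Fin d)) :
    ∃ S : Finset (Fin d → ℤ), ∀ g : EuclideanSpace ℝ (Fin d) → ℝ, tsupport g ⊆ tsupport f →
      foldSum c L g =ᶠ[𝓝 x] fun y => ∑ m ∈ S, tileSign c m * g (tileMotion c L m y) := by
  obtain ⟨S, hS⟩ := exists_finset_eventually_tileMotion_notMem hL hc.isCompact c x
  refine ⟨S, fun g hg => hS.mono fun y hy => tsum_eq_sum fun m hm => ?_⟩
  rw [image_eq_zero_of_notMem_tsupport fun h => hy m hm (hg h), mul_zero]

theorem contDiff_foldSum {n : WithTop ℕ∞} (hL : 0 < L) (hf : ContDiff ℝ n f)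
    (hc : HasCompactSupport f) (c : ℤˣ) : ContDiff ℝ n (foldSum c L f) := by
  refine contDiff_iff_contDiffAt.2 fun x => ?_
  obtain ⟨S, hS⟩ := exists_finset_foldSum_eventuallyEq hL hc c x
  refine ContDiffAt.congr_of_eventuallyEq ?_ (hS f subset_rfl)
  exact (ContDiff.sum fun m _ =>
    contDiff_const.mul (hf.comp (contDiff_affineIsometryEquiv _))).contDiffAt

theorem laplacian_foldSum (hL : 0 < L) (hf : ContDiff ℝ 2 f) (hc : HasCompactSupport f)
    (c : ℤˣ) : Δ (foldSum c L f) = foldSum c L (Δ f) := by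
  ext x
  obtain ⟨S, hS⟩ := exists_finset_foldSum_eventuallyEq hL hc c x
  have h_smooth (m : Fin d → ℤ) : ContDiff ℝ 2 fun y => f (tileMotion c L m y) :=
    hf.comp (contDiff_affineIsometryEquiv _)
  rw [(InnerProductSpace.laplacian_congr_nhds (hS f subset_rfl)).eq_of_nhds,
    (hS _ tsupport_laplacian_subset).eq_of_nhds,
    laplacian_finsetSum fun m _ => contDiff_const.mul (h_smooth m)]
  refine Finset.sum_congr rfl fun m _ => ?_
  rw [← laplacian_comp_affineIsometryEquiv _ hf]
  exact InnerProductSpace.laplacian_smul (tileSign c m) (h_smooth m).contDiffAt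

theorem fderiv_foldSum_one (hL : 0 < L) (hf : ContDiff ℝ 1 f) (hc : HasCompactSupport f)
    (v : EuclideanSpace ℝ (Fin d)) :
    fderiv ℝ (foldSum 1 L f) x v = foldSum 1 L (fun y => fderiv ℝ f y v) x := by
  obtain ⟨S, hS⟩ := exists_finset_foldSum_eventuallyEq hL hc 1 x
  have h_diff (m : Fin d → ℤ) : DifferentiableAt ℝ (fun y => f (tileMotion 1 L m y)) x :=
    (hf.comp (contDiff_affineIsometryEquiv _)).differentiable one_ne_zero x
  rw [(hS f subset_rfl).fderiv_eq, (hS _ (tsupport_fderiv_apply_subset ℝ v)).eq_of_nhds,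
    fderiv_fun_sum fun m _ => (h_diff m).const_mul _, sum_apply]
  refine Finset.sum_congr rfl fun m _ => ?_
  rw [fderiv_const_mul (h_diff m), smul_apply, smul_eq_mul]
  simp only [tileMotion_one, fderiv_comp_add_right]

end FoldSum

section Equivariance

variable {d : ℕ} {L : ℝ} {x : EuclideanSpace ℝ (Fin d)}
  {f : EuclideanSpace ℝ (Fin d) → ℝ}

theorem zpow_zpow_mul (c : ℤˣ) (m k : ℤ) : c ^ (((c ^ m : ℤˣ) : ℤ) * k) = c ^ k := by
  rcases Int.units_eq_one_or (c ^ m) with h | h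
  · simp [h]
  · simp [h, zpow_neg, Int.units_inv_eq_self]

/-- The action on tile indices, in one coordinate, of the composition with the motion of
index `k`. -/
def indexShift (c : ℤˣ) (k : ℤ) : ℤ ≃ ℤ where
  toFun m := m + ((c ^ m : ℤˣ) : ℤ) * k
  invFun m := m - ((c ^ (m - k) : ℤˣ) : ℤ) * k
  left_inv m := by
    simp only [zpow_sub, zpow_add, zpow_zpow_mul, mul_inv_cancel_right, add_sub_cancel_right]
  right_inv m := by
    dsimp only
    rw [zpow_sub c m (_ * k), zpow_zpow_mul, ← zpow_sub, sub_add_cancel]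

theorem signPow_indexShift (c : ℤˣ) (k m : ℤ) :
    signPow c (indexShift c k m) = signPow c k * signPow c m := by
  rw [signPow, indexShift, Equiv.coe_fn_mk, zpow_add, zpow_zpow_mul, mul_comm]
  push_cast
  rfl

theorem tileMotion_tileMotion (c : ℤˣ) (L : ℝ) (m n : Fin d → ℤ)
    (x : EuclideanSpace ℝ (Fin d)) :
    tileMotion c L m (tileMotion c L n x)
      = tileMotion c L (fun i => indexShift c (n i) (m i)) x := by
  ext i
  simp only [tileMotion_apply, signPow_indexShift]
  simp only [indexShift, Equiv.coe_fn_mk, signPow]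
  push_cast
  ring

theorem tileSign_indexShift (c : ℤˣ) (m n : Fin d → ℤ) :
    tileSign c (fun i => indexShift c (n i) (m i)) = tileSign c n * tileSign c m := by
  simp only [tileSign, signPow_indexShift, Finset.prod_mul_distrib]

theorem foldSum_tileMotion (c : ℤˣ) (L : ℝ) (f : EuclideanSpace ℝ (Fin d) → ℝ) (n : Fin d → ℤ)
    (x : EuclideanSpace ℝ (Fin d)) :
    foldSum c L f (tileMotion c L n x) = tileSign c n * foldSum c L f x := by
  let shift : (Fin d → ℤ) ≃ (Fin d → ℤ) := Equiv.piCongrRight fun i => indexShift c (n i)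
  rw [foldSum, foldSum, ← shift.tsum_eq fun m => tileSign c m * f (tileMotion c L m x),
    ← tsum_mul_left]
  refine tsum_congr fun m => ?_
  have h_sign : tileSign c (shift m) = tileSign c n * tileSign c m := tileSign_indexShift c m n
  rw [tileMotion_tileMotion, h_sign, ← mul_assoc, ← mul_assoc, tileSign_mul_self, one_mul]
  rfl

theorem foldSum_one_mem_periodicCore (hL : 0 < L) (hf : ContDiff ℝ ∞ f)
    (hc : HasCompactSupport f) : foldSum 1 L f ∈ periodicCore d L :=
  ⟨contDiff_foldSum hL hf hc 1, fun k x => by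
    rw [← tileMotion_one, foldSum_tileMotion, tileSign_one, one_mul]⟩

/-- A face of the box is fixed by the reflection onto the tile behind it, which has sign `-1`. -/
theorem foldSum_neg_one_eq_zero (f : EuclideanSpace ℝ (Fin d) → ℝ) (hx : x ∈ box L 0)
    (hx' : x ∉ interior (box L 0)) : foldSum (-1) L f x = 0 := by
  obtain ⟨i, k, hk, hik⟩ : ∃ i, ∃ k : ℤ, (k = 1 ∨ k = -1) ∧ x i = k * (L / 2) := by
    simp only [mem_interior_box, not_forall, not_lt] at hx'
    obtain ⟨i, hi⟩ := hx'
    have h_abs : |x i| = L / 2 := le_antisymm (by simpa using mem_box.1 hx i) (by simpa using hi)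
    rcases eq_or_eq_neg_of_abs_eq h_abs with h | h
    · exact ⟨i, 1, .inl rfl, by simp [h]⟩
    · exact ⟨i, -1, .inr rfl, by simp [h]⟩
  have h_sign : signPow (-1) k = -1 := by rcases hk with rfl | rfl <;> simp [signPow]
  have h_sign_zero : signPow (-1) 0 = 1 := by simp [signPow]
  have h_fixed : tileMotion (-1) L (Pi.single i k) x = x := by
    ext j
    rw [tileMotion_apply]
    by_cases hj : j = i
    · subst hj
      rw [Pi.single_eq_same, h_sign, hik]
      ring
    · simp [Pi.single_eq_of_ne hj, h_sign_zero]
  have h_tileSign : tileSign (-1) (Pi.single i k) = -1 := by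
    rw [tileSign, Finset.prod_eq_single i (fun j _ hj => by rw [Pi.single_eq_of_ne hj, h_sign_zero])
      (by simp), Pi.single_eq_same, h_sign]
  have h_odd := foldSum_tileMotion (-1) L f (Pi.single i k) x
  rw [h_fixed, h_tileSign] at h_odd
  linarith

end Equivariance

section Unfolding

variable {d : ℕ} {L : ℝ} {w w₀ f h : EuclideanSpace ℝ (Fin d) → ℝ}

theorem integral_eq_integral_tsum_tileMotion (hL : 0 < L) (c : ℤˣ) (hh : Integrable h) :
    ∫ y, h y = ∫ x, ∑' m, h (tileMotion c L m x) ∂boxMeasure d L := by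
  have h_tile (u : EuclideanSpace ℝ (Fin d) → ℝ) (m : Fin d → ℤ) :
      ∫ x, u (tileMotion c L m x) ∂boxMeasure d L = ∫ y in tile L m, u y :=
    (measurePreserving_tileMotion hL c m).integral_comp (measurableEmbedding_tileMotion c L m) u
  have h_hasSum {u : EuclideanSpace ℝ (Fin d) → ℝ} (hu : Integrable u) :
      HasSum (fun m => ∫ x, u (tileMotion c L m x) ∂boxMeasure d L) (∫ y, u y) := by
    have h := hasSum_integral_iUnion (measurableSet_tile L) (pairwise_disjoint_tile d L)
      hu.integrableOn
    simpa only [h_tile, iUnion_tile, Measure.restrict_univ] using h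
  rw [← (h_hasSum hh).tsum_eq]
  exact integral_tsum_of_summable_integral_norm
    (fun m => (measurePreserving_tileMotion hL c m).integrable_comp_of_integrable hh.integrableOn)
    (h_hasSum hh.norm).summable

theorem integral_mul_eq_integral_mul_foldSum (hL : 0 < L) {c : ℤˣ}
    (hw : ∀ m, ∀ᵐ x ∂boxMeasure d L, w (tileMotion c L m x) = tileSign c m * w₀ x)
    (hwf : Integrable fun y => w y * f y) :
    ∫ y, w y * f y = ∫ x, w₀ x * foldSum c L f x ∂boxMeasure d L := by
  rw [integral_eq_integral_tsum_tileMotion hL c hwf]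
  refine integral_congr_ae ?_
  filter_upwards [ae_all_iff.2 hw] with x hx
  rw [foldSum, ← tsum_mul_left]
  exact tsum_congr fun m => by rw [hx m]; ring

theorem integral_extend_mul (hL : 0 < L) (c : ℤˣ) (hψ : MemLp w 2 (boxMeasure d L))
    (hf : Continuous f) (hc : HasCompactSupport f) :
    ∫ y, extend c L w y * f y = ∫ x, w x * foldSum c L f x ∂boxMeasure d L :=
  integral_mul_eq_integral_mul_foldSum hL (fun m => ae_extend_tileMotion hL c m w)
    ((locallyIntegrable_extend hL c hψ).integrable_smul_right_of_hasCompactSupport hf hc)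

end Unfolding

/-! ### Extended functions are weak solutions -/

section Green

variable {d : ℕ} {L : ℝ} {f φ ψ Φ : EuclideanSpace ℝ (Fin d) → ℝ}

instance isFiniteMeasure_boxMeasure (d : ℕ) (L : ℝ) : IsFiniteMeasure (boxMeasure d L) :=
  ⟨by rw [boxMeasure, Measure.restrict_apply_univ]; exact isCompact_box.measure_lt_top⟩

theorem memLp_boxMeasure_of_continuous {F : Type*} [NormedAddCommGroup F]
    {f : EuclideanSpace ℝ (Fin d) → F} (hf : Continuous f) : MemLp f 2 (boxMeasure d L) := by
  obtain ⟨C, hC⟩ := (isCompact_box (L := L) (x := 0)).exists_bound_of_continuousOn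
    hf.continuousOn
  exact MemLp.of_bound hf.aestronglyMeasurable C
    ((ae_restrict_mem isCompact_box.measurableSet).mono hC)

theorem gradient_add_of_mem_periodicCore (hφ : φ ∈ periodicCore d L) (k : Fin d → ℤ)
    (x : EuclideanSpace ℝ (Fin d)) : ∇ φ (x + L • latticePoint k) = ∇ φ x := by
  rw [gradient, ← fderiv_comp_add_right, funext (hφ.2 k), gradient]

theorem integral_mul_laplacian_foldSum_one (hL : 0 < L) (hφ : φ ∈ periodicCore d L)
    (hf : ContDiff ℝ 2 f) (hc : HasCompactSupport f) :
    ∫ x, φ x * Δ (foldSum 1 L f) x ∂boxMeasure d L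
      = -∫ x, inner ℝ (∇ φ x) (∇ (foldSum 1 L f) x) ∂boxMeasure d L := by
  have hφ₁ : ContDiff ℝ 1 φ := hφ.1.of_le (WithTop.coe_le_coe.2 le_top)
  have hf₁ : ContDiff ℝ 1 f := hf.of_le one_le_two
  have hc_lap : HasCompactSupport (Δ f) :=
    hc.mono' (subset_closure.trans tsupport_laplacian_subset)
  have hc_inner : HasCompactSupport fun y => inner ℝ (∇ φ y) (∇ f y) :=
    (hc.mono' (subset_closure.trans tsupport_gradient_subset)).mono
      fun y hy h0 => hy (by simp [h0])
  have h_inner_int : Integrable fun y => inner ℝ (∇ φ y) (∇ f y) :=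
    ((contDiff_gradient (n := 0) hφ₁).continuous.inner
      (contDiff_gradient (n := 0) hf₁).continuous).integrable_of_hasCompactSupport hc_inner
  have h_fold (x : EuclideanSpace ℝ (Fin d)) :
      ∑' m, inner ℝ (∇ φ (tileMotion 1 L m x)) (∇ f (tileMotion 1 L m x))
        = inner ℝ (∇ φ x) (∇ (foldSum 1 L f) x) := by
    rw [real_inner_comm, inner_gradient_left, fderiv_foldSum_one hL hf₁ hc, foldSum]
    refine tsum_congr fun m => ?_
    rw [tileSign_one, one_mul, ← inner_gradient_left, real_inner_comm, tileMotion_one,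
      gradient_add_of_mem_periodicCore hφ]
  calc ∫ x, φ x * Δ (foldSum 1 L f) x ∂boxMeasure d L
      = ∫ y, φ y * Δ f y := by
        rw [laplacian_foldSum hL hf hc]
        refine (integral_mul_eq_integral_mul_foldSum hL (fun m => .of_forall fun x => ?_)
          ((hφ₁.continuous.mul (continuous_laplacian hf)).integrable_of_hasCompactSupport
            hc_lap.mul_left)).symm
        rw [tileMotion_one, hφ.2, tileSign_one, one_mul]
    _ = -∫ y, inner ℝ (∇ φ y) (∇ f y) := integral_mul_laplacian hφ₁ hf (.inr hc)
    _ = -∫ x, inner ℝ (∇ φ x) (∇ (foldSum 1 L f) x) ∂boxMeasure d L := by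
        rw [integral_eq_integral_tsum_tileMotion hL 1 h_inner_int]
        simp only [h_fold]

theorem integral_mul_laplacian_of_mem_dirichletCore (hφ : φ ∈ dirichletCore d L)
    (hΦ : ContDiff ℝ 2 Φ) :
    ∫ x, φ x * Δ Φ x ∂boxMeasure d L = -∫ x, inner ℝ (∇ φ x) (∇ Φ x) ∂boxMeasure d L := by
  obtain ⟨hφ_smooth, hc, hφ_supp⟩ := hφ
  have h_notMem {x : EuclideanSpace ℝ (Fin d)} (hx : x ∉ box L 0) : x ∉ tsupport φ :=
    fun h => hx (interior_subset (hφ_supp h))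
  rw [boxMeasure, setIntegral_eq_integral_of_forall_compl_eq_zero fun x hx => by
      rw [image_eq_zero_of_notMem_tsupport (h_notMem hx), zero_mul],
    setIntegral_eq_integral_of_forall_compl_eq_zero fun x hx => by
      rw [image_eq_zero_of_notMem_tsupport fun h => h_notMem hx (tsupport_gradient_subset h),
        inner_zero_left]]
  exact integral_mul_laplacian (hφ_smooth.of_le (WithTop.coe_le_coe.2 le_top)) hΦ (.inl hc)

theorem IsFormGradient.integral_mul_laplacian
    {G : EuclideanSpace ℝ (Fin d) → EuclideanSpace ℝ (Fin d)}
    {core : Set (EuclideanSpace ℝ (Fin d) → ℝ)} (hψ : IsFormGradient core L ψ G)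
    (hcore : ∀ φ ∈ core, ContDiff ℝ 1 φ) (hΦ : ContDiff ℝ 2 Φ)
    (h_green : ∀ φ ∈ core, ∫ x, φ x * Δ Φ x ∂boxMeasure d L
      = -∫ x, inner ℝ (∇ φ x) (∇ Φ x) ∂boxMeasure d L) :
    ∫ x, ψ x * Δ Φ x ∂boxMeasure d L = -∫ x, inner ℝ (G x) (∇ Φ x) ∂boxMeasure d L := by
  obtain ⟨hψ₂, hG₂, φ, hφ, hφ_lim, h_grad_lim⟩ := hψ
  have hΔ₂ : MemLp (Δ Φ) 2 (boxMeasure d L) :=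
    memLp_boxMeasure_of_continuous (continuous_laplacian hΦ)
  have h_grad₂ {u : EuclideanSpace ℝ (Fin d) → ℝ} (hu : ContDiff ℝ 1 u) :
      MemLp (∇ u) 2 (boxMeasure d L) :=
    memLp_boxMeasure_of_continuous (contDiff_gradient (n := 0) hu).continuous
  have h_grad_tendsto := tendsto_integral_inner_of_tendsto_eLpNorm
    (fun n => h_grad₂ (hcore _ (hφ n))) hG₂ (fun _ => h_grad₂ (hΦ.of_le one_le_two))
    (h_grad₂ (hΦ.of_le one_le_two)) h_grad_lim (by simp)
  have h_tendsto := tendsto_integral_inner_of_tendsto_eLpNorm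
    (fun n => memLp_boxMeasure_of_continuous (hcore _ (hφ n)).continuous) hψ₂ (fun _ => hΔ₂)
    hΔ₂ hφ_lim (by simp)
  simp only [RCLike.inner_apply, conj_trivial, mul_comm _ (φ _ _), mul_comm _ (ψ _)] at h_tendsto
  exact tendsto_nhds_unique (h_tendsto.congr fun n => h_green _ (hφ n)) h_grad_tendsto.neg

end Green

section VanishingBoundary

theorem ae_gradient_eq_zero_of_eq_zero {E : Type*} [NormedAddCommGroup E]
    [InnerProductSpace ℝ E] [FiniteDimensional ℝ E] [MeasurableSpace E] [BorelSpace E]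
    {f : E → ℝ} (hf : ContDiff ℝ 1 f) : ∀ᵐ x, f x = 0 → ∇ f x = 0 := by
  rcases subsingleton_or_nontrivial E with _ | _
  · exact .of_forall fun x _ => Subsingleton.elim _ _
  obtain ⟨e, he⟩ := exists_ne (0 : E)
  have h_meas : MeasurableSet {x | f x = 0} :=
    (isClosed_eq hf.continuous continuous_const).measurableSet
  have h_approx : ApproximatesLinearOn (fun x => f x • e) (0 : E →L[ℝ] E) {x | f x = 0} 0 :=
    fun x (hx : f x = 0) y (hy : f y = 0) => by simp [hx, hy]
  have h_fderiv := h_approx.norm_fderiv_sub_le volume h_meas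
    (fun x => (fderiv ℝ f x).smulRight e) fun x _ =>
      ((hf.differentiable one_ne_zero x).hasFDerivAt.smul_const e).hasFDerivWithinAt
  filter_upwards [(ae_restrict_iff' h_meas).1 h_fderiv] with x hx hx0
  have h_zero : ‖fderiv ℝ f x‖ = 0 := by
    simpa [he] using hx hx0
  rw [gradient, norm_eq_zero.1 h_zero, map_zero]

/-- A smooth bump function on the line that equals `1` on `[-1, 1]` and vanishes off `(-2, 2)`. -/
def lineBump : ContDiffBump (0 : ℝ) := ⟨1, 2, one_pos, one_lt_two⟩

/-- A smooth approximation of the identity that vanishes near `0`. -/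
noncomputable def softThreshold (t : ℝ) : ℝ := t * (1 - lineBump t)

theorem contDiff_softThreshold {n : ℕ∞} : ContDiff ℝ n softThreshold :=
  contDiff_id.mul (contDiff_const.sub lineBump.contDiff)

theorem softThreshold_eq_zero {t : ℝ} (ht : |t| ≤ 1) : softThreshold t = 0 := by
  rw [softThreshold, lineBump.one_of_mem_closedBall (mem_closedBall_zero_iff.2 ht), sub_self,
    mul_zero]

theorem softThreshold_eq_self {t : ℝ} (ht : 2 ≤ |t|) : softThreshold t = t := by
  rw [softThreshold, lineBump.zero_of_le_dist (ht.trans_eq (dist_zero_right t).symm), sub_zero,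
    mul_one]

theorem abs_softThreshold_le (t : ℝ) : |softThreshold t| ≤ |t| := by
  rw [softThreshold, abs_mul, abs_of_nonneg (sub_nonneg.2 lineBump.le_one)]
  exact mul_le_of_le_one_right (abs_nonneg t) (sub_le_self 1 lineBump.nonneg)

theorem deriv_softThreshold_eq_one {t : ℝ} (ht : 2 < |t|) : deriv softThreshold t = 1 := by
  have h_id : softThreshold =ᶠ[𝓝 t] id :=
    (continuous_abs.continuousAt.eventually (lt_mem_nhds ht)).mono fun s hs =>
      softThreshold_eq_self hs.le
  rw [h_id.deriv_eq, deriv_id]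

theorem exists_abs_deriv_softThreshold_le : ∃ D, ∀ t, |deriv softThreshold t| ≤ D := by
  obtain ⟨D, hD⟩ := (isCompact_closedBall (0 : ℝ) 2).exists_bound_of_continuousOn
    (contDiff_softThreshold.continuous_deriv (n := 1) le_rfl).continuousOn
  refine ⟨max D 1, fun t => ?_⟩
  rcases le_or_gt |t| 2 with ht | ht
  · exact (hD t (by simpa using ht)).trans (le_max_left D 1)
  · simp [deriv_softThreshold_eq_one ht]

theorem eventually_lt_abs_natCast_add_one_mul {t : ℝ} (ht : t ≠ 0) (r : ℝ) :
    ∀ᶠ k : ℕ in atTop, r < |((k : ℝ) + 1) * t| := by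
  have h_tendsto : Tendsto (fun k : ℕ => |((k : ℝ) + 1) * t|) atTop atTop := by
    simp_rw [abs_mul]
    exact (tendsto_abs_atTop_atTop.comp
      (tendsto_natCast_atTop_atTop.atTop_add tendsto_const_nhds)).atTop_mul_const (abs_pos.2 ht)
  exact h_tendsto.eventually_gt_atTop r

variable {d : ℕ} {L s : ℝ} {g Φ : EuclideanSpace ℝ (Fin d) → ℝ}
  {G : EuclideanSpace ℝ (Fin d) → EuclideanSpace ℝ (Fin d)} {x : EuclideanSpace ℝ (Fin d)}

/-- The restriction of a function to the box, with its values of modulus below `s⁻¹` replaced by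
zero: for a function that vanishes on the boundary, an approximation in the Dirichlet core. -/
noncomputable def boxThreshold (L s : ℝ) (Φ : EuclideanSpace ℝ (Fin d) → ℝ) :
    EuclideanSpace ℝ (Fin d) → ℝ :=
  (interior (box L 0)).indicator fun x => s⁻¹ * softThreshold (s * Φ x)

theorem tsupport_boxThreshold_subset (hΦ : Continuous Φ) :
    tsupport (boxThreshold L s Φ) ⊆ box L 0 ∩ {x | 1 ≤ |s * Φ x|} := by
  refine closure_minimal (fun x hx => ?_) (isCompact_box.isClosed.inter
    (isClosed_le continuous_const (continuous_const.mul hΦ).abs))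
  refine ⟨interior_subset (Set.mem_of_indicator_ne_zero hx), ?_⟩
  by_contra h_lt
  refine hx (Set.indicator_apply_eq_zero.2 fun _ => ?_)
  rw [softThreshold_eq_zero (not_le.1 h_lt).le, mul_zero]

theorem boxThreshold_eventuallyEq (hx : x ∈ interior (box L 0)) :
    boxThreshold L s Φ =ᶠ[𝓝 x] fun y => s⁻¹ * softThreshold (s * Φ y) :=
  Filter.mem_of_superset (isOpen_interior.mem_nhds hx) fun _ hy => Set.indicator_of_mem hy _

theorem boxThreshold_mem_dirichletCore (hΦ : ContDiff ℝ ∞ Φ)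
    (h0 : ∀ x ∈ box L 0, x ∉ interior (box L 0) → Φ x = 0) :
    boxThreshold L s Φ ∈ dirichletCore d L := by
  have h_tsupport := tsupport_boxThreshold_subset (L := L) (s := s) hΦ.continuous
  have h_interior : tsupport (boxThreshold L s Φ) ⊆ interior (box L 0) := fun x hx => by
    by_contra h_boundary
    have h_one_le : (1 : ℝ) ≤ |s * Φ x| := (h_tsupport hx).2
    rw [h0 x (h_tsupport hx).1 h_boundary, mul_zero, abs_zero] at h_one_le
    exact absurd h_one_le (by norm_num)
  refine ⟨(contMDiff_of_tsupport fun x hx => ContDiffAt.contMDiffAt ?_).contDiff,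
    .of_isClosed_subset isCompact_box (isClosed_tsupport _)
      (h_tsupport.trans Set.inter_subset_left), h_interior⟩
  exact ((contDiff_const.mul (contDiff_softThreshold.comp
    (contDiff_const.mul hΦ))).contDiffAt).congr_of_eventuallyEq
      (boxThreshold_eventuallyEq (h_interior hx))

theorem gradient_boxThreshold (hs : s ≠ 0) (hΦ : DifferentiableAt ℝ Φ x)
    (hx : x ∈ interior (box L 0)) :
    ∇ (boxThreshold L s Φ) x = deriv softThreshold (s * Φ x) • ∇ Φ x := by
  have h_deriv : HasDerivAt (fun t => s⁻¹ * softThreshold (s * t))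
      (deriv softThreshold (s * Φ x)) (Φ x) := by
    have h_threshold := ((contDiff_softThreshold (n := 1)).differentiable one_ne_zero
      (s * Φ x)).hasDerivAt
    refine ((h_threshold.comp (Φ x) ((hasDerivAt_id (Φ x)).const_mul s)).const_mul
      s⁻¹).congr_deriv ?_
    field_simp
  have h_fderiv : HasFDerivAt (fun y => s⁻¹ * softThreshold (s * Φ y))
      (deriv softThreshold (s * Φ x) • fderiv ℝ Φ x) x :=
    h_deriv.comp_hasFDerivAt x hΦ.hasFDerivAt
  rw [(boxThreshold_eventuallyEq hx).gradient_eq, gradient, h_fderiv.fderiv, map_smul, gradient]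

theorem tendsto_boxThreshold (hx : x ∈ interior (box L 0)) :
    Tendsto (fun k : ℕ => boxThreshold L (k + 1) Φ x) atTop (𝓝 (Φ x)) := by
  by_cases hz : Φ x = 0
  · simp [boxThreshold, Set.indicator_of_mem hx, hz, softThreshold]
  · refine tendsto_const_nhds.congr' ?_
    filter_upwards [eventually_lt_abs_natCast_add_one_mul hz 2] with k hk
    rw [boxThreshold, Set.indicator_of_mem hx, softThreshold_eq_self hk.le,
      inv_mul_cancel_left₀ (by positivity)]

theorem tendsto_gradient_boxThreshold (hΦ : DifferentiableAt ℝ Φ x)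
    (h0 : Φ x = 0 → ∇ Φ x = 0) (hx : x ∈ interior (box L 0)) :
    Tendsto (fun k : ℕ => ∇ (boxThreshold L (k + 1) Φ) x) atTop (𝓝 (∇ Φ x)) := by
  have h_grad (k : ℕ) := gradient_boxThreshold (s := k + 1) (by positivity) hΦ hx
  by_cases hz : Φ x = 0
  · simp [h_grad, h0 hz]
  · refine tendsto_const_nhds.congr' ?_
    filter_upwards [eventually_lt_abs_natCast_add_one_mul hz 2] with k hk
    rw [h_grad, deriv_softThreshold_eq_one hk, one_smul]

theorem abs_boxThreshold_le (hs : s ≠ 0) : |boxThreshold L s Φ x| ≤ |Φ x| := by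
  by_cases hx : x ∈ interior (box L 0)
  · rw [boxThreshold, Set.indicator_of_mem hx, abs_mul, abs_inv]
    refine (mul_le_mul_of_nonneg_left (abs_softThreshold_le _) (by positivity)).trans_eq ?_
    rw [abs_mul, inv_mul_cancel_left₀ (abs_ne_zero.2 hs)]
  · rw [boxThreshold, Set.indicator_of_notMem hx, abs_zero]
    exact abs_nonneg _

theorem tendsto_integral_mul_boxThreshold (hg : MemLp g 2 (boxMeasure d L)) (hΦ : ContDiff ℝ ∞ Φ)
    (h0 : ∀ x ∈ box L 0, x ∉ interior (box L 0) → Φ x = 0) :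
    Tendsto (fun k : ℕ => ∫ x, g x * boxThreshold L (k + 1) Φ x ∂boxMeasure d L) atTop
      (𝓝 (∫ x, g x * Φ x ∂boxMeasure d L)) := by
  refine tendsto_integral_of_dominated_convergence (fun x => ‖g x * Φ x‖) (fun k => ?_)
    (hg.integrable_mul (memLp_boxMeasure_of_continuous hΦ.continuous)).norm
    (fun k => .of_forall fun x => ?_) ?_
  · exact hg.1.mul (boxThreshold_mem_dirichletCore hΦ h0).1.continuous.aestronglyMeasurable
  · rw [norm_mul, norm_mul]
    exact mul_le_mul_of_nonneg_left (abs_boxThreshold_le (by positivity)) (norm_nonneg _)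
  · exact (ae_mem_interior_box d L).mono fun x hx => (tendsto_boxThreshold hx).const_mul _

theorem tendsto_integral_inner_gradient_boxThreshold (hG : MemLp G 2 (boxMeasure d L))
    (hΦ : ContDiff ℝ ∞ Φ) (h0 : ∀ x ∈ box L 0, x ∉ interior (box L 0) → Φ x = 0) :
    Tendsto (fun k : ℕ => ∫ x, inner ℝ (G x) (∇ (boxThreshold L (k + 1) Φ) x) ∂boxMeasure d L)
      atTop (𝓝 (∫ x, inner ℝ (G x) (∇ Φ x) ∂boxMeasure d L)) := by
  obtain ⟨D, hD⟩ := exists_abs_deriv_softThreshold_le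
  have hΦ₁ : ContDiff ℝ 1 Φ := hΦ.of_le (WithTop.coe_le_coe.2 le_top)
  have h_diff : Differentiable ℝ Φ := hΦ₁.differentiable one_ne_zero
  have h_grad_cont {u : EuclideanSpace ℝ (Fin d) → ℝ} (hu : ContDiff ℝ ∞ u) :
      Continuous (∇ u) :=
    (contDiff_gradient (n := 0) (hu.of_le (WithTop.coe_le_coe.2 le_top))).continuous
  refine tendsto_integral_of_dominated_convergence (fun x => ‖G x‖ * (D * ‖∇ Φ x‖)) (fun k => ?_)
    ?_ (fun k => ?_) ?_
  · exact hG.1.inner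
      (h_grad_cont (boxThreshold_mem_dirichletCore hΦ h0).1).aestronglyMeasurable
  · exact hG.norm.integrable_mul
      ((memLp_boxMeasure_of_continuous (h_grad_cont hΦ)).norm.const_mul D)
  · filter_upwards [ae_mem_interior_box d L] with x hx
    refine (norm_inner_le_norm _ _).trans (mul_le_mul_of_nonneg_left ?_ (norm_nonneg _))
    rw [gradient_boxThreshold (by positivity) (h_diff x) hx, norm_smul]
    exact mul_le_mul_of_nonneg_right (hD _) (norm_nonneg _)
  · filter_upwards [ae_mem_interior_box d L,
      ae_restrict_of_ae (ae_gradient_eq_zero_of_eq_zero hΦ₁)] with x hx h_zero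
    exact tendsto_const_nhds.inner (tendsto_gradient_boxThreshold (h_diff x) h_zero hx)

theorem integral_inner_gradient_of_eq_zero_on_boundary (hG : MemLp G 2 (boxMeasure d L))
    (hg : MemLp g 2 (boxMeasure d L))
    (h_weak : ∀ φ ∈ dirichletCore d L, ∫ x, inner ℝ (G x) (∇ φ x) ∂boxMeasure d L
      = -∫ x, g x * φ x ∂boxMeasure d L)
    (hΦ : ContDiff ℝ ∞ Φ) (h0 : ∀ x ∈ box L 0, x ∉ interior (box L 0) → Φ x = 0) :
    ∫ x, inner ℝ (G x) (∇ Φ x) ∂boxMeasure d L = -∫ x, g x * Φ x ∂boxMeasure d L :=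
  tendsto_nhds_unique (tendsto_integral_inner_gradient_boxThreshold hG hΦ h0) <|
    (tendsto_integral_mul_boxThreshold hg hΦ h0).neg.congr fun _ =>
      (h_weak _ (boxThreshold_mem_dirichletCore hΦ h0)).symm

end VanishingBoundary

section WeakExtension

variable {d : ℕ} {L : ℝ} {ψ g : EuclideanSpace ℝ (Fin d) → ℝ}

theorem isWeakSolution_extend_of_foldSum (hL : 0 < L) {c : ℤˣ} (hψ : MemLp ψ 2 (boxMeasure d L))
    (hg : MemLp g 2 (boxMeasure d L))
    (h : ∀ f, ContDiff ℝ ∞ f → HasCompactSupport f →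
      ∫ x, ψ x * Δ (foldSum c L f) x ∂boxMeasure d L
        = ∫ x, g x * foldSum c L f x ∂boxMeasure d L) :
    IsWeakSolution Set.univ (extend c L ψ) (extend c L g) := by
  intro f hf hc _
  have hf₂ : ContDiff ℝ 2 f := hf.of_le (WithTop.coe_le_coe.2 le_top)
  rw [integral_extend_mul hL c hψ (continuous_laplacian hf₂)
      (hc.mono' (subset_closure.trans tsupport_laplacian_subset)),
    integral_extend_mul hL c hg hf.continuous hc, ← laplacian_foldSum hL hf₂ hc, h f hf hc]

theorem isWeakSolution_extend_neg_one (hL : 0 < L) (h : HasDirichletLaplacian L ψ g) :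
    IsWeakSolution Set.univ (extend (-1) L ψ) (extend (-1) L g) := by
  obtain ⟨hg, G, hG, h_weak⟩ := h
  refine isWeakSolution_extend_of_foldSum hL hG.1 hg fun f hf hc => ?_
  have hΦ := contDiff_foldSum hL hf hc (-1)
  have hΦ₂ : ContDiff ℝ 2 (foldSum (-1) L f) := hΦ.of_le (WithTop.coe_le_coe.2 le_top)
  rw [hG.integral_mul_laplacian (fun φ hφ => hφ.1.of_le (WithTop.coe_le_coe.2 le_top)) hΦ₂
      fun φ hφ => integral_mul_laplacian_of_mem_dirichletCore hφ hΦ₂,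
    integral_inner_gradient_of_eq_zero_on_boundary hG.2.1 hg h_weak hΦ
      fun x => foldSum_neg_one_eq_zero f, neg_neg]

theorem isWeakSolution_extend_one (hL : 0 < L) (h : HasPeriodicLaplacian L ψ g) :
    IsWeakSolution Set.univ (extend 1 L ψ) (extend 1 L g) := by
  obtain ⟨hg, G, hG, h_weak⟩ := h
  refine isWeakSolution_extend_of_foldSum hL hG.1 hg fun f hf hc => ?_
  have hf₂ : ContDiff ℝ 2 f := hf.of_le (WithTop.coe_le_coe.2 le_top)
  rw [hG.integral_mul_laplacian (fun φ hφ => hφ.1.of_le (WithTop.coe_le_coe.2 le_top))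
      (contDiff_foldSum hL hf₂ hc 1)
      fun φ hφ => integral_mul_laplacian_foldSum_one hL hφ hf₂ hc,
    h_weak _ (foldSum_one_mem_periodicCore hL hf hc), neg_neg]

end WeakExtension

/-! ### From balls to boxes -/

section Covering

variable {α ι : Type*} [MeasurableSpace α] {μ : Measure α} {F : α → ℝ} {S : Finset ι}
  {B : ι → Set α} {A D : Set α}

theorem setIntegral_le_sum_setIntegral (hAB : A ⊆ ⋃ k ∈ S, B k)
    (hF : ∀ k ∈ S, IntegrableOn F (B k) μ) (hF0 : ∀ x, 0 ≤ F x) :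
    ∫ x in A, F x ∂μ ≤ ∑ k ∈ S, ∫ x in B k, F x ∂μ := by
  have h_le : μ.restrict A ≤ ∑ k ∈ S, μ.restrict (B k) := Measure.le_iff.2 fun t ht => by
    rw [Measure.finsetSum_apply, Measure.restrict_apply ht]
    simp only [Measure.restrict_apply ht]
    refine (measure_mono ?_).trans (measure_biUnion_finset_le S fun k => t ∩ B k)
    rw [← Set.inter_iUnion₂]
    exact Set.inter_subset_inter_right t hAB
  rw [← integral_finsetSum_measure hF]
  exact integral_mono_measure h_le (.of_forall hF0) (integrable_finsetSum_measure.2 hF)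

open scoped Classical in
theorem sum_setIntegral_le_mul_setIntegral {n : ℕ} (hB : ∀ k ∈ S, MeasurableSet (B k))
    (hD : MeasurableSet D) (hBD : ∀ k ∈ S, B k ⊆ D) (hF : IntegrableOn F D μ)
    (hF0 : ∀ x, 0 ≤ F x) (h_card : ∀ x, (S.filter (x ∈ B ·)).card ≤ n) :
    ∑ k ∈ S, ∫ x in B k, F x ∂μ ≤ n * ∫ x in D, F x ∂μ := by
  have h_int : ∀ k ∈ S, Integrable ((B k).indicator F) μ := fun k hk =>
    (integrable_indicator_iff (hB k hk)).2 (hF.mono_set (hBD k hk))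
  calc ∑ k ∈ S, ∫ x in B k, F x ∂μ = ∫ x, ∑ k ∈ S, (B k).indicator F x ∂μ := by
        rw [integral_finsetSum _ h_int]
        exact Finset.sum_congr rfl fun k hk => (integral_indicator (hB k hk)).symm
    _ ≤ ∫ x, n * D.indicator F x ∂μ := by
        refine integral_mono (integrable_finsetSum _ h_int)
          (((integrable_indicator_iff hD).2 hF).const_mul _) fun x => ?_
        calc ∑ k ∈ S, (B k).indicator F x
            ≤ ∑ k ∈ S, if x ∈ B k then D.indicator F x else 0 :=
              Finset.sum_le_sum fun k hk => by
                rw [Set.indicator_apply]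
                split_ifs with hx
                exacts [(Set.indicator_of_mem (hBD k hk hx) F).ge, le_rfl]
          _ = (S.filter (x ∈ B ·)).card * D.indicator F x := by
              rw [← Finset.sum_filter, Finset.sum_const, nsmul_eq_mul]
          _ ≤ n * D.indicator F x := by
              gcongr
              exacts [Set.indicator_nonneg (fun y _ => hF0 y) x, h_card x]
    _ = n * ∫ x in D, F x ∂μ := by rw [integral_const_mul, integral_indicator hD]

end Covering

section UnitCubes

variable {d : ℕ} {L : ℕ} {δ : ℝ} {k : Fin d → ℤ} {p y : EuclideanSpace ℝ (Fin d)}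

theorem abs_intCast_le_of_lt (hL : Odd L) {n : ℤ} (hn : |(n : ℝ)| < (L + 1) / 2) :
    |(n : ℝ)| ≤ (L - 1) / 2 := by
  obtain ⟨a, rfl⟩ := hL
  push_cast at hn ⊢
  have h_lt : |(n : ℝ)| < (a : ℤ) + 1 := hn.trans_eq (by push_cast; ring)
  have h_le : |n| ≤ (a : ℤ) := Int.lt_add_one_iff.1 (by exact_mod_cast h_lt)
  calc |(n : ℝ)| ≤ (a : ℤ) := by exact_mod_cast h_le
    _ = (2 * a + 1 - 1) / 2 := by push_cast; ring

theorem mem_sites_of_odd (hL : Odd L) :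
    k ∈ sites d L ↔ ∀ i, |(k i : ℝ)| ≤ (L - 1) / 2 := by
  simp only [mem_sites, mem_box, latticePoint, PiLp.zero_apply, sub_zero]
  exact ⟨fun h i => abs_intCast_le_of_lt hL ((h i).trans_lt (by linarith)),
    fun h i => (h i).trans (by linarith)⟩

theorem box_one_subset_box (hL : Odd L) (hk : k ∈ sites d L) :
    box 1 (latticePoint k) ⊆ box (L : ℝ) 0 := fun y hy => mem_box.2 fun i =>
  calc |y i - 0| ≤ |y i - k i| + |(k i : ℝ)| := by simpa using abs_sub_le (y i) (k i) 0
    _ ≤ 1 / 2 + (L - 1) / 2 := add_le_add (mem_box.1 hy i) ((mem_sites_of_odd hL).1 hk i)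
    _ = L / 2 := by ring

theorem interior_box_subset_biUnion_box_one (hL : Odd L) :
    interior (box (L : ℝ) (0 : EuclideanSpace ℝ (Fin d)))
      ⊆ ⋃ k ∈ sites d L, box 1 (latticePoint k) := by
  intro y hy
  refine Set.mem_iUnion₂.2 ⟨fun i => round (y i), (mem_sites_of_odd hL).2 fun i => ?_,
    mem_box.2 fun i => abs_sub_round (y i)⟩
  refine abs_intCast_le_of_lt hL ?_
  calc |(round (y i) : ℝ)| ≤ |round (y i) - y i| + |y i| := by
        simpa using abs_sub_le (round (y i) : ℝ) (y i) 0
    _ < 1 / 2 + L / 2 := by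
        refine add_lt_add_of_le_of_lt (abs_sub_comm (y i) _ ▸ abs_sub_round (y i)) ?_
        simpa using mem_interior_box.1 hy i
    _ = (L + 1) / 2 := by ring

theorem mem_sites_of_mem_interior_box_one (hL : Odd L)
    (hy : y ∈ interior (box 1 (latticePoint k))) (hyL : y ∈ box (L : ℝ) 0) : k ∈ sites d L := by
  refine (mem_sites_of_odd hL).2 fun i => abs_intCast_le_of_lt hL ?_
  calc |(k i : ℝ)| ≤ |k i - y i| + |y i| := by simpa using abs_sub_le (k i : ℝ) (y i) 0
    _ < 1 / 2 + L / 2 := by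
        refine add_lt_add_of_lt_of_le (abs_sub_comm (y i) _ ▸ mem_interior_box.1 hy i) ?_
        simpa using mem_box.1 hyL i
    _ = (L + 1) / 2 := by ring

theorem pairwise_disjoint_interior_box_one (d : ℕ) :
    Pairwise (Function.onFun Disjoint fun k : Fin d → ℤ => interior (box 1 (latticePoint k))) := by
  refine fun k l hkl => Set.disjoint_left.2 fun y hk hl => hkl (funext fun i => ?_)
  have h_lt : |(k i : ℝ) - l i| < 1 :=
    calc |(k i : ℝ) - l i| ≤ |k i - y i| + |y i - l i| := abs_sub_le _ _ _
      _ < 1 / 2 + 1 / 2 := add_lt_add (abs_sub_comm (y i) _ ▸ mem_interior_box.1 hk i)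
          (mem_interior_box.1 hl i)
      _ = 1 := by norm_num
  exact sub_eq_zero.1 (Int.abs_lt_one_iff.1 (by exact_mod_cast h_lt))

variable {z : (Fin d → ℤ) → EuclideanSpace ℝ (Fin d)}

theorem ballUnion_eq_biUnion_sites (hL : Odd L)
    (hz : ∀ k, Metric.ball (z k) δ ⊆ box 1 (latticePoint k)) :
    ballUnion L δ z = ⋃ k ∈ sites d L, Metric.ball (z k) δ := by
  refine Set.Subset.antisymm ?_ (Set.iUnion₂_subset fun k hk y hy =>
    ⟨Set.mem_iUnion.2 ⟨k, hy⟩, box_one_subset_box hL hk (hz k hy)⟩)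
  rintro y ⟨hy, hyL⟩
  obtain ⟨k, hk⟩ := Set.mem_iUnion.1 hy
  have h_interior := interior_maximal (hz k) Metric.isOpen_ball hk
  exact Set.mem_iUnion₂.2 ⟨k, mem_sites_of_mem_interior_box_one hL h_interior hyL, hk⟩

theorem setIntegral_ballUnion (hL : Odd L)
    (hz : ∀ k, Metric.ball (z k) δ ⊆ box 1 (latticePoint k)) {F : EuclideanSpace ℝ (Fin d) → ℝ}
    (hF : Integrable F (boxMeasure d L)) :
    ∫ x in ballUnion L δ z, F x = ∑ k ∈ sites d L, ∫ x in Metric.ball (z k) δ, F x := by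
  have h_interior (k : Fin d → ℤ) := interior_maximal (hz k) Metric.isOpen_ball
  rw [ballUnion_eq_biUnion_sites hL hz]
  exact integral_biUnion_finset _ (fun k _ => measurableSet_ball)
    (fun k _ l _ hkl =>
      (pairwise_disjoint_interior_box_one d hkl).mono (h_interior k) (h_interior l))
    fun k hk => IntegrableOn.mono_set hF ((hz k).trans (box_one_subset_box hL hk))

theorem box_one_subset_closedBall {q : EuclideanSpace ℝ (Fin d)} (hp : p ∈ box 1 q) :
    box 1 q ⊆ Metric.closedBall p √d := by
  intro y hy
  rw [Metric.mem_closedBall, EuclideanSpace.dist_eq]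
  refine Real.sqrt_le_sqrt ?_
  have h_coord (i : Fin d) : dist (y i) (p i) ^ 2 ≤ 1 := by
    refine pow_le_one₀ dist_nonneg ((dist_triangle_right _ _ (q i)).trans ?_)
    exact (add_le_add (mem_box.1 hy i) (mem_box.1 hp i)).trans_eq (by norm_num)
  simpa using Finset.sum_le_card_nsmul Finset.univ _ 1 fun i _ => h_coord i

theorem abs_sub_intCast_le_of_mem_closedBall {s : ℝ} (hp : p ∈ box 1 (latticePoint k))
    (hy : y ∈ Metric.closedBall p s) (i : Fin d) : |y i - k i| ≤ s + 1 / 2 :=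
  calc |y i - k i| ≤ |y i - p i| + |p i - k i| := abs_sub_le _ _ _
    _ ≤ s + 1 / 2 := add_le_add
        ((PiLp.norm_apply_le (y - p) i).trans (mem_closedBall_iff_norm.1 hy)) (mem_box.1 hp i)

theorem mem_latticeCube_round {s : ℝ} {M : ℕ} (hM : s + 1 ≤ M) (hp : p ∈ box 1 (latticePoint k))
    (hy : y ∈ Metric.closedBall p s) : k ∈ latticeCube (fun i => round (y i)) M := by
  refine mem_latticeCube.2 fun i => ?_
  have h_le : |(k i : ℝ) - round (y i)| ≤ M :=
    calc |(k i : ℝ) - round (y i)| ≤ |k i - y i| + |y i - round (y i)| := abs_sub_le _ _ _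
      _ ≤ s + 1 / 2 + 1 / 2 := by
          refine add_le_add ?_ (abs_sub_round (y i))
          exact abs_sub_comm (y i) _ ▸ abs_sub_intCast_le_of_mem_closedBall hp hy i
      _ ≤ M := by linarith
  exact_mod_cast h_le

theorem closedBall_subset_biUnion_tile {s : ℝ} {M : ℕ} (hL : 0 < L) (hM : s + 1 ≤ M)
    (hk : k ∈ sites d L) (hp : p ∈ box 1 (latticePoint k)) :
    Metric.closedBall p s ⊆ ⋃ m ∈ latticeCube (0 : Fin d → ℤ) M, tile L m := by
  intro y hy
  have hs : 0 ≤ s := dist_nonneg.trans hy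
  have hL1 : (1 : ℝ) ≤ L := by exact_mod_cast hL
  refine mem_biUnion_tile (by positivity) fun i => ?_
  calc |y i| ≤ |y i - k i| + |(k i : ℝ)| := by simpa using abs_sub_le (y i) (k i) 0
    _ ≤ s + 1 / 2 + L / 2 := by
        refine add_le_add (abs_sub_intCast_le_of_mem_closedBall hp hy i) ?_
        simpa [latticePoint] using mem_box.1 (mem_sites.1 hk) i
    _ ≤ M * L := by nlinarith

end UnitCubes

section BoxEstimate

variable {d L : ℕ} {δ : ℝ} {z : (Fin d → ℤ) → EuclideanSpace ℝ (Fin d)}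
  {ψ g : EuclideanSpace ℝ (Fin d) → ℝ}

theorem integrableOn_closedBall_extend_sq (hL : 0 < L) (c : ℤˣ) (hψ : MemLp ψ 2 (boxMeasure d L))
    (p : EuclideanSpace ℝ (Fin d)) (s : ℝ) :
    IntegrableOn (fun x => extend c L ψ x ^ 2) (Metric.closedBall p s) :=
  (memLp_restrict_extend (Nat.cast_pos.2 hL) c hψ Metric.isBounded_closedBall).integrable_sq

theorem setIntegral_closedBall_extend_sq (hL : 0 < L) (c : ℤˣ) {p : EuclideanSpace ℝ (Fin d)}
    (hδ : δ ≠ 0) (hp : Metric.ball p δ ⊆ box L 0) (ψ : EuclideanSpace ℝ (Fin d) → ℝ) :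
    ∫ x in Metric.closedBall p δ, extend c L ψ x ^ 2 = ∫ x in Metric.ball p δ, ψ x ^ 2 := by
  have h_ae : Metric.ball p δ =ᵐ[volume] Metric.closedBall p δ := by
    rw [← interior_closedBall p hδ]
    exact interior_ae_eq_of_null_frontier ((convex_closedBall p δ).addHaar_frontier volume)
  rw [← setIntegral_congr_set h_ae]
  refine setIntegral_congr_fun measurableSet_ball fun x hx => ?_
  simp only [extend_of_mem_interior_box (Nat.cast_pos.2 hL)
    (interior_maximal hp Metric.isOpen_ball hx)]

theorem integral_sq_le_sum_closedBall (hL : Odd L) (c : ℤˣ) (hψ : MemLp ψ 2 (boxMeasure d L))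
    (hz : ∀ k, z k ∈ box 1 (latticePoint k)) :
    ∫ x, ψ x ^ 2 ∂boxMeasure d L
      ≤ ∑ k ∈ sites d L, ∫ x in Metric.closedBall (z k) √d, extend c L ψ x ^ 2 := by
  have h_cover : interior (box (L : ℝ) 0) ⊆ ⋃ k ∈ sites d L, Metric.closedBall (z k) √d :=
    (interior_box_subset_biUnion_box_one hL).trans
      (Set.iUnion₂_mono fun k _ => box_one_subset_closedBall (hz k))
  calc ∫ x, ψ x ^ 2 ∂boxMeasure d L
      = ∫ x in interior (box (L : ℝ) 0), extend c L ψ x ^ 2 := by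
        rw [← restrict_interior_box]
        refine setIntegral_congr_fun isOpen_interior.measurableSet fun x hx => ?_
        simp only [extend_of_mem_interior_box (Nat.cast_pos.2 hL.pos) hx]
    _ ≤ _ := setIntegral_le_sum_setIntegral h_cover
        (fun k _ => integrableOn_closedBall_extend_sq hL.pos c hψ (z k) √d) fun x => sq_nonneg _

theorem sum_closedBall_le_integral_sq (hL : 0 < L) (c : ℤˣ) (hψ : MemLp ψ 2 (boxMeasure d L))
    (hz : ∀ k, z k ∈ box 1 (latticePoint k)) {s : ℝ} {M : ℕ} (hM : s + 1 ≤ M) :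
    ∑ k ∈ sites d L, ∫ x in Metric.closedBall (z k) s, extend c L ψ x ^ 2
      ≤ ((2 * (M : ℝ) + 1) ^ d) ^ 2 * ∫ x, ψ x ^ 2 ∂boxMeasure d L := by
  classical
  have hL' : (0 : ℝ) < L := Nat.cast_pos.2 hL
  calc ∑ k ∈ sites d L, ∫ x in Metric.closedBall (z k) s, extend c L ψ x ^ 2
      ≤ ((2 * M + 1) ^ d : ℕ)
          * ∫ x in ⋃ m ∈ latticeCube (0 : Fin d → ℤ) M, tile (L : ℝ) m, extend c L ψ x ^ 2 := by
        refine sum_setIntegral_le_mul_setIntegral (fun k _ => measurableSet_closedBall)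
          (Finset.measurableSet_biUnion _ fun m _ => measurableSet_tile L m)
          (fun k hk => closedBall_subset_biUnion_tile hL hM hk (hz k))
          (memLp_biUnion_tile_extend hL' c hψ _).integrable_sq (fun x => sq_nonneg _) fun x => ?_
        rw [← card_latticeCube fun i => round (x i)]
        exact Finset.card_le_card fun k hk =>
          mem_latticeCube_round hM (hz k) (Finset.mem_filter.1 hk).2
    _ = ((2 * M + 1) ^ d) ^ 2 * ∫ x, ψ x ^ 2 ∂boxMeasure d L := by
        rw [setIntegral_biUnion_tile_extend_sq hL' c hψ, card_latticeCube, ← mul_assoc, ← sq]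
        push_cast
        rfl

theorem integral_sq_le_two_mul_sum {A s : ℝ} {M : ℕ} (hL : Odd L) (c : ℤˣ)
    (hψ : MemLp ψ 2 (boxMeasure d L)) (hδ : 0 < δ)
    (hz : ∀ k, Metric.ball (z k) δ ⊆ box 1 (latticePoint k)) (hM : s + 1 ≤ M)
    (h_local : ∀ p : EuclideanSpace ℝ (Fin d),
      ∫ x in Metric.closedBall p √d, extend c L ψ x ^ 2
        ≤ A * (∫ x in Metric.closedBall p δ, extend c L ψ x ^ 2)
          + (2 * ((2 * (M : ℝ) + 1) ^ d) ^ 2)⁻¹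
            * ∫ x in Metric.closedBall p s, extend c L ψ x ^ 2) :
    ∫ x, ψ x ^ 2 ∂boxMeasure d L
      ≤ 2 * A * ∑ k ∈ sites d L, ∫ x in Metric.ball (z k) δ, ψ x ^ 2 := by
  have hz' (k : Fin d → ℤ) : z k ∈ box 1 (latticePoint k) := hz k (Metric.mem_ball_self hδ)
  set P : ℝ := ((2 * (M : ℝ) + 1) ^ d) ^ 2
  have hP : 0 < P := by positivity
  have h_half : ∫ x, ψ x ^ 2 ∂boxMeasure d L
      ≤ A * (∑ k ∈ sites d L, ∫ x in Metric.ball (z k) δ, ψ x ^ 2)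
        + (∫ x, ψ x ^ 2 ∂boxMeasure d L) / 2 :=
    calc ∫ x, ψ x ^ 2 ∂boxMeasure d L
        ≤ ∑ k ∈ sites d L, ∫ x in Metric.closedBall (z k) √d, extend c L ψ x ^ 2 :=
          integral_sq_le_sum_closedBall hL c hψ hz'
      _ ≤ ∑ k ∈ sites d L, (A * (∫ x in Metric.ball (z k) δ, ψ x ^ 2)
            + (2 * P)⁻¹ * ∫ x in Metric.closedBall (z k) s, extend c L ψ x ^ 2) :=
          Finset.sum_le_sum fun k hk => by
            rw [← setIntegral_closedBall_extend_sq hL.pos c hδ.ne'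
              ((hz k).trans (box_one_subset_box hL hk)) ψ]
            exact h_local (z k)
      _ ≤ A * (∑ k ∈ sites d L, ∫ x in Metric.ball (z k) δ, ψ x ^ 2)
            + (2 * P)⁻¹ * (P * ∫ x, ψ x ^ 2 ∂boxMeasure d L) := by
          rw [Finset.sum_add_distrib, ← Finset.mul_sum, ← Finset.mul_sum]
          gcongr
          exact sum_closedBall_le_integral_sq hL.pos c hψ hz' hM
      _ = _ := by
          field_simp
  linarith

theorem exists_isWeakSolution_extend {L : ℝ} (hL : 0 < L)
    (h : HasDirichletLaplacian L ψ g ∨ HasPeriodicLaplacian L ψ g) :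
    ∃ c : ℤˣ, IsWeakSolution Set.univ (extend c L ψ) (extend c L g) :=
  h.elim (fun h => ⟨-1, isWeakSolution_extend_neg_one hL h⟩)
    fun h => ⟨1, isWeakSolution_extend_one hL h⟩

theorem memLp_of_hasLaplacian {L : ℝ}
    (h : HasDirichletLaplacian L ψ g ∨ HasPeriodicLaplacian L ψ g) :
    MemLp ψ 2 (boxMeasure d L) ∧ MemLp g 2 (boxMeasure d L) := by
  rcases h with ⟨hg, _, hψ, _⟩ | ⟨hg, _, hψ, _⟩ <;> exact ⟨hψ.1, hg⟩

theorem scale_free_unique_continuation (d : ℕ) (hd : 1 ≤ d) :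
    ∃ C : ℝ, 1 ≤ C ∧ ∀ K δ : ℝ, 0 ≤ K → 0 < δ → δ ≤ 1 →
      ∃ A : ℝ, 0 ≤ A ∧ A ≤ (C / δ) ^ (C + C * K ^ (2 / 3 : ℝ)) ∧
        ∀ L : ℕ, Odd L → ∀ z : (Fin d → ℤ) → EuclideanSpace ℝ (Fin d),
        (∀ k, Metric.ball (z k) δ ⊆ box 1 (latticePoint k)) →
        ∀ ψ g : EuclideanSpace ℝ (Fin d) → ℝ,
        (HasDirichletLaplacian (L : ℝ) ψ g ∨ HasPeriodicLaplacian (L : ℝ) ψ g) →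
        (∀ᵐ x ∂boxMeasure d L, |g x| ≤ K * |ψ x|) →
        ∫ x, ψ x ^ 2 ∂boxMeasure d L
          ≤ 2 * A * ∑ k ∈ sites d L, ∫ x in Metric.ball (z k) δ, ψ x ^ 2 := by
  have hr : 1 ≤ √(d : ℝ) := Real.one_le_sqrt.2 (by exact_mod_cast hd)
  obtain ⟨M, hM⟩ := exists_nat_ge (32 * √(d : ℝ) + 1)
  obtain ⟨C, hC, h_local⟩ := local_unique_continuation (EuclideanSpace ℝ (Fin d)) hr
    (by positivity : (0 : ℝ) < (2 * ((2 * (M : ℝ) + 1) ^ d) ^ 2)⁻¹)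
  refine ⟨C, hC, fun K δ hK hδ hδ1 => ?_⟩
  obtain ⟨A, hA, hAC, h_local⟩ := h_local K δ hK hδ hδ1
  refine ⟨A, hA, hAC, fun L hL z hz ψ g h_lap hgψ => ?_⟩
  have hL' : (0 : ℝ) < L := Nat.cast_pos.2 hL.pos
  obtain ⟨hψ, hg⟩ := memLp_of_hasLaplacian h_lap
  obtain ⟨c, h_weak⟩ := exists_isWeakSolution_extend hL' h_lap
  exact integral_sq_le_two_mul_sum hL c hψ hδ hz hM fun p =>
    h_local _ _ p (h_weak.mono (Set.subset_univ _))
      (memLp_restrict_extend hL' c hψ Metric.isBounded_ball)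
      (aestronglyMeasurable_extend hL' c hg.1).restrict
      (ae_restrict_of_ae (ae_abs_extend_le hL' hgψ))

theorem div_rpow_le_inv_two_mul_add_one {A C δ t : ℝ} (hC : 1 ≤ C) (hδ : 0 < δ) (hδ1 : δ ≤ 1)
    (ht : 0 ≤ t) (hA : 0 ≤ A) (hAC : A ≤ (C / δ) ^ (C + C * t)) :
    (δ / (4 * C)) ^ (4 * C + 4 * C * t) ≤ (2 * (A + 1))⁻¹ := by
  have hCt : 0 ≤ C * t := by positivity
  have h_base : 1 ≤ C / δ := (one_le_div hδ).2 (hδ1.trans hC)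
  rw [← inv_div (4 * C) δ, Real.inv_rpow (by positivity)]
  refine inv_anti₀ (by positivity) ?_
  calc 2 * (A + 1) ≤ 4 * (C / δ) ^ (C + C * t) := by
        linarith [Real.one_le_rpow h_base (by positivity : 0 ≤ C + C * t)]
    _ ≤ 4 ^ (C + C * t) * (C / δ) ^ (C + C * t) := by
        gcongr
        exact Real.self_le_rpow_of_one_le (by norm_num) (by linarith)
    _ = (4 * C / δ) ^ (C + C * t) := by
        rw [← Real.mul_rpow (by norm_num) (by positivity), mul_div_assoc]
    _ ≤ (4 * C / δ) ^ (4 * C + 4 * C * t) :=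
        Real.rpow_le_rpow_of_exponent_le (by rw [mul_div_assoc]; linarith) (by linarith)

end BoxEstimate

end ScaleFreeUCP

theorem theorem2p1 (d : ℕ) (hd : 1 ≤ d) :
    ∃ C : ℝ, 0 < C ∧ ∀ K δ : ℝ, 0 ≤ K → 0 < δ → δ ≤ 1 →
      ∃ Csf : ℝ, 0 < Csf ∧ (δ / C) ^ (C + C * K ^ (2 / 3 : ℝ)) ≤ Csf ∧
        ∀ L : ℕ, Odd L →
        ∀ z : (Fin d → ℤ) → EuclideanSpace ℝ (Fin d),
        (∀ k, Metric.ball (z k) δ ⊆ ScaleFreeUCP.box 1 (ScaleFreeUCP.latticePoint k)) →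
        ∀ V : EuclideanSpace ℝ (Fin d) → ℝ, Measurable V →
        (∀ x ∈ ScaleFreeUCP.box (L : ℝ) 0, V x ∈ Set.Icc (-K) K) →
        ∀ ψ Δψ : EuclideanSpace ℝ (Fin d) → ℝ,
        (ScaleFreeUCP.HasDirichletLaplacian L ψ Δψ ∨
          ScaleFreeUCP.HasPeriodicLaplacian L ψ Δψ) →
        (∀ᵐ x ∂(ScaleFreeUCP.boxMeasure d L), |Δψ x| ≤ |V x * ψ x|) →
        ScaleFreeUCP.ballUnion (L : ℝ) δ z =
            ⋃ k ∈ ScaleFreeUCP.sites d L, Metric.ball (z k) δ ∧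
          ∫ x in ScaleFreeUCP.ballUnion (L : ℝ) δ z, |ψ x| ^ 2 =
            ∑ k ∈ ScaleFreeUCP.sites d L, ∫ x in Metric.ball (z k) δ, |ψ x| ^ 2 ∧
          Csf * ∫ x in ScaleFreeUCP.box (L : ℝ) 0, |ψ x| ^ 2 ≤
            ∑ k ∈ ScaleFreeUCP.sites d L, ∫ x in Metric.ball (z k) δ, |ψ x| ^ 2 := by
  obtain ⟨C, hC, h⟩ := ScaleFreeUCP.scale_free_unique_continuation d hd
  refine ⟨4 * C, by linarith, fun K δ hK hδ hδ1 => ?_⟩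
  obtain ⟨A, hA, hAC, h⟩ := h K δ hK hδ hδ1
  refine ⟨(2 * (A + 1))⁻¹, by positivity,
    ScaleFreeUCP.div_rpow_le_inv_two_mul_add_one hC hδ hδ1 (by positivity) hA hAC,
    fun L hL z hz V _ hV ψ g h_lap hgV => ?_⟩
  have hgψ : ∀ᵐ x ∂ScaleFreeUCP.boxMeasure d L, |g x| ≤ K * |ψ x| := by
    filter_upwards [hgV, ae_restrict_mem ScaleFreeUCP.isCompact_box.measurableSet] with x hx hxL
    exact (hx.trans_eq (abs_mul _ _)).trans
      (mul_le_mul_of_nonneg_right (abs_le.2 (hV x hxL)) (abs_nonneg _))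
  have hψ_sq := (ScaleFreeUCP.memLp_of_hasLaplacian h_lap).1.integrable_sq
  have h_nonneg : 0 ≤ ∑ k ∈ ScaleFreeUCP.sites d L, ∫ x in Metric.ball (z k) δ, ψ x ^ 2 :=
    Finset.sum_nonneg fun k _ => integral_nonneg fun x => sq_nonneg _
  simp only [sq_abs]
  refine ⟨ScaleFreeUCP.ballUnion_eq_biUnion_sites hL hz,
    ScaleFreeUCP.setIntegral_ballUnion hL hz hψ_sq, (inv_mul_le_iff₀ (by positivity)).2 ?_⟩
  exact (h L hL z hz ψ g h_lap hgψ).trans (mul_le_mul_of_nonneg_right (by linarith) h_nonneg)
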